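/- Let $M$ be a complex manifold of complex dimension $n\ge 2$ (not necessarily compact) with a smooth Hermitian metric $g$ and fundamental form $\omega=\sqrt{-1}\,g_{r\bar s}\,dz^r\wedge d\bar z^s$, and let $\nabla$ be the Levi-Civita connection of $g$. A real $(n-1,n-1)$-form $\varphi$ is called positive if $\varphi(u_1,Ju_1,\dots,u_{n-1},Ju_{n-1})>0$ for all complex linearly independent tangent vectors $u_1,\dots,u_{n-1}$ at a point, where $J$ is the complex structure. Let $$C^\infty_\omega(M)=\{v\in C^\infty(M,\mathbb R):\ \omega^{n-1}+\sqrt{-1}\,\partial\bar\partial(v\,\omega^{n-2})>0\}.$$ For every $v\in C^\infty_\omega(M)$ there is exactly one smooth Hermitian metric $g_v$ whose fundamental form $\omega_v$ satisfies $\omega_v^{n-1}=\omega^{n-1}+\sqrt{-1}\,\partial\bar\partial(v\,\omega^{n-2})$. Let $s_v$ be its Chern scalar curvature, i.e. $s_v=\sum g_v^{\bar j i}R_{i\bar j k}{}^{k}$, where $R_{i\bar jk}{}^{l}=-\partial_{\bar j}\Gamma^l_{ik}$ and $\Gamma^l_{ik}=\sum_q (\partial_i (g_v)_{k\bar q})\,g_v^{\bar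 q l}$ are the curvature and the coefficients of the Chern connection of $g_v$ (so $s_v=-g_v^{\bar k r}\partial_r\partial_{\bar k}\log\det g_v$). Then $v\mapsto s_v$ is a quasi-linear strongly elliptic operator of order four on $C^\infty_\omega(M)$, in the following sense. Let $\mathcal D$ be the set of all $(x,\psi_0,\psi_1,\psi_2,\psi_3)$ with $x\in M$ and $\psi_k\in\otimes^kT^*_xM$ such that $\omega^{n-1}+\sqrt{-1}\,\partial\bar\partial(u\,\omega^{n-2})$ is positive at $x$ for some real function $u$, smooth near $x$, with $u(x)=\psi_0$, $\nabla u(x)=\psi_1$ and $\nabla^2u(x)$ equal to the symmetric part of $\psi_2$. Then $(x,v,\nabla v,\nabla^2v,\nabla^3v)(x)\in\mathcal D$ for all $v\in C^\infty_\omega(M)$ and $x\in M$, and there are tensors $E_1,E_2$ of type $(2,0)$ at $x$ and a real function $b$, all depending smoothly on $(x,\psi_0,\dots,\psi_3)\in\mathcal D$, such that for every $v\in C^\infty_\omega(M)$ and $x\in M$ $$s_v(x)=-E_1^{ij}E_2^{kl}\,\nabla^4_{ijkl}v(x)+b,$$ where $E_1$, $E_2$ and $b$ are evaluated at $(x,v,\nabla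 v,\nabla^2v,\nabla^3v)(x)$. Moreover, for every holomorphic chart of the atlas and every compact set $K\subset\mathcal D$ lying over the domain of that chart there is $\lambda>0$ such that for both $k=1,2$ $$E_k^{ij}(x,\psi_0,\dots,\psi_3)\,\xi_i\xi_j\ \ge\ \lambda\,|\xi|_g^2\qquad\text{for all }(x,\psi_0,\dots,\psi_3)\in K\text{ and }\xi\in T_x^*M.$$ -/

import Mathlib

set_option maxSynthPendingDepth 3

open scoped ContDiff Manifold

noncomputable section

/-! ## Complex manifolds and Hermitian metrics

A complex manifold of dimension `n` is a space `M` with holomorphic charts in `ℂⁿ`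
(`IsManifold 𝓘(ℂ, CSpace n) ω M`).  Smooth real objects on `M` are smooth for the underlying real
manifold structure.  As everywhere in Mathlib, the real tangent space `TangentSpace 𝓘(ℝ, CSpace n) x`
is the vector space `ℂⁿ`, identified with `T_x M` through the differential at `x` of the preferred
chart `chartAt (CSpace n) x`.  Tensors at `x` are therefore tensors on `ℂⁿ`, and the value at `x` of
a tensor field that is given by coordinate expressions is computed in this chart. -/

/-- The model space `ℂⁿ`. -/
abbrev CSpace (n : ℕ) : Type := EuclideanSpace ℂ (Fin n)

/-- Real bilinear forms on `ℂⁿ`. -/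
abbrev RealBilin (n : ℕ) : Type := CSpace n →L[ℝ] CSpace n →L[ℝ] ℝ

/-- Complex-valued alternating real `k`-forms on `ℂⁿ`. -/
abbrev CForm (n k : ℕ) : Type := CSpace n [⋀^Fin k]→L[ℝ] ℂ

/-- Real covariant `k`-tensors on `ℂⁿ`. -/
abbrev CovTensor (n k : ℕ) : Type := CSpace n [×k]→L[ℝ] ℝ

/-- The complex structure of `ℂⁿ` as a real linear map. -/
def complexJ (n : ℕ) : CSpace n →L[ℝ] CSpace n :=
  (Complex.I • ContinuousLinearMap.id ℂ (CSpace n)).restrictScalars ℝ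

theorem complexJ_apply (n : ℕ) (u : CSpace n) : complexJ n u = Complex.I • u := rfl

/-- A complex manifold is a smooth real manifold. -/
instance isManifold_real_of_complex {n : ℕ} {M : Type*} [TopologicalSpace M]
    [ChartedSpace (CSpace n) M] [IsManifold 𝓘(ℂ, CSpace n) ω M] :
    IsManifold 𝓘(ℝ, CSpace n) ∞ M := by
  refine isManifold_of_contDiffOn _ _ _ fun e e' he he' => ?_
  have h := (contDiffGroupoid ω 𝓘(ℂ, CSpace n)).compatible he he'
  have h2 := (mem_groupoid_of_pregroupoid.1 h).1
  exact (ContDiffOn.restrict_scalars ℝ h2).of_le le_top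

/-- A smooth Hermitian metric on the complex manifold `M`: a smooth Riemannian metric that is
invariant under the complex structure. -/
structure HermitianMetric (n : ℕ) (M : Type*) [TopologicalSpace M] [ChartedSpace (CSpace n) M]
    [IsManifold 𝓘(ℂ, CSpace n) ω M] where
  /-- The Riemannian metric. -/
  metric : Bundle.ContMDiffRiemannianMetric 𝓘(ℝ, CSpace n) ∞ (CSpace n)
    (fun x : M => TangentSpace 𝓘(ℝ, CSpace n) x)
  /-- Invariance under the complex structure. -/
  invariant : ∀ (x : M) (u w : CSpace n),
    metric.inner x (complexJ n u) (complexJ n w) = metric.inner x u w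

section Local

variable {n : ℕ}

/-! ## Forms on open subsets of `ℂⁿ` -/

/-- The fundamental form `ω(u, w) = g(iu, w)` of a Hermitian inner product `g`, as a bilinear form. -/
def fundBilin (G : RealBilin n) : RealBilin n := G ∘L complexJ n

/-- The wedge product `B ∧ α` of a real `2`-form `B` (given as a skew-symmetric bilinear form) with a
`k`-form `α`.  Alternating twice the tensor `B ⊗ α` sums over ordered pairs `(i, j)`, hence
the factor `1 / 2`:
`(B ∧ α)(u₀, …, u_{k+1}) = ∑_{i < j} (-1)^{i+j-1} B(u_i, u_j) α(u₀, …, û_i, …, û_j, …, u_{k+1})`. -/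
def wedgeTwo {k : ℕ} (B : RealBilin n) (α : CForm n k) : CForm n (k + 1 + 1) :=
  (1 / 2 : ℝ) • ContinuousAlternatingMap.alternatizeUncurryFin
    (ContinuousAlternatingMap.alternatizeUncurryFinCLM ℝ (CSpace n) ℂ ∘L
      ((ContinuousLinearMap.smulRightL ℝ (CSpace n) (CForm n k)).flip α ∘L B))

/-- For a skew-symmetric bilinear form `B`, the form `B ∧ c` is `c • B`. -/
theorem wedgeTwo_const (B : RealBilin n) (hB : ∀ u w, B u w = -B w u) (c : ℂ)
    (u : Fin 2 → CSpace n) :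
    wedgeTwo B (ContinuousAlternatingMap.constOfIsEmpty ℝ (CSpace n) (Fin 0) c) u
      = (B (u 0) (u 1) : ℂ) * c := by
  have h := hB (u 1) (u 0)
  simp [wedgeTwo, ContinuousAlternatingMap.alternatizeUncurryFin_apply, Fin.sum_univ_succ,
    Fin.removeNth, h]
  ring

/-- The powers `ω^k` of the fundamental form of `G`, as forms of degree `2k`. -/
def fundPow (G : RealBilin n) : (k : ℕ) → CForm n (2 * k)
  | 0 => ContinuousAlternatingMap.constOfIsEmpty ℝ (CSpace n) (Fin 0) 1
  | k + 1 => wedgeTwo (fundBilin G) (fundPow G k)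

/-- The operator `∂` on complex-valued differential forms on open subsets of `ℂⁿ`: the exterior
derivative in which the derivative of the coefficients is replaced by its complex linear part. -/
def delForm {k : ℕ} (α : CSpace n → CForm n k) (z : CSpace n) : CForm n (k + 1) :=
  ContinuousAlternatingMap.alternatizeUncurryFin
    ((1 / 2 : ℂ) • (fderiv ℝ α z - Complex.I • (fderiv ℝ α z ∘L complexJ n)))

/-- The operator `∂̄` on complex-valued differential forms on open subsets of `ℂⁿ`: the exterior
derivative in which the derivative of the coefficients is replaced by its antilinear part. -/
def delbarForm {k : ℕ} (α : CSpace n → CForm n k) (z : CSpace n) : CForm n (k + 1) :=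
  ContinuousAlternatingMap.alternatizeUncurryFin
    ((1 / 2 : ℂ) • (fderiv ℝ α z + Complex.I • (fderiv ℝ α z ∘L complexJ n)))

/-- The exterior derivative is `d = ∂ + ∂̄`. -/
theorem delForm_add_delbarForm {k : ℕ} (α : CSpace n → CForm n k) (z : CSpace n) :
    delForm α z + delbarForm α z = extDeriv α z := by
  rw [delForm, delbarForm, extDeriv, ← ContinuousAlternatingMap.alternatizeUncurryFin_add]
  congr 1
  ext u w
  simp
  ring

/-- The operator `i∂∂̄`. -/
def iDelDelbar {k : ℕ} (α : CSpace n → CForm n k) (z : CSpace n) : CForm n (k + 1 + 1) :=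
  Complex.I • delForm (delbarForm α) z

/-- The tuple `(u₀, i u₀, u₁, i u₁, …)`. -/
def interleaveJ {k : ℕ} (u : Fin k → CSpace n) : Fin (2 * k) → CSpace n := fun s =>
  if s.val % 2 = 0 then u ⟨s.val / 2, by omega⟩ else complexJ n (u ⟨s.val / 2, by omega⟩)

/-- Positivity of a `(k, k)`-form `φ`: the number `φ(u₁, iu₁, …, u_k, iu_k)` is real and positive for
all complex linearly independent `u₁, …, u_k`.  With `Z_a = (u_a - i J u_a) / 2` this number is
`(2 / i)^k φ(Z₁, Z̄₁, …, Z_k, Z̄_k)`. -/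
def IsPositiveForm {k : ℕ} (φ : CForm n (2 * k)) : Prop :=
  ∀ u : Fin k → CSpace n, LinearIndependent ℂ u →
    0 < (φ (interleaveJ u)).re ∧ (φ (interleaveJ u)).im = 0

/-! ## Chern scalar curvature on open subsets of `ℂⁿ` -/

/-- The coordinate vector `∂/∂x^r`. -/
def coordVec (r : Fin n) : CSpace n := EuclideanSpace.single r 1

/-- `∂_r f = (∂f/∂x^r - i ∂f/∂y^r) / 2`. -/
def wirt (r : Fin n) (f : CSpace n → ℂ) (z : CSpace n) : ℂ :=
  (1 / 2) * (fderiv ℝ f z (coordVec r) - Complex.I * fderiv ℝ f z (complexJ n (coordVec r)))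

/-- `∂_{s̄} f = (∂f/∂x^s + i ∂f/∂y^s) / 2`. -/
def wirtBar (s : Fin n) (f : CSpace n → ℂ) (z : CSpace n) : ℂ :=
  (1 / 2) * (fderiv ℝ f z (coordVec s) + Complex.I * fderiv ℝ f z (complexJ n (coordVec s)))

/-- The matrix `g_{r s̄} = g(∂_r, ∂_{s̄})` of a Hermitian inner product, so that the fundamental form is
`i ∑ g_{r s̄} dz^r ∧ dz̄^s`. -/
def hermMatrix (G : RealBilin n) : Matrix (Fin n) (Fin n) ℂ := Matrix.of fun r s =>
  (1 / 2) * ((G (coordVec r) (coordVec s) : ℂ)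
    + Complex.I * (G (coordVec r) (complexJ n (coordVec s)) : ℂ))

/-- The coefficients `Γ^l_{ik} = ∑_q (∂_i g_{k q̄}) g^{q̄ l}` of the Chern connection of the Hermitian
metric `G`: `∇_{∂_i} ∂_k = ∑_l Γ^l_{ik} ∂_l`. -/
def chernGamma (G : CSpace n → RealBilin n) (i k l : Fin n) (z : CSpace n) : ℂ :=
  ∑ q, wirt i (fun y => hermMatrix (G y) k q) z * (hermMatrix (G z))⁻¹ q l

/-- The curvature `R_{i j̄ k}^l = -∂_{j̄} Γ^l_{ik}` of the Chern connection. -/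
def chernCurv (G : CSpace n → RealBilin n) (i j k l : Fin n) (z : CSpace n) : ℂ :=
  -wirtBar j (chernGamma G i k l) z

/-- The Chern scalar curvature `∑ g^{j̄ i} R_{i j̄ k}^k` (a real number). -/
def chernScalarLocal (G : CSpace n → RealBilin n) (z : CSpace n) : ℝ :=
  (∑ i, ∑ j, ∑ k, (hermMatrix (G z))⁻¹ j i * chernCurv G i j k k z).re

/-! ## Levi-Civita connection on open subsets of `ℂⁿ` -/

/-- The bilinear form with values in covectors on the right-hand side of the Koszul formula:
`K(u, w)(y) = (D_u G(w, y) + D_w G(u, y) - D_y G(u, w)) / 2`. -/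
def koszul (G : CSpace n → RealBilin n) (z : CSpace n) :
    CSpace n →L[ℝ] CSpace n →L[ℝ] CSpace n →L[ℝ] ℝ :=
  let D : CSpace n →L[ℝ] CSpace n →L[ℝ] CSpace n →L[ℝ] ℝ := fderiv ℝ G z
  (1 / 2 : ℝ) • (D + D.flip -
    (ContinuousLinearMap.flipₗᵢ ℝ (CSpace n) (CSpace n) ℝ).toContinuousLinearEquiv.toContinuousLinearMap
      ∘L D.flip)

theorem koszul_apply (G : CSpace n → RealBilin n) (z u w y : CSpace n) :
    koszul G z u w y =
      (1 / 2) * (fderiv ℝ G z u w y + fderiv ℝ G z w u y - fderiv ℝ G z y u w) := by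
  simp [koszul]

/-- The Christoffel symbols of the Levi-Civita connection of the metric `G`: the vector `Γ(u, w)` with
`G(Γ(u, w), ·) = K(u, w)`. -/
def leviCivitaGamma (G : CSpace n → RealBilin n) (z : CSpace n) :
    CSpace n →L[ℝ] CSpace n →L[ℝ] CSpace n :=
  (ContinuousLinearMap.compL ℝ (CSpace n) (CSpace n →L[ℝ] ℝ) (CSpace n)
    (ContinuousLinearMap.inverse (G z))) ∘L koszul G z

/-- The covariant derivative of a covariant `k`-tensor field for the connection `Γ`, see
`covDeriv_apply`. -/
def covDeriv {k : ℕ} (Γ : CSpace n → CSpace n →L[ℝ] CSpace n →L[ℝ] CSpace n)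
    (T : CSpace n → CovTensor n k) (z : CSpace n) : CovTensor n (k + 1) :=
  ContinuousLinearMap.uncurryLeft (fderiv ℝ T z -
    ∑ j : Fin k, (((ContinuousMultilinearMap.compContinuousLinearMapContinuousMultilinear ℝ
      (fun _ : Fin k => CSpace n) (fun _ : Fin k => CSpace n) ℝ).toContinuousLinearMap
        (fun _ => ContinuousLinearMap.id ℝ (CSpace n)) j).flip (T z)) ∘L Γ z)

/-- `(∇T)(u₀, u₁, …, u_k) = D_{u₀}T(u₁, …, u_k) - ∑_j T(u₁, …, Γ(u₀, u_j), …, u_k)`. -/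
theorem covDeriv_apply {k : ℕ} (Γ : CSpace n → CSpace n →L[ℝ] CSpace n →L[ℝ] CSpace n)
    (T : CSpace n → CovTensor n k) (z : CSpace n) (u : Fin (k + 1) → CSpace n) :
    covDeriv Γ T z u = fderiv ℝ T z (u 0) (Fin.tail u) -
      ∑ j : Fin k, T z (Function.update (Fin.tail u) j (Γ z (u 0) (Fin.tail u j))) := by
  rw [covDeriv, ContinuousLinearMap.uncurryLeft_apply]
  simp only [sub_apply, sum_apply]
  congr 1
  refine Finset.sum_congr rfl fun j _ => ?_
  change T z (fun i => Function.update (fun _ : Fin k => ContinuousLinearMap.id ℝ (CSpace n)) j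
    (Γ z (u 0)) i (Fin.tail u i)) = _
  congr 1
  funext i
  rcases eq_or_ne i j with rfl | h
  · simp
  · simp [h]

/-- The iterated covariant derivative `∇^k f` of a function for the Levi-Civita connection of `G`. -/
def iterCovDeriv (G : CSpace n → RealBilin n) (f : CSpace n → ℝ) :
    (k : ℕ) → CSpace n → CovTensor n k
  | 0 => fun z => ContinuousMultilinearMap.constOfIsEmpty ℝ (fun _ : Fin 0 => CSpace n) (f z)
  | k + 1 => covDeriv (leviCivitaGamma G) (iterCovDeriv G f k)

/-! ## Jets and contractions -/

/-- The tuples `(ψ_0, …, ψ_{N-1})` of covariant tensors of degrees `0, …, N - 1`. -/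
abbrev JetTuple (n N : ℕ) : Type := (k : Fin N) → CovTensor n k

/-- The pull-back of a tuple of covariant tensors. -/
def JetTuple.pullback {N : ℕ} (A : CSpace n →L[ℝ] CSpace n) (ψ : JetTuple n N) : JetTuple n N :=
  fun k => (ψ k).compContinuousLinearMap fun _ => A

/-- Covectors. -/
abbrev Covec (n : ℕ) : Type := CSpace n →L[ℝ] ℝ

/-- Tensors of type `(2, 0)`: bilinear forms on covectors. -/
abbrev ContraTwo (n : ℕ) : Type := Covec n →L[ℝ] Covec n →L[ℝ] ℝ

/-- The real coordinate vectors `∂/∂x^r` (index `inl r`) and `∂/∂y^r` (index `inr r`). -/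
def realVec : Fin n ⊕ Fin n → CSpace n
  | .inl r => coordVec r
  | .inr r => complexJ n (coordVec r)

/-- The real coordinate covectors `dx^r` (index `inl r`) and `dy^r` (index `inr r`). -/
def realCovec : Fin n ⊕ Fin n → Covec n
  | .inl r => Complex.reCLM ∘L (EuclideanSpace.proj r : CSpace n →L[ℂ] ℂ).restrictScalars ℝ
  | .inr r => Complex.imCLM ∘L (EuclideanSpace.proj r : CSpace n →L[ℂ] ℂ).restrictScalars ℝ

theorem realCovec_realVec (a b : Fin n ⊕ Fin n) :
    realCovec a (realVec b) = if a = b then 1 else 0 := by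
  rcases a with a | a <;> rcases b with b | b <;>
    simp [realCovec, realVec, coordVec, complexJ_apply] <;> aesop

/-- The full contraction `∑ E₁^{i₁j₁} ⋯ E_r^{i_r j_r} T_{i₁ j₁ … i_r j_r}`; the index `P (k, 0)` is
`i_k` and `P (k, 1)` is `j_k`. -/
def contract {r : ℕ} (A : Fin r → ContraTwo n) (T : CovTensor n (r * 2)) : ℝ :=
  ∑ P : Fin r × Fin 2 → Fin n ⊕ Fin n,
    (∏ k : Fin r, A k (realCovec (P (k, 0))) (realCovec (P (k, 1)))) *
      T fun s => realVec (P (finProdFinEquiv.symm s))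

end Local

section Global

variable {n : ℕ} {M : Type*} [TopologicalSpace M] [ChartedSpace (CSpace n) M]
  [IsManifold 𝓘(ℂ, CSpace n) ω M]

/-- Riemannian metrics on the real manifold underlying `M`. -/
abbrev RMetric (n : ℕ) (M : Type*) [TopologicalSpace M] [ChartedSpace (CSpace n) M]
    [IsManifold 𝓘(ℂ, CSpace n) ω M] :=
  Bundle.ContMDiffRiemannianMetric 𝓘(ℝ, CSpace n) ∞ (CSpace n)
    (fun x : M => TangentSpace 𝓘(ℝ, CSpace n) x)

/-- The inner product on `T_x M`. -/
def metricAt (g : RMetric n M) (x : M) : RealBilin n := g.inner x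

/-- The differential at `x` of the chart `φ`. -/
def chartDeriv (φ : OpenPartialHomeomorph M (CSpace n)) (x : M) : CSpace n →L[ℝ] CSpace n :=
  mfderiv 𝓘(ℝ, CSpace n) 𝓘(ℝ, CSpace n) φ x

/-- The differential at `z` of the inverse of the chart `φ`. -/
def chartSymmDeriv (φ : OpenPartialHomeomorph M (CSpace n)) (z : CSpace n) :
    CSpace n →L[ℝ] CSpace n :=
  mfderiv 𝓘(ℝ, CSpace n) 𝓘(ℝ, CSpace n) φ.symm z

/-- The coordinate expression of the metric `g` in the chart `φ`. -/
def metricIn (g : RMetric n M) (φ : OpenPartialHomeomorph M (CSpace n)) (z : CSpace n) :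
    RealBilin n :=
  (metricAt g (φ.symm z)).bilinearComp (chartSymmDeriv φ z) (chartSymmDeriv φ z)

/-- The tensor `∇^k f` at `x`, for the Levi-Civita connection of `g`. -/
def covDerivAt (g : RMetric n M) (f : M → ℝ) (k : ℕ) (x : M) : CovTensor n k :=
  iterCovDeriv (metricIn g (chartAt (CSpace n) x)) (f ∘ (chartAt (CSpace n) x).symm) k
    (chartAt (CSpace n) x x)

/-- The tuple `(f, ∇f, …, ∇^{N-1} f)` at `x`. -/
def jetAt (g : RMetric n M) (N : ℕ) (f : M → ℝ) (x : M) : JetTuple n N :=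
  fun k => covDerivAt g f k x

/-- The square of the norm of a covector at `x`:
`|ξ|_g² = sup {ξ(u)² : g(u, u) ≤ 1}`. -/
def covecNormSq (g : RMetric n M) (x : M) (ξ : Covec n) : ℝ :=
  sSup {t : ℝ | ∃ u : CSpace n, metricAt g x u u ≤ 1 ∧ t = ξ u ^ 2}

/-- The coordinate expression, in the chart `φ`, of a set `𝒟` of tuples `(x, ψ_0, …, ψ_{N-1})`. -/
def jetRegion {N : ℕ} (𝒟 : M → Set (JetTuple n N)) (φ : OpenPartialHomeomorph M (CSpace n)) :
    Set (CSpace n × JetTuple n N) :=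
  {p | p.1 ∈ φ.target ∧
    p.2.pullback (chartDeriv φ (φ.symm p.1)) ∈ 𝒟 (φ.symm p.1)}

/-- The coordinate expression, in the chart `φ`, of a real function `b(x, ψ_0, …, ψ_{N-1})`. -/
def coordFun {N : ℕ} (b : M → JetTuple n N → ℝ) (φ : OpenPartialHomeomorph M (CSpace n))
    (p : CSpace n × JetTuple n N) : ℝ :=
  b (φ.symm p.1) (p.2.pullback (chartDeriv φ (φ.symm p.1)))

/-- The coordinate expression, in the chart `φ`, of a `(2, 0)`-tensor `A(x, ψ_0, …, ψ_{N-1})`,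
evaluated on the covectors `ξ`, `η` of `ℂⁿ`. -/
def coordContra {N : ℕ} (A : M → JetTuple n N → ContraTwo n)
    (φ : OpenPartialHomeomorph M (CSpace n)) (ξ η : Covec n) (p : CSpace n × JetTuple n N) : ℝ :=
  A (φ.symm p.1) (p.2.pullback (chartDeriv φ (φ.symm p.1)))
    (ξ ∘L chartDeriv φ (φ.symm p.1)) (η ∘L chartDeriv φ (φ.symm p.1))

/-- `Q` is, on the functions in `𝒞`, a quasi-linear operator of order `2r` that is strongly elliptic:
all `(v, ∇v, …, ∇^{2r-1}v)(x)` with `v ∈ 𝒞` belong to `𝒟`, and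
`Q(v) = (-1)^{r-1} E₁^{i₁j₁} ⋯ E_r^{i_r j_r} ∇^{2r}_{i₁j₁…i_r j_r} v + b`,
where the `(2, 0)`-tensors `E_k` and the function `b` are smooth functions of
`(x, v, ∇v, …, ∇^{2r-1}v)` on the set `𝒟`, and over every chart and every compact set `K` of elements
of `𝒟` there is `λ > 0` with `E_k(x, ψ)(ξ, ξ) ≥ λ |ξ|_g²` for all `k`, all `(x, ψ)` in `K` and all
covectors `ξ` at `x`. -/
def IsQuasilinearElliptic (g : RMetric n M) (r : ℕ) (𝒞 : Set (M → ℝ))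
    (𝒟 : M → Set (JetTuple n (r * 2))) (Q : (M → ℝ) → M → ℝ) : Prop :=
  (∀ v ∈ 𝒞, ∀ x, jetAt g (r * 2) v x ∈ 𝒟 x) ∧
  ∃ (A : Fin r → M → JetTuple n (r * 2) → ContraTwo n) (b : M → JetTuple n (r * 2) → ℝ),
    (∀ v ∈ 𝒞, ∀ x, Q v x =
      (-1) ^ (r - 1) * contract (fun k => A k x (jetAt g (r * 2) v x)) (covDerivAt g v (r * 2) x)
        + b x (jetAt g (r * 2) v x)) ∧
    (∀ φ ∈ atlas (CSpace n) M,
      (∀ k ξ η, ContDiffOn ℝ ∞ (coordContra (A k) φ ξ η) (jetRegion 𝒟 φ)) ∧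
      ContDiffOn ℝ ∞ (coordFun b φ) (jetRegion 𝒟 φ)) ∧
    (∀ φ ∈ atlas (CSpace n) M, ∀ K ⊆ jetRegion 𝒟 φ, IsCompact K → ∃ lam : ℝ, 0 < lam ∧
      ∀ k, ∀ p ∈ K, ∀ ξ : Covec n,
        lam * covecNormSq g (φ.symm p.1) ξ ≤
          A k (φ.symm p.1) (p.2.pullback (chartDeriv φ (φ.symm p.1))) ξ ξ)

/-- The Chern scalar curvature of the Hermitian metric `h`. -/
def chernScalar (h : HermitianMetric n M) (x : M) : ℝ :=
  chernScalarLocal (metricIn h.metric (chartAt (CSpace n) x)) (chartAt (CSpace n) x x)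

/-- The `k`-th power, at `x`, of the fundamental form of the Hermitian metric `h`. -/
def fundPowAt (h : HermitianMetric n M) (k : ℕ) (x : M) : CForm n (2 * k) :=
  fundPow (metricAt h.metric x) k

end Global

section Flow

variable {m : ℕ} {M : Type*} [TopologicalSpace M] [ChartedSpace (CSpace (m + 2)) M]
  [IsManifold 𝓘(ℂ, CSpace (m + 2)) ω M]

/-- In complex dimension `n = m + 2`, the value at `x` of the form
`ω^{n-1} + i∂∂̄(v ω^{n-2})`, where `ω` is the fundamental form of `g`. -/
def perturbedForm (g : HermitianMetric (m + 2) M) (v : M → ℝ) (x : M) :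
    CForm (m + 2) (2 * (m + 1)) :=
  fundPowAt g (m + 1) x +
    iDelDelbar (fun z => v ((chartAt (CSpace (m + 2)) x).symm z) •
      fundPow (metricIn g.metric (chartAt (CSpace (m + 2)) x) z) m) (chartAt (CSpace (m + 2)) x x)

/-- The set `C^∞_ω(M)` of smooth functions `v` with `ω^{n-1} + i∂∂̄(v ω^{n-2}) > 0`. -/
def admissibleFunctions (g : HermitianMetric (m + 2) M) : Set (M → ℝ) :=
  {v | ContMDiff 𝓘(ℝ, CSpace (m + 2)) 𝓘(ℝ) ∞ v ∧ ∀ x, IsPositiveForm (perturbedForm g v x)}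

/-- `h` is a Hermitian metric `ω_v`, that is, `ω_v^{n-1} = ω^{n-1} + i∂∂̄(v ω^{n-2})`. -/
def IsInducedMetric (g : HermitianMetric (m + 2) M) (v : M → ℝ) (h : HermitianMetric (m + 2) M) :
    Prop :=
  ∀ x, fundPowAt h (m + 1) x = perturbedForm g v x

open Classical in
/-- The Hermitian metric `ω_v` (with the value `g` if there is no such metric). -/
def inducedMetric (g : HermitianMetric (m + 2) M) (v : M → ℝ) : HermitianMetric (m + 2) M :=
  if h : ∃ h : HermitianMetric (m + 2) M, IsInducedMetric g v h then h.choose else g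

/-- The operator `v ↦ s_v`, where `s_v` is the Chern scalar curvature of `ω_v`. -/
def scalarOperator (g : HermitianMetric (m + 2) M) (v : M → ℝ) : M → ℝ :=
  chernScalar (inducedMetric g v)

/-- The tuples `(x, ψ_0, ψ_1, ψ_2, ψ_3)` that are admissible: the form
`ω^{n-1} + i∂∂̄(u ω^{n-2})` at `x` is positive for some function `u`, smooth near `x`, with
`u(x) = ψ_0`, `∇u(x) = ψ_1` and `∇²u(x)` the symmetric part of `ψ_2` (the form at `x` depends on `u`
only through these values; there is no condition on `ψ_3`). -/
def admissibleJets (g : HermitianMetric (m + 2) M) (x : M) : Set (JetTuple (m + 2) (2 * 2)) :=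
  {ψ | ∃ u : M → ℝ, ContMDiffAt 𝓘(ℝ, CSpace (m + 2)) 𝓘(ℝ) ∞ u x ∧
    IsPositiveForm (perturbedForm g u x) ∧
    covDerivAt g.metric u 0 x = ψ 0 ∧ covDerivAt g.metric u 1 x = ψ 1 ∧
    ∀ a b : CSpace (m + 2),
      covDerivAt g.metric u 2 x ![a, b] = (1 / 2) * (ψ 2 ![a, b] + ψ 2 ![b, a])}

end Flow

end

/-!
Write `n = m + 2` for the dimension and `p = n - 1`.

A form `Φ` of degree `2p` on `ℂ^n` has a Hermitian matrix `cofMatrix Φ`, obtained from the products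
`i dz^r ∧ dz̄^s ∧ Φ`. A positive form has a positive definite matrix (`cofMatrix_posDef`), and a real
form that is invariant under the complex structure is determined by its matrix
(`eq_zero_of_cofMatrix_eq_zero`). The matrix of `ω^p` is, up to a factor, the matrix of cofactors of
that of `ω` (`cofMatrix_fundPow`). Hence a positive form `Φ` has exactly one positive root
`rootForm Φ`, given by an explicit smooth formula (`fundPow_rootForm`, `rootForm_fundPow`), which
yields the metric `ω_v`.

The Chern scalar curvature is minus the trace of the complex Hessian of `log det ω_v`
(`chernScalarLocal_eq`), and `log det ω_v` is `1 / p` times the logarithm of the determinant of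
`cofMatrix Φ`, up to a constant, where `Φ = ω^p + i∂∂̄(v ω^{p-1})`. So the curvature of `ω_v` is a
second order operator in `Φ` (`rootScalar`), of which the fourth order part in `v` is the product of
two second order symbols: `E₁` is the trace with respect to `ω_v`, and `E₂` is the derivative of
`log det ω_v` along `i∂∂̄(v ω^{p-1})` (`symbols`). The first is positive definite since `ω_v` is
(`chernTrace_pos`). For the second, `i ξ' ∧ ξ'' ∧ ω^{p-1}` has a nonzero positive semidefinite matrix
for every real covector `ξ ≠ 0` (`cofMatrix_leviForm_posSemidef`), and the trace of such a matrix
with the inverse of a positive definite one is positive (`hessTrace_pos`).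

What remains of the curvature after the product `-E₁ E₂ ∇⁴v` is taken away, `lowerOrder`, does not
change if a function that vanishes to fourth order is added to `v` (`lowerOrder_eq_of_vanishesTo`).
For every tuple `ψ` of tensors, `jetPoly` is a polynomial whose covariant derivatives at the point
have the same diagonals as `ψ`, and whose coefficients depend smoothly on the point and on `ψ`.
Evaluating the form and `lowerOrder` on it expresses them in terms of the jet (`jetForm`,
`jetLower`).

The coefficients at a point are computed in the preferred chart there. Their expressions in any
other chart are given by the same formulas, because the covariant derivatives, `i∂∂̄`, the symbols
and the remaining terms are natural under biholomorphic maps (`iterCovDeriv_pull`,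
`iDelDelbar_pullForm`, `symbols_comp`, `lowerOrder_pull`); smoothness follows. Over a compact set a
continuous family of positive definite forms has a common lower bound
(`exists_pos_forall_mul_norm_sq_le`), which gives the constant `λ`.
-/

noncomputable section

/-! ### The algebra of wedge products with two-forms -/

section WedgeAlgebra

variable {n k : ℕ}

/-- The double alternatization of a bilinear form with values in `k`-forms, a continuous linear map. -/
def altTwo (n k : ℕ) : (CSpace n →L[ℝ] CSpace n →L[ℝ] CForm n k) →L[ℝ] CForm n (k + 1 + 1) :=
  ContinuousAlternatingMap.alternatizeUncurryFinCLM ℝ (CSpace n) ℂ ∘L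
    ContinuousLinearMap.compL ℝ (CSpace n) (CSpace n →L[ℝ] CForm n k) (CForm n (k + 1))
      (ContinuousAlternatingMap.alternatizeUncurryFinCLM ℝ (CSpace n) ℂ)

/-- The tensor product `B ⊗ α` of a bilinear form and a `k`-form. -/
def tensorForm (B : RealBilin n) (α : CForm n k) : CSpace n →L[ℝ] CSpace n →L[ℝ] CForm n k :=
  (ContinuousLinearMap.smulRightL ℝ (CSpace n) (CForm n k)).flip α ∘L B

@[simp]
theorem tensorForm_apply (B : RealBilin n) (α : CForm n k) (u w : CSpace n) :
    tensorForm B α u w = B u w • α := by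
  simp [tensorForm]

theorem altTwo_eq (T : CSpace n →L[ℝ] CSpace n →L[ℝ] CForm n k) :
    altTwo n k T = ContinuousAlternatingMap.alternatizeUncurryFin
      (ContinuousAlternatingMap.alternatizeUncurryFinCLM ℝ (CSpace n) ℂ ∘L T) := rfl

theorem altTwo_apply (T : CSpace n →L[ℝ] CSpace n →L[ℝ] CForm n k) (u : Fin (k + 1 + 1) → CSpace n) :
    altTwo n k T u = ∑ i : Fin (k + 1 + 1), ∑ j : Fin (k + 1),
      (-1 : ℤ) ^ (i : ℕ) • (-1 : ℤ) ^ (j : ℕ) •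
      T (u i) (i.removeNth u j) (j.removeNth (i.removeNth u)) := by
  rw [altTwo_eq, ContinuousAlternatingMap.alternatizeUncurryFin_apply]
  refine Finset.sum_congr rfl fun i _ => ?_
  rw [ContinuousLinearMap.comp_apply, ContinuousAlternatingMap.alternatizeUncurryFinCLM_apply,
    ContinuousAlternatingMap.alternatizeUncurryFin_apply, Finset.smul_sum]

theorem wedgeTwo_eq_altTwo (B : RealBilin n) (α : CForm n k) :
    wedgeTwo B α = (1 / 2 : ℝ) • altTwo n k (tensorForm B α) := rfl

theorem wedgeTwo_apply (B : RealBilin n) (α : CForm n k) (u : Fin (k + 1 + 1) → CSpace n) :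
    wedgeTwo B α u = (1 / 2 : ℝ) • ∑ i : Fin (k + 1 + 1), ∑ j : Fin (k + 1),
      (-1 : ℤ) ^ (i : ℕ) • (-1 : ℤ) ^ (j : ℕ) •
      (B (u i) (i.removeNth u j) • α (j.removeNth (i.removeNth u))) := by
  rw [wedgeTwo_eq_altTwo, ContinuousAlternatingMap.smul_apply, altTwo_apply]
  simp only [tensorForm_apply, ContinuousAlternatingMap.smul_apply]

/-- The double alternatization commutes with pull-backs. -/
theorem altTwo_comp (T : CSpace n →L[ℝ] CSpace n →L[ℝ] CForm n k) (A : CSpace n →L[ℝ] CSpace n)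
    (T' : CSpace n →L[ℝ] CSpace n →L[ℝ] CForm n k)
    (h : ∀ u w, T' u w = (T (A u) (A w)).compContinuousLinearMap A) :
    altTwo n k T' = (altTwo n k T).compContinuousLinearMap A := by
  ext u
  rw [ContinuousAlternatingMap.compContinuousLinearMap_apply, altTwo_apply, altTwo_apply]
  refine Finset.sum_congr rfl fun i _ => Finset.sum_congr rfl fun j _ => ?_
  rw [h]
  rfl

theorem altTwo_eq_zero_of_symm {T : CSpace n →L[ℝ] CSpace n →L[ℝ] CForm n k}
    (h : ∀ u w, T u w = T w u) : altTwo n k T = 0 :=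
  ContinuousAlternatingMap.alternatizeUncurryFin_alternatizeUncurryFinCLM_comp_of_symmetric h

/-- The double alternatization depends only on the skew part. -/
theorem altTwo_congr_skew {T T' : CSpace n →L[ℝ] CSpace n →L[ℝ] CForm n k}
    (h : ∀ u w, T u w - T w u = T' u w - T' w u) : altTwo n k T = altTwo n k T' := by
  rw [← sub_eq_zero, ← map_sub]
  refine altTwo_eq_zero_of_symm fun u w => ?_
  have := h u w
  simp only [sub_apply]
  rw [sub_eq_sub_iff_sub_eq_sub] at this
  exact this

theorem wedgeTwo_comp (B : RealBilin n) (α : CForm n k) (A : CSpace n →L[ℝ] CSpace n) :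
    wedgeTwo (B.bilinearComp A A) (α.compContinuousLinearMap A) =
      (wedgeTwo B α).compContinuousLinearMap A := by
  rw [wedgeTwo_eq_altTwo, wedgeTwo_eq_altTwo, altTwo_comp (tensorForm B α) A]
  · rfl
  · intro u w
    ext
    simp

theorem wedgeTwo_congr_skew {B B' : RealBilin n} (h : ∀ u w, B u w - B w u = B' u w - B' w u)
    (α : CForm n k) : wedgeTwo B α = wedgeTwo B' α := by
  rw [wedgeTwo_eq_altTwo, wedgeTwo_eq_altTwo, altTwo_congr_skew]
  intro u w
  simp only [tensorForm_apply, ← sub_smul, h]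

/-- The wedge product `B ∧ α` as a continuous bilinear map of `α` and `B`. -/
def wedgeTwoL (n k : ℕ) : CForm n k →L[ℝ] RealBilin n →L[ℝ] CForm n (k + 1 + 1) :=
  (1 / 2 : ℝ) • (ContinuousLinearMap.compL ℝ (RealBilin n)
      (CSpace n →L[ℝ] CSpace n →L[ℝ] CForm n k) (CForm n (k + 1 + 1)) (altTwo n k) ∘L
    (ContinuousLinearMap.compL ℝ (CSpace n) (CSpace n →L[ℝ] ℝ) (CSpace n →L[ℝ] CForm n k) ∘L
      (ContinuousLinearMap.smulRightL ℝ (CSpace n) (CForm n k)).flip))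

theorem wedgeTwoL_apply (B : RealBilin n) (α : CForm n k) : wedgeTwoL n k α B = wedgeTwo B α := rfl

/-- If `B` pairs only `u₀` and `u₁`, all other terms of `B ∧ α` vanish. -/
theorem wedgeTwo_apply_of_vanish {B : RealBilin n} (α : CForm n k) {a c : CSpace n}
    {u : Fin k → CSpace n} (h1 : ∀ i, B (u i) = 0) (h2 : ∀ w i, B w (u i) = 0) :
    wedgeTwo B α (Fin.cons a (Fin.cons c u)) = (1 / 2 : ℝ) • ((B a c - B c a) • α u) := by
  have key : ∀ (x : CSpace n) (y : CSpace n), (∑ j : Fin (k + 1), (-1 : ℤ) ^ (j : ℕ) •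
      (B y ((Fin.cons x u : Fin (k + 1) → CSpace n) j) •
        α (j.removeNth (Fin.cons x u : Fin (k + 1) → CSpace n)))) = B y x • α u := by
    intro x y
    rw [Fin.sum_univ_succ]
    simp [h2]
  have hsum : ∀ F : Fin (k + 1 + 1) → ℂ, (∀ i : Fin k, F i.succ.succ = 0) →
      ∑ i, F i = F 0 + F 1 := by
    intro F hF
    rw [Fin.sum_univ_succ, Fin.sum_univ_succ]
    simp [hF]
  have h10 : Fin.removeNth 1 (Fin.cons a (Fin.cons c u : Fin (k + 1) → CSpace n) :
      Fin (k + 1 + 1) → CSpace n) = Fin.cons a u := by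
    funext j
    refine Fin.cases ?_ (fun j => ?_) j
    · simp [Fin.removeNth]
    · simp [Fin.removeNth]
  rw [wedgeTwo_apply, hsum]
  · simp only [← Finset.smul_sum]
    rw [h10]
    simp only [Fin.removeNth_zero, Fin.tail_cons, key, Fin.cons_zero, Fin.cons_one]
    simp [sub_eq_add_neg]
    ring
  · intro i
    simp [h1]

theorem interleaveJ_cons (a : CSpace n) (u : Fin k → CSpace n) :
    interleaveJ (Fin.cons a u : Fin (k + 1) → CSpace n) =
      (Fin.cons a (Fin.cons (complexJ n a) (interleaveJ u)) : Fin (2 * k + 1 + 1) → CSpace n) := by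
  funext s
  refine Fin.cases ?_ (fun s => Fin.cases ?_ (fun s => ?_) s) s
  · simp [interleaveJ]
  · have h : ((Fin.succ 0 : Fin (2 * k + 1 + 1)) : ℕ) = 1 := by simp
    have h0 : (⟨((Fin.succ 0 : Fin (2 * k + 1 + 1)) : ℕ) / 2, by omega⟩ : Fin (k + 1)) = 0 := by
      ext; simp only [h]; rfl
    simp only [Fin.cons_succ, Fin.cons_zero, interleaveJ]
    rw [h0, h, if_neg (by norm_num), Fin.cons_zero]
  · have hs : (s : ℕ) < 2 * k := s.2
    have h1 : ((s.succ.succ : Fin (2 * k + 1 + 1)) : ℕ) = s + 2 := rfl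
    have h2 : ((s : ℕ) + 2) / 2 = s / 2 + 1 := by omega
    have h3 : ((s : ℕ) + 2) % 2 = s % 2 := by omega
    simp only [Fin.cons_succ, interleaveJ]
    have : (⟨((s.succ.succ : Fin (2 * k + 1 + 1)) : ℕ) / 2, by omega⟩ : Fin (k + 1)) =
      Fin.succ ⟨(s : ℕ) / 2, by omega⟩ := by
      ext; simp only [h1, h2, Fin.val_succ]
    rw [this, h1, h3, Fin.cons_succ]

theorem fundBilin_apply (G : RealBilin n) (u w : CSpace n) :
    fundBilin G u w = G (complexJ n u) w := rfl

theorem complexJ_complexJ (u : CSpace n) : complexJ n (complexJ n u) = -u := by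
  rw [complexJ_apply, complexJ_apply, smul_smul, Complex.I_mul_I, neg_one_smul]

theorem fundPow_succ (G : RealBilin n) (k : ℕ) :
    fundPow G (k + 1) = wedgeTwo (fundBilin G) (fundPow G k) := rfl

theorem fundPow_comp (G : RealBilin n) {A : CSpace n →L[ℝ] CSpace n}
    (hA : ∀ u, A (complexJ n u) = complexJ n (A u)) (k : ℕ) :
    fundPow (G.bilinearComp A A) k = (fundPow G k).compContinuousLinearMap A := by
  induction k with
  | zero => rfl
  | succ k ih =>
    rw [fundPow_succ, fundPow_succ, ih, ← wedgeTwo_comp]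
    congr 1
    ext u w
    simp [fundBilin_apply, hA]

/-- Removing a pair `u_a, iu_a` from an interleaved frame leaves the frame of the other vectors. -/
theorem removeNth_interleaveJ (u : Fin (k + 1) → CSpace n) (i : Fin (2 * k + 1 + 1))
    (j : Fin (2 * k + 1)) (a : Fin (k + 1)) (ha : (a : ℕ) = i / 2) (hj : (j : ℕ) = 2 * a) :
    j.removeNth (i.removeNth (interleaveJ u : Fin (2 * k + 1 + 1) → CSpace n)) =
      interleaveJ (a.removeNth u) := by
  funext s
  have hs := s.2
  have h : ((i.succAbove (j.succAbove s)) : ℕ) = if (s : ℕ) < 2 * a then (s : ℕ) else s + 2 := by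
    simp only [Fin.succAbove, Fin.lt_def, Fin.val_castSucc]
    split_ifs <;> simp at * <;> omega
  have h' : ∀ (b : Fin k) , (b : ℕ) = s / 2 →
      (a.succAbove b : ℕ) = if (s : ℕ) < 2 * a then (s : ℕ) / 2 else s / 2 + 1 := by
    intro b hb
    simp only [Fin.succAbove, Fin.lt_def, Fin.val_castSucc]
    split_ifs <;> simp at * <;> omega
  have h2 : ((i.succAbove (j.succAbove s)) : ℕ) % 2 = s % 2 := by rw [h]; split_ifs <;> omega
  have h3 : (⟨((i.succAbove (j.succAbove s)) : ℕ) / 2, by omega⟩ : Fin (k + 1)) =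
      a.succAbove ⟨(s : ℕ) / 2, by omega⟩ := by
    ext
    rw [h' _ rfl]
    simp only [h]
    split_ifs <;> omega
  simp only [Fin.removeNth, interleaveJ, h2, h3]

/-- The form `ω^k` takes the value `k!` on a unitary frame `(u₁, iu₁, …, u_k, iu_k)`. -/
theorem fundPow_interleaveJ (G : RealBilin n) (k : ℕ) (u : Fin k → CSpace n)
    (h00 : ∀ a b, fundBilin G (u a) (u b) = 0)
    (h11 : ∀ a b, fundBilin G (complexJ n (u a)) (complexJ n (u b)) = 0)
    (h01 : ∀ a b, fundBilin G (u a) (complexJ n (u b)) = if a = b then 1 else 0)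
    (h10 : ∀ a b, fundBilin G (complexJ n (u a)) (u b) = if a = b then -1 else 0) :
    fundPow G k (interleaveJ u) = (k.factorial : ℂ) := by
  induction k with
  | zero => simp [fundPow]
  | succ k ih =>
    rw [fundPow_succ]
    refine (wedgeTwo_apply _ _ _).trans ?_
-- each of the `2k + 2` vectors pairs only with its partner `u ↔ iu`, and the pair leaves the frame of
-- the remaining `k` vectors: every `i` contributes `k!`, in total `(2k + 2) k! / 2 = (k + 1)!`
    have key : ∀ i : Fin (2 * k + 1 + 1), (∑ j : Fin (2 * k + 1),
      (-1 : ℤ) ^ (i : ℕ) • (-1 : ℤ) ^ (j : ℕ) •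
      (fundBilin G (interleaveJ u i) ((i.removeNth (interleaveJ u : Fin (2 * k + 1 + 1) → CSpace n)) j) •
        fundPow G k (j.removeNth (i.removeNth (interleaveJ u : Fin (2 * k + 1 + 1) → CSpace n))))) =
        (k.factorial : ℂ) := by
      intro i
      have hi := i.2
      set a : Fin (k + 1) := ⟨(i : ℕ) / 2, by omega⟩ with ha
      have hav : (a : ℕ) = i / 2 := rfl
      rw [Finset.sum_eq_single ⟨2 * a, by omega⟩]
      · rw [removeNth_interleaveJ u i _ a rfl rfl, ih]
        · have h : ((i.succAbove ⟨2 * (a : ℕ), by omega⟩) : ℕ) =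
            if (i : ℕ) % 2 = 0 then (i : ℕ) + 1 else (i : ℕ) - 1 := by
            simp only [Fin.succAbove, Fin.lt_def, Fin.val_castSucc]
            split_ifs <;> simp at * <;> omega
          rcases Nat.mod_two_eq_zero_or_one (i : ℕ) with hm | hm
          · have e1 : (interleaveJ u : Fin (2 * k + 1 + 1) → CSpace n) i = u a := by
              simp [interleaveJ, hm, ha]
            have e2 : i.removeNth (interleaveJ u : Fin (2 * k + 1 + 1) → CSpace n)
                ⟨2 * (a : ℕ), by omega⟩ = complexJ n (u a) := by
              have h2 : ((i : ℕ) + 1) / 2 = i / 2 := by omega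
              have h3 : ((i : ℕ) + 1) % 2 = 1 := by omega
              simp only [Fin.removeNth, interleaveJ, h, hm, if_true, h2, h3]
              simp [ha]
            rw [e1, e2, h01]
            have : Even (i : ℕ) := Nat.even_iff.2 hm
            simp [this.neg_one_pow]
          · have e1 : (interleaveJ u : Fin (2 * k + 1 + 1) → CSpace n) i = complexJ n (u a) := by
              simp [interleaveJ, hm, ha]
            have e2 : i.removeNth (interleaveJ u : Fin (2 * k + 1 + 1) → CSpace n)
                ⟨2 * (a : ℕ), by omega⟩ = u a := by
              have h2 : ((i : ℕ) - 1) / 2 = i / 2 := by omega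
              have h3 : ((i : ℕ) - 1) % 2 = 0 := by omega
              simp only [Fin.removeNth, interleaveJ, h, hm, one_ne_zero, if_false, h2, h3]
              simp [ha]
            rw [e1, e2, h10]
            have : Odd (i : ℕ) := Nat.odd_iff.2 hm
            simp [this.neg_one_pow]
        · intro b c; exact h00 _ _
        · intro b c; exact h11 _ _
        · intro b c
          simp only [Fin.removeNth, h01, Fin.succAbove_right_inj]
        · intro b c
          simp only [Fin.removeNth, h10, Fin.succAbove_right_inj]
      · intro j _ hj
        have hj' : (j : ℕ) ≠ 2 * a := fun h => hj (Fin.ext h)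
        have hj2 := j.2
        have h : ((i.succAbove j) : ℕ) = if (j : ℕ) < i then (j : ℕ) else j + 1 := by
          simp only [Fin.succAbove, Fin.lt_def, Fin.val_castSucc]
          split_ifs <;> simp
        have hz : fundBilin G (interleaveJ u i)
            ((i.removeNth (interleaveJ u : Fin (2 * k + 1 + 1) → CSpace n)) j) = 0 := by
          simp only [Fin.removeNth, interleaveJ]
          have hne : ((i.succAbove j : ℕ) % 2 ≠ i % 2) → (i : ℕ) / 2 ≠ (i.succAbove j : ℕ) / 2 := by
            rw [h]; split_ifs <;> omega
          split_ifs with h1 h2 h2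
          · exact h00 _ _
          · rw [h01, if_neg]
            simp only [Fin.mk.injEq]
            exact hne (by omega)
          · rw [h10, if_neg]
            simp only [Fin.mk.injEq]
            exact hne (by omega)
          · exact h11 _ _
        rw [hz]; simp
      · simp
    rw [Finset.sum_congr rfl fun i _ => key i]
    simp only [Finset.sum_const, Finset.card_univ, Fintype.card_fin, nsmul_eq_mul, Nat.factorial_succ]
    rw [Complex.real_smul]
    push_cast
    ring

end WedgeAlgebra

/-! ### The Hermitian matrix of a form of degree `2n - 2` -/

section HermitianAlgebra

variable {n p : ℕ}

/-- The complex matrix of a real linear map that commutes with the complex structure. -/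
def complexMatrix (A : CSpace n →L[ℝ] CSpace n) : Matrix (Fin n) (Fin n) ℂ :=
  Matrix.of fun r s => A (coordVec s) r

theorem sum_smul_coordVec (u : CSpace n) : ∑ s, u s • coordVec s = u := by
  ext r
  simp [coordVec, Finset.sum_apply, Pi.single_apply]

theorem map_smul_of_commute {A : CSpace n →L[ℝ] CSpace n}
    (hA : ∀ u, A (complexJ n u) = complexJ n (A u)) (c : ℂ) (u : CSpace n) : A (c • u) = c • A u := by
  have h1 := hA u
  rw [complexJ_apply, complexJ_apply] at h1
  have : ∀ w : CSpace n, c • w = c.re • w + c.im • (Complex.I • w) := by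
    intro w
    nth_rw 1 [← Complex.re_add_im c]
    rw [add_smul, mul_smul]
    rfl
  rw [this, this, map_add, map_smul, map_smul, h1]

/-- A real linear map that commutes with the complex structure, as a complex linear map. -/
def complexLinearOf (A : CSpace n →L[ℝ] CSpace n)
    (hA : ∀ u, A (complexJ n u) = complexJ n (A u)) : CSpace n →ₗ[ℂ] CSpace n where
  toFun := A
  map_add' := map_add A
  map_smul' := map_smul_of_commute hA

theorem complexMatrix_mulVec {A : CSpace n →L[ℝ] CSpace n}
    (hA : ∀ u, A (complexJ n u) = complexJ n (A u)) (u : CSpace n) (r : Fin n) :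
    A u r = ∑ s, complexMatrix A r s * u s := by
  conv_lhs => rw [← sum_smul_coordVec u]
  simp only [map_sum, map_smul_of_commute hA, complexMatrix, Matrix.of_apply]
  simp [mul_comm]

theorem complexMatrix_comp {A B : CSpace n →L[ℝ] CSpace n}
    (hA : ∀ u, A (complexJ n u) = complexJ n (A u)) :
    complexMatrix (A ∘L B) = complexMatrix A * complexMatrix B := by
  ext r s
  rw [Matrix.mul_apply]
  exact complexMatrix_mulVec hA _ _

theorem complexMatrix_id : complexMatrix (ContinuousLinearMap.id ℝ (CSpace n)) = 1 := by
  ext r s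
  simp [complexMatrix, coordVec, Matrix.one_apply]

/-- The real linear map with a given complex matrix. -/
def ofComplexMatrix (A : Matrix (Fin n) (Fin n) ℂ) : CSpace n →L[ℝ] CSpace n :=
  (LinearMap.toContinuousLinearMap (Matrix.toEuclideanLin A)).restrictScalars ℝ

theorem ofComplexMatrix_apply (A : Matrix (Fin n) (Fin n) ℂ) (u : CSpace n) (r : Fin n) :
    ofComplexMatrix A u r = ∑ s, A r s * u s := by
  simp [ofComplexMatrix, Matrix.mulVec, dotProduct]

theorem ofComplexMatrix_commute (A : Matrix (Fin n) (Fin n) ℂ) (u : CSpace n) :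
    ofComplexMatrix A (complexJ n u) = complexJ n (ofComplexMatrix A u) := by
  simp [ofComplexMatrix, complexJ_apply]

theorem complexMatrix_ofComplexMatrix (A : Matrix (Fin n) (Fin n) ℂ) :
    complexMatrix (ofComplexMatrix A) = A := by
  ext r s
  simp [complexMatrix, ofComplexMatrix_apply, coordVec]

theorem det_eq_normSq {A : CSpace n →L[ℝ] CSpace n}
    (hA : ∀ u, A (complexJ n u) = complexJ n (A u)) :
    LinearMap.det (A : CSpace n →ₗ[ℝ] CSpace n) = Complex.normSq (complexMatrix A).det := by
  have h1 : (A : CSpace n →ₗ[ℝ] CSpace n) = (complexLinearOf A hA).restrictScalars ℝ := rfl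
  have h2 : LinearMap.det (complexLinearOf A hA) = (complexMatrix A).det := by
    rw [← LinearMap.det_toMatrix (EuclideanSpace.basisFun (Fin n) ℂ).toBasis]
    congr 1
  rw [h1, LinearMap.det_restrictScalars, Algebra.norm_complex_apply, h2]

/-- The real frame `(∂/∂x^1, ∂/∂y^1, …, ∂/∂x^n, ∂/∂y^n)`. -/
def stdFrame (n : ℕ) : Fin (2 * n) → CSpace n := interleaveJ coordVec

theorem interleaveJ_comp {k : ℕ} {A : CSpace n →L[ℝ] CSpace n}
    (hA : ∀ u, A (complexJ n u) = complexJ n (A u)) (u : Fin k → CSpace n) :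
    interleaveJ (fun a => A (u a)) = fun s => A (interleaveJ u s) := by
  funext s
  simp only [interleaveJ]
  split_ifs <;> simp [hA]

theorem linearIndependent_stdFrame : LinearIndependent ℝ (stdFrame n) := by
  rw [Fintype.linearIndependent_iff]
  intro c hc
  have h : ∀ r : Fin n, c ⟨2 * r, by omega⟩ = 0 ∧ c ⟨2 * r + 1, by omega⟩ = 0 := by
    intro r
    have h1 := congrArg (fun u : CSpace n => u r) hc
    have h2 : ∀ s : Fin (2 * n), (stdFrame n s) r =
        (if s = ⟨2 * r, by omega⟩ then 1 else 0) + (if s = ⟨2 * r + 1, by omega⟩ then Complex.I else 0) := by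
      intro s
      have hs := s.2
      have e1 : (r = ⟨(s : ℕ) / 2, by omega⟩ ↔ (r : ℕ) = s / 2) := by rw [Fin.ext_iff]
      simp only [stdFrame, interleaveJ, Fin.ext_iff]
      split_ifs <;>
        simp [coordVec, complexJ_apply, e1] <;> omega
    simp [Finset.sum_apply, h2, Finset.sum_add_distrib] at h1
    constructor
    · simpa using congrArg Complex.re h1
    · simpa using congrArg Complex.im h1
  intro s
  rcases Nat.mod_two_eq_zero_or_one (s : ℕ) with hs | hs
  · convert (h ⟨s / 2, by omega⟩).1 using 2
    ext; simp; omega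
  · convert (h ⟨s / 2, by omega⟩).2 using 2
    ext; simp; omega

/-- The real basis `stdFrame`. -/
def stdBasis (n : ℕ) : Module.Basis (Fin (2 * n)) ℝ (CSpace n) :=
  basisOfLinearIndependentOfCardEqFinrank' _ linearIndependent_stdFrame (by
    rw [Fintype.card_fin, finrank_real_of_complex, finrank_euclideanSpace, Fintype.card_fin])

/-- A form of top degree is multiplied by the real determinant `|det A|²` under a complex linear
map. -/
theorem top_re_comp (ψ : CForm n (2 * n)) {A : CSpace n →L[ℝ] CSpace n}
    (hA : ∀ u, A (complexJ n u) = complexJ n (A u)) :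
    (ψ.compContinuousLinearMap A (stdFrame n)).re =
      Complex.normSq (complexMatrix A).det * (ψ (stdFrame n)).re := by
  let φ : CSpace n [⋀^Fin (2 * n)]→ₗ[ℝ] ℝ :=
    Complex.reLm.compAlternatingMap ψ.toAlternatingMap
  have hb : ⇑(stdBasis n) = stdFrame n := by simp [stdBasis]
  have h1 : φ (fun s => A (stdBasis n s)) = (stdBasis n).det (fun s => A (stdBasis n s)) * φ (stdBasis n) := by
    conv_lhs => rw [φ.eq_smul_basis_det (stdBasis n)]
    simp [mul_comm]
  have h2 : (stdBasis n).det (fun s => A (stdBasis n s)) = LinearMap.det (A : CSpace n →ₗ[ℝ] CSpace n) := by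
    have := (stdBasis n).det_comp (A : CSpace n →ₗ[ℝ] CSpace n) (stdBasis n)
    simpa [Module.Basis.det_self, Function.comp_def] using this
  rw [h2, det_eq_normSq hA, hb] at h1
  exact h1

/-- The tensor `ξ ∘ J ⊗ η - ξ ⊗ η ∘ J`; its skew part is `i (ξ' ∧ η'' + η' ∧ ξ'')`, where `ξ'` and `ξ''` are
the complex linear and the antilinear part of `ξ`. -/
def leviBilin (n : ℕ) : Covec n →L[ℝ] Covec n →L[ℝ] RealBilin n :=
  LinearMap.toContinuousBilinearMap (LinearMap.mk₂ ℝ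
    (fun ξ η : Covec n => (ξ ∘L complexJ n).smulRight η - ξ.smulRight (η ∘L complexJ n))
    (by intros; ext; simp; ring) (by intros; ext; simp; ring)
    (by intros; ext; simp; ring) (by intros; ext; simp; ring))

theorem leviBilin_apply (ξ η : Covec n) (u w : CSpace n) :
    leviBilin n ξ η u w = ξ (complexJ n u) * η w - ξ u * η (complexJ n w) := rfl

theorem leviBilin_comp {A : CSpace n →L[ℝ] CSpace n}
    (hA : ∀ u, A (complexJ n u) = complexJ n (A u)) (ξ η : Covec n) :
    leviBilin n (ξ ∘L A) (η ∘L A) = (leviBilin n ξ η).bilinearComp A A := by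
  ext u w
  simp [leviBilin_apply, hA]

theorem leviBilin_compJ (ξ η : Covec n) :
    leviBilin n (ξ ∘L complexJ n) (η ∘L complexJ n) = leviBilin n ξ η := by
  ext u w
  simp [leviBilin_apply, complexJ_complexJ]
  ring

/-- The real bilinear form `K_Φ(ξ, η) = (leviBilin ξ η ∧ Φ)(stdFrame)` on covectors attached to a form `Φ` of
degree `2n - 2`. -/
def cofForm (Φ : CForm (p + 1) (2 * p)) (ξ η : Covec (p + 1)) : ℝ :=
  (wedgeTwo (leviBilin (p + 1) ξ η) Φ (stdFrame (p + 1))).re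

theorem cofForm_eq (Φ : CForm (p + 1) (2 * p)) (ξ η : Covec (p + 1)) : cofForm Φ ξ η =
  (wedgeTwoL (p + 1) (2 * p) Φ (leviBilin (p + 1) ξ η) (stdFrame (p + 1))).re := rfl

theorem cofForm_symm (Φ : CForm (p + 1) (2 * p)) (ξ η : Covec (p + 1)) :
    cofForm Φ ξ η = cofForm Φ η ξ := by
  rw [cofForm, cofForm, wedgeTwo_congr_skew]
  intro u w
  simp only [leviBilin_apply]
  ring

theorem cofForm_compJ (Φ : CForm (p + 1) (2 * p)) (ξ η : Covec (p + 1)) :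
    cofForm Φ (ξ ∘L complexJ (p + 1)) (η ∘L complexJ (p + 1)) = cofForm Φ ξ η := by
  rw [cofForm, leviBilin_compJ, cofForm]

theorem cofForm_compJ_left (Φ : CForm (p + 1) (2 * p)) (ξ η : Covec (p + 1)) :
    cofForm Φ (ξ ∘L complexJ (p + 1)) η = -cofForm Φ ξ (η ∘L complexJ (p + 1)) := by
  have h : η = -((η ∘L complexJ (p + 1)) ∘L complexJ (p + 1)) := by
    ext u; simp [complexJ_complexJ]
  conv_lhs => rw [h]
  have h2 := cofForm_compJ Φ ξ (η ∘L complexJ (p + 1))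
  rw [← h2, cofForm_eq, cofForm_eq]
  simp

/-- The form `K_Φ` is natural up to the real determinant, since a top degree form occurs in its definition. -/
theorem cofForm_comp (Φ : CForm (p + 1) (2 * p)) {A : CSpace (p + 1) →L[ℝ] CSpace (p + 1)}
    (hA : ∀ u, A (complexJ (p + 1) u) = complexJ (p + 1) (A u)) (ξ η : Covec (p + 1)) :
    cofForm (Φ.compContinuousLinearMap A) (ξ ∘L A) (η ∘L A) =
      Complex.normSq (complexMatrix A).det * cofForm Φ ξ η := by
  rw [cofForm, leviBilin_comp hA, wedgeTwo_comp]
  exact top_re_comp _ hA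

/-- The coordinates `ξ_r = ξ(∂/∂x^r) - i ξ(∂/∂y^r)` of the complex covector whose real part is `ξ`. -/
def covecCoord (ξ : Covec n) (r : Fin n) : ℂ :=
  (ξ (coordVec r) : ℂ) - Complex.I * (ξ (complexJ n (coordVec r)) : ℂ)

theorem covecCoord_compJ (ξ : Covec n) (r : Fin n) :
    covecCoord (ξ ∘L complexJ n) r = Complex.I * covecCoord ξ r := by
  simp only [covecCoord, ContinuousLinearMap.comp_apply, complexJ_complexJ, map_neg]
  push_cast
  linear_combination (ξ (complexJ n (coordVec r)) : ℂ) * Complex.I_sq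

/-- The covector `dx^r`. -/
abbrev dx (r : Fin n) : Covec n := realCovec (.inl r)

theorem dx_apply (r : Fin n) (u : CSpace n) : dx r u = (u r).re := rfl

theorem covecCoord_dx_comp {A : CSpace n →L[ℝ] CSpace n}
    (hA : ∀ u, A (complexJ n u) = complexJ n (A u)) (r s : Fin n) :
    covecCoord (dx r ∘L A) s = complexMatrix A r s := by
  simp only [covecCoord, ContinuousLinearMap.comp_apply, dx_apply, hA]
  simp only [complexMatrix, Matrix.of_apply, complexJ_apply]
  apply Complex.ext <;> simp

theorem apply_eq_re_sum (ξ : Covec n) (u : CSpace n) : ξ u = (∑ r, covecCoord ξ r * u r).re := by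
  conv_lhs => rw [← sum_smul_coordVec u]
  rw [map_sum, Complex.re_sum]
  refine Finset.sum_congr rfl fun r _ => ?_
  have : u r • coordVec r = (u r).re • coordVec r + (u r).im • complexJ n (coordVec r) := by
    nth_rw 1 [← Complex.re_add_im (u r)]
    rw [add_smul, mul_smul, complexJ_apply]
    rfl
  rw [this, map_add, map_smul, map_smul]
  simp [covecCoord]
  ring

theorem eq_sum_covecCoord (ξ : Covec n) :
    ξ = ∑ r, ((covecCoord ξ r).re • dx r + (covecCoord ξ r).im • (dx r ∘L complexJ n)) := by
  ext u
  rw [apply_eq_re_sum, Complex.re_sum]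
  simp only [sum_apply, add_apply, smul_apply, ContinuousLinearMap.comp_apply, dx_apply,
    complexJ_apply, smul_eq_mul]
  refine Finset.sum_congr rfl fun r _ => ?_
  simp
  ring

/-- The Hermitian matrix `P_{rs}` of `K_Φ`: `K_Φ(ξ, η) = Re ∑ P_{rs} ξ_r η̄_s`. -/
def cofMatrix (Φ : CForm (p + 1) (2 * p)) : Matrix (Fin (p + 1)) (Fin (p + 1)) ℂ :=
  Matrix.of fun r s => (cofForm Φ (dx r) (dx s) : ℂ) +
    Complex.I * (cofForm Φ (dx r) (dx s ∘L complexJ (p + 1)) : ℂ)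

theorem cofForm_eq_sum (Φ : CForm (p + 1) (2 * p)) (ξ η : Covec (p + 1)) :
    cofForm Φ ξ η = (∑ r, ∑ s, cofMatrix Φ r s * covecCoord ξ r * star (covecCoord η s)).re := by
  conv_lhs => rw [eq_sum_covecCoord ξ, eq_sum_covecCoord η]
  rw [cofForm_eq]
  simp only [map_sum, map_add, map_smul, sum_apply, add_apply, smul_apply, 
    ContinuousAlternatingMap.sum_apply, ContinuousAlternatingMap.add_apply,
    ContinuousAlternatingMap.smul_apply, Complex.re_sum, Complex.add_re, Complex.real_smul,
    Complex.re_ofReal_mul, ← cofForm_eq, cofForm_compJ_left]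
  rw [Finset.sum_comm]
  refine Finset.sum_congr rfl fun s _ => ?_
  rw [Finset.mul_sum, Finset.mul_sum, ← Finset.sum_add_distrib]
  refine Finset.sum_congr rfl fun r _ => ?_
  have hJJ := cofForm_compJ_left Φ (dx r) (dx s ∘L complexJ (p + 1))
  rw [cofForm_compJ] at hJJ
  rw [← hJJ]
  simp [cofMatrix]
  ring

theorem cofMatrix_isHermitian (Φ : CForm (p + 1) (2 * p)) : (cofMatrix Φ).IsHermitian := by
  ext r s
  rw [Matrix.conjTranspose_apply]
  simp only [cofMatrix, Matrix.of_apply]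
  rw [cofForm_symm Φ (dx s) (dx r), cofForm_symm Φ (dx s) (dx r ∘L _), cofForm_compJ_left]
  simp

/-- Transformation of `cofMatrix` under a complex linear map. -/
theorem cofMatrix_comp (Φ : CForm (p + 1) (2 * p)) {A : CSpace (p + 1) →L[ℝ] CSpace (p + 1)}
    (hA : ∀ u, A (complexJ (p + 1) u) = complexJ (p + 1) (A u)) :
    complexMatrix A * cofMatrix (Φ.compContinuousLinearMap A) * (complexMatrix A).conjTranspose =
      (Complex.normSq (complexMatrix A).det : ℂ) • cofMatrix Φ := by
  ext r s
  have h1 := cofForm_comp Φ hA (dx r) (dx s)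
  have h2 := cofForm_comp Φ hA (dx r) (dx s ∘L complexJ (p + 1))
  have h3 : (dx s ∘L complexJ (p + 1)) ∘L A = (dx s ∘L A) ∘L complexJ (p + 1) := by
    ext u; simp [hA]
  rw [h3] at h2
  rw [cofForm_eq_sum] at h1 h2
  simp only [covecCoord_compJ, covecCoord_dx_comp hA] at h1 h2
  have h4 : (complexMatrix A * cofMatrix (Φ.compContinuousLinearMap A) *
      (complexMatrix A).conjTranspose) r s =
      ∑ k, ∑ l, cofMatrix (Φ.compContinuousLinearMap A) k l * complexMatrix A r k *
        star (complexMatrix A s l) := by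
    rw [Matrix.mul_apply, Finset.sum_comm]
    refine Finset.sum_congr rfl fun l _ => ?_
    rw [Matrix.mul_apply, Finset.sum_mul]
    refine Finset.sum_congr rfl fun k _ => ?_
    rw [Matrix.conjTranspose_apply]
    ring
  have h5 : (∑ k, ∑ l, cofMatrix (Φ.compContinuousLinearMap A) k l * complexMatrix A r k *
        star (Complex.I * complexMatrix A s l)).re = (∑ k, ∑ l, cofMatrix (Φ.compContinuousLinearMap A) k l * complexMatrix A r k *
        star (complexMatrix A s l)).im := by
    simp only [Complex.re_sum, Complex.im_sum]
    refine Finset.sum_congr rfl fun k _ => Finset.sum_congr rfl fun l _ => ?_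
    simp
    ring
  rw [h5] at h2
  rw [h4]
  apply Complex.ext
  · rw [h1]; simp [cofMatrix]
  · rw [h2]; simp [cofMatrix]

end HermitianAlgebra

/-! ### Hermitian bilinear forms and their matrices -/

section HermitianForms

open scoped ComplexOrder

variable {n p : ℕ}

/-- The bilinear form `G(u, w) = 2 Re ∑ H_{rs} u_r w̄_s` with matrix `H`. -/
def matrixBilin (H : Matrix (Fin n) (Fin n) ℂ) : RealBilin n :=
  ∑ r, ∑ s, ((H r s).re • ((2 : ℝ) • ((realCovec (.inl r)).smulRight (realCovec (.inl s)) +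
      (realCovec (.inr r)).smulRight (realCovec (.inr s)) : RealBilin n)) +
    (H r s).im • ((2 : ℝ) • ((realCovec (.inl r)).smulRight (realCovec (.inr s)) -
      (realCovec (.inr r)).smulRight (realCovec (.inl s)) : RealBilin n)))

theorem matrixBilin_apply (H : Matrix (Fin n) (Fin n) ℂ) (u w : CSpace n) :
    matrixBilin H u w = 2 * (∑ r, ∑ s, H r s * u r * star (w s)).re := by
  simp only [matrixBilin, sum_apply, Complex.re_sum, Finset.mul_sum]
  refine Finset.sum_congr rfl fun r _ => Finset.sum_congr rfl fun s _ => ?_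
  simp [realCovec]
  ring

theorem hermMatrix_matrixBilin (H : Matrix (Fin n) (Fin n) ℂ) : hermMatrix (matrixBilin H) = H := by
  ext r s
  simp only [hermMatrix, Matrix.of_apply, matrixBilin_apply]
  have h1 : ∀ c : ℂ, (∑ r', ∑ s', H r' s' * (coordVec r : CSpace n) r' *
      star ((c • coordVec s : CSpace n) s')) = H r s * star c := by
    intro c
    simp [coordVec, apply_ite]
  have h2 := h1 1
  rw [one_smul] at h2
  rw [complexJ_apply, h2, h1]
  apply Complex.ext <;> simp

theorem matrixBilin_invariant (H : Matrix (Fin n) (Fin n) ℂ) (u w : CSpace n) :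
    matrixBilin H (complexJ n u) (complexJ n w) = matrixBilin H u w := by
  rw [matrixBilin_apply, matrixBilin_apply]
  congr 2
  refine Finset.sum_congr rfl fun r _ => Finset.sum_congr rfl fun s _ => ?_
  simp only [complexJ_apply, PiLp.smul_apply, smul_eq_mul, star_mul', Complex.star_def, Complex.conj_I]
  linear_combination (-(H r s * u r * (starRingEnd ℂ) (w s))) * Complex.I_sq

theorem matrixBilin_symm {H : Matrix (Fin n) (Fin n) ℂ} (hH : H.IsHermitian) (u w : CSpace n) :
    matrixBilin H u w = matrixBilin H w u := by
  rw [matrixBilin_apply, matrixBilin_apply, ← Complex.conj_re, map_sum]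
  simp only [map_sum]
  rw [Finset.sum_comm]
  congr 2
  refine Finset.sum_congr rfl fun r _ => Finset.sum_congr rfl fun s _ => ?_
  have h := hH.apply r s
  simp only [map_mul, Complex.star_def, Complex.conj_conj] at h ⊢
  rw [h]
  ring

theorem matrixBilin_self {H : Matrix (Fin n) (Fin n) ℂ} (u : CSpace n) :
    matrixBilin H u u = 2 * (star (star (⇑u)) ⬝ᵥ (H.mulVec (star (⇑u)))).re := by
  rw [matrixBilin_apply]
  congr 2
  simp [dotProduct, Matrix.mulVec, Finset.mul_sum]
  refine Finset.sum_congr rfl fun r _ => Finset.sum_congr rfl fun s _ => ?_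
  ring

theorem matrixBilin_pos {H : Matrix (Fin n) (Fin n) ℂ} (hH : H.PosDef) {u : CSpace n} (hu : u ≠ 0) :
    0 < matrixBilin H u u := by
  rw [matrixBilin_self]
  have : star (⇑u) ≠ 0 := by
    intro h
    apply hu
    ext r
    simpa using congrFun h r
  have := hH.re_dotProduct_pos this
  simp only [RCLike.re_to_complex] at this
  linarith

theorem matrixBilin_comp (H : Matrix (Fin n) (Fin n) ℂ) {A : CSpace n →L[ℝ] CSpace n}
    (hA : ∀ u, A (complexJ n u) = complexJ n (A u)) :
    (matrixBilin H).bilinearComp A A =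
      matrixBilin ((complexMatrix A).transpose * H * (complexMatrix A).map star) := by
  ext u w
  rw [ContinuousLinearMap.bilinearComp_apply, matrixBilin_apply, matrixBilin_apply]
  congr 2
  simp only [complexMatrix_mulVec hA, Matrix.mul_apply, Matrix.transpose_apply, Matrix.map_apply,
    star_sum, star_mul', Finset.mul_sum, Finset.sum_mul]
  -- both sides are the same sum over four indices, in a different order
  calc _ = ∑ k, ∑ l, ∑ s, ∑ r, H k l * (complexMatrix A k r * u r) *
        (star (complexMatrix A l s) * star (w s)) := rfl
    _ = _ := ?_
  calc _ = ∑ k, ∑ l, ∑ r, ∑ s, H k l * (complexMatrix A k r * u r) *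
        (star (complexMatrix A l s) * star (w s)) := by
        refine Finset.sum_congr rfl fun k _ => Finset.sum_congr rfl fun l _ => Finset.sum_comm
    _ = ∑ k, ∑ r, ∑ l, ∑ s, H k l * (complexMatrix A k r * u r) *
        (star (complexMatrix A l s) * star (w s)) := by
        refine Finset.sum_congr rfl fun k _ => Finset.sum_comm
    _ = ∑ r, ∑ k, ∑ l, ∑ s, H k l * (complexMatrix A k r * u r) *
        (star (complexMatrix A l s) * star (w s)) := Finset.sum_comm
    _ = ∑ r, ∑ k, ∑ s, ∑ l, H k l * (complexMatrix A k r * u r) *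
        (star (complexMatrix A l s) * star (w s)) := by
        refine Finset.sum_congr rfl fun k _ => Finset.sum_congr rfl fun l _ => Finset.sum_comm
    _ = ∑ r, ∑ s, ∑ k, ∑ l, H k l * (complexMatrix A k r * u r) *
        (star (complexMatrix A l s) * star (w s)) := by
        refine Finset.sum_congr rfl fun k _ => Finset.sum_comm
    _ = _ := by
        refine Finset.sum_congr rfl fun r _ => Finset.sum_congr rfl fun s _ => ?_
        rw [Finset.sum_comm]
        refine Finset.sum_congr rfl fun k _ => Finset.sum_congr rfl fun l _ => ?_
        ring

/-- A symmetric form that is invariant under the complex structure is determined by its matrix. -/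
theorem matrixBilin_hermMatrix {G : RealBilin n}
    (hJ : ∀ u w, G (complexJ n u) (complexJ n w) = G u w) : matrixBilin (hermMatrix G) = G := by
  have hJ1 : ∀ u w, G (complexJ n u) w = -G u (complexJ n w) := by
    intro u w
    rw [← hJ, complexJ_complexJ]; simp
  have hu : ∀ u : CSpace n, u = ∑ r, ((u r).re • coordVec r + (u r).im • complexJ n (coordVec r)) := by
    intro u
    conv_lhs => rw [← sum_smul_coordVec u]
    refine Finset.sum_congr rfl fun r _ => ?_
    nth_rw 1 [← Complex.re_add_im (u r)]
    rw [add_smul, mul_smul, complexJ_apply]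
    rfl
  ext u w
  rw [matrixBilin_apply]
  conv_rhs => rw [hu u, hu w]
  simp only [map_sum, map_add, map_smul, sum_apply, add_apply, smul_apply, smul_eq_mul, hJ1,
    complexJ_complexJ, map_neg, Complex.re_sum, Finset.mul_sum]
  rw [Finset.sum_comm]
  refine Finset.sum_congr rfl fun s _ => ?_
  rw [← Finset.sum_add_distrib]
  refine Finset.sum_congr rfl fun r _ => ?_
  simp [hermMatrix]
  ring

theorem hermMatrix_isHermitian {G : RealBilin n} (hs : ∀ u w, G u w = G w u)
    (hJ : ∀ u w, G (complexJ n u) (complexJ n w) = G u w) : (hermMatrix G).IsHermitian := by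
  ext r s
  have h : G (coordVec s) (complexJ n (coordVec r)) = - G (coordVec r) (complexJ n (coordVec s)) := by
    rw [hs, ← hJ, complexJ_complexJ, map_neg]; simp
  rw [Matrix.conjTranspose_apply]
  simp only [hermMatrix, Matrix.of_apply]
  rw [h, hs (coordVec s)]
  apply Complex.ext <;> simp

theorem hermMatrix_posDef {G : RealBilin n} (hs : ∀ u w, G u w = G w u)
    (hJ : ∀ u w, G (complexJ n u) (complexJ n w) = G u w) (hp : ∀ u, u ≠ 0 → 0 < G u u) :
    (hermMatrix G).PosDef := by
  refine Matrix.PosDef.of_dotProduct_mulVec_pos (hermMatrix_isHermitian hs hJ) fun x hx => ?_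
  have hu : WithLp.toLp 2 (star x) ≠ (0 : CSpace n) := by
    intro h
    apply hx
    funext r
    simpa using congrArg (fun u : CSpace n => u r) h
  have h := hp _ hu
  rw [← matrixBilin_hermMatrix hJ, matrixBilin_self] at h
  rw [Complex.pos_iff]
  have h3 := (hermMatrix_isHermitian hs hJ).im_star_dotProduct_mulVec_self x
  refine ⟨?_, h3.symm⟩
  simp only [star_star] at h
  linarith

end HermitianForms

/-! ### Positivity and injectivity of the matrix of a form -/

section CofactorMatrix

open scoped ComplexOrder

variable {n p : ℕ}

theorem normSq_det_of_unitary {U : Matrix (Fin n) (Fin n) ℂ} (hU : U * U.conjTranspose = 1) :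
    Complex.normSq U.det = 1 := by
  have h := congrArg Matrix.det hU
  rw [Matrix.det_mul, Matrix.det_conjTranspose, Matrix.det_one, Complex.star_def, Complex.mul_conj] at h
  exact_mod_cast h

theorem cofMatrix_comp_unitary (Φ : CForm (p + 1) (2 * p)) {U : Matrix (Fin (p + 1)) (Fin (p + 1)) ℂ}
    (hU : U * U.conjTranspose = 1) :
    cofMatrix (Φ.compContinuousLinearMap (ofComplexMatrix U)) = U.conjTranspose * cofMatrix Φ * U := by
  have h := cofMatrix_comp Φ (ofComplexMatrix_commute U)
  rw [complexMatrix_ofComplexMatrix, normSq_det_of_unitary hU, Complex.ofReal_one, one_smul] at h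
  have hU' : U.conjTranspose * U = 1 := mul_eq_one_comm.1 hU
  rw [← h]
  simp only [Matrix.mul_assoc, hU', Matrix.mul_one]
  rw [← Matrix.mul_assoc, hU', Matrix.one_mul]

/-- The diagonal entries of `cofMatrix Φ` are the values of `Φ` on the coordinate frames with one complex
coordinate omitted. -/
theorem cofForm_dx_self (Φ : CForm (p + 1) (2 * p)) (r : Fin (p + 1)) :
    cofForm Φ (dx r) (dx r) = (Φ (interleaveJ (coordVec ∘ r.succAbove))).re := by
  set σ : Equiv.Perm (Fin (p + 1)) := r.cycleRange.symm with hσ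
  -- a permutation of the complex coordinates that moves `r` to the first place
  have hA := ofComplexMatrix_commute (σ⁻¹.permMatrix ℂ)
  have hAe : ∀ a, ofComplexMatrix (σ⁻¹.permMatrix ℂ) (coordVec a) = coordVec (σ a) := by
    intro a
    ext s
    rw [ofComplexMatrix_apply]
    simp [coordVec, Equiv.Perm.permMatrix, PEquiv.toMatrix_apply, Equiv.toPEquiv_apply,
      Equiv.Perm.inv_def, Equiv.symm_apply_eq]
  have hdet : Complex.normSq (complexMatrix (ofComplexMatrix (σ⁻¹.permMatrix ℂ))).det = 1 := by
    rw [complexMatrix_ofComplexMatrix]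
    apply normSq_det_of_unitary
    rw [Matrix.conjTranspose_permMatrix, inv_inv, ← Matrix.permMatrix_mul]
    simp
  have hfr : (fun s => ofComplexMatrix (σ⁻¹.permMatrix ℂ) (stdFrame (p + 1) s)) =
      interleaveJ (Fin.cons (coordVec r) (coordVec ∘ r.succAbove)) := by
    rw [stdFrame, ← interleaveJ_comp hA]
    congr 1
    funext a
    rw [hAe, hσ]
    refine Fin.cases ?_ (fun a => ?_) a
    · rw [Fin.cycleRange_symm_zero, Fin.cons_zero]
    · rw [Fin.cycleRange_symm_succ, Fin.cons_succ]; rfl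
  have h := top_re_comp (wedgeTwo (leviBilin (p + 1) (dx r) (dx r)) Φ) hA
  rw [hdet, one_mul] at h
  rw [cofForm]
  refine h.symm.trans ?_
  rw [ContinuousAlternatingMap.compContinuousLinearMap_apply]
  refine (congrArg (fun v => (wedgeTwo (leviBilin (p + 1) (dx r) (dx r)) Φ v).re)
    (hfr.trans (interleaveJ_cons _ _))).trans ?_
  have hv : ∀ i, dx r (interleaveJ (coordVec ∘ r.succAbove) i) = 0 ∧
      dx r (complexJ (p + 1) (interleaveJ (coordVec ∘ r.succAbove) i)) = 0 := by
    intro i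
    simp only [interleaveJ, dx_apply, complexJ_apply, Function.comp_apply]
    split_ifs <;> simp [coordVec, (Fin.succAbove_ne _ _).symm]
  have hr : dx r (coordVec r) = 1 := by simp [dx_apply, coordVec]
  have hr' : dx r (complexJ (p + 1) (coordVec r)) = 0 := by simp [dx_apply, coordVec, complexJ_apply]
  rw [wedgeTwo_apply_of_vanish]
  · simp [leviBilin_apply, complexJ_complexJ, hr, hr']
    norm_num
    ring
  · intro i
    ext w
    simp [leviBilin_apply, hv]
  · intro w i
    simp [leviBilin_apply, hv]

theorem cofMatrix_self (Φ : CForm (p + 1) (2 * p)) (r : Fin (p + 1)) :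
    cofMatrix Φ r r = ((Φ (interleaveJ (coordVec ∘ r.succAbove))).re : ℂ) := by
  rw [← cofForm_dx_self]
  have h := cofForm_compJ_left Φ (dx r) (dx r)
  rw [cofForm_symm] at h
  have h0 : cofForm Φ (dx r) (dx r ∘L complexJ (p + 1)) = 0 := by linarith
  simp [cofMatrix, h0]

/-- Any form of degree `2n - 2` has a diagonal matrix in a suitable unitary frame. -/
theorem exists_unitary_cofMatrix_comp (Φ : CForm (p + 1) (2 * p)) :
    ∃ U : Matrix (Fin (p + 1)) (Fin (p + 1)) ℂ, U * U.conjTranspose = 1 ∧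
      cofMatrix (Φ.compContinuousLinearMap (ofComplexMatrix U)) =
        Matrix.diagonal (fun r => ((cofMatrix_isHermitian Φ).eigenvalues r : ℂ)) := by
  have hP := cofMatrix_isHermitian Φ
  have h2 : (hP.eigenvectorUnitary : Matrix (Fin (p + 1)) (Fin (p + 1)) ℂ) *
      (hP.eigenvectorUnitary : Matrix (Fin (p + 1)) (Fin (p + 1)) ℂ).conjTranspose = 1 := by
    have := Unitary.coe_mul_star_self hP.eigenvectorUnitary
    rwa [Unitary.coe_star, Matrix.star_eq_conjTranspose] at this
  have h3 := mul_eq_one_comm.1 h2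
  refine ⟨hP.eigenvectorUnitary, h2, ?_⟩
  rw [cofMatrix_comp_unitary _ h2]
  have hs := hP.spectral_theorem
  rw [Unitary.conjStarAlgAut_apply, Matrix.star_eq_conjTranspose] at hs
  refine (congrArg (fun X => (hP.eigenvectorUnitary : Matrix (Fin (p + 1)) (Fin (p + 1)) ℂ).conjTranspose *
    X * (hP.eigenvectorUnitary : Matrix (Fin (p + 1)) (Fin (p + 1)) ℂ)) hs).trans ?_
  simp only [Matrix.mul_assoc, h3, Matrix.mul_one]
  rw [← Matrix.mul_assoc, h3, Matrix.one_mul]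
  rfl

/-- In a unitary frame that diagonalizes the matrix, the eigenvalues are values of `Φ` on tuples
`(u₁, iu₁, …)` with linearly independent `u_a`. -/
theorem cofMatrix_posDef {Φ : CForm (p + 1) (2 * p)} (hΦ : IsPositiveForm Φ) :
    (cofMatrix Φ).PosDef := by
  obtain ⟨U, hU, hd⟩ := exists_unitary_cofMatrix_comp Φ
  rw [(cofMatrix_isHermitian Φ).posDef_iff_eigenvalues_pos]
  intro r
  have h := congrFun (congrFun hd r) r
  rw [cofMatrix_self, Matrix.diagonal_apply_eq, Complex.ofReal_inj] at h
  rw [← h, ContinuousAlternatingMap.compContinuousLinearMap_apply]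
  have h1 := interleaveJ_comp (ofComplexMatrix_commute U) (coordVec ∘ r.succAbove)
  have h2 : (⇑(ofComplexMatrix U) ∘ interleaveJ (coordVec ∘ r.succAbove)) =
    interleaveJ (fun a => ofComplexMatrix U ((coordVec ∘ r.succAbove) a)) := h1.symm
  rw [h2]
  refine (hΦ _ ?_).1
  have hli : LinearIndependent ℂ (fun a => (coordVec (r.succAbove a) : CSpace (p + 1))) := by
    have := (EuclideanSpace.basisFun (Fin (p + 1)) ℂ).toBasis.linearIndependent.comp _
      r.succAbove_right_injective
    have he : (fun a => (coordVec (r.succAbove a) : CSpace (p + 1))) =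
        (EuclideanSpace.basisFun (Fin (p + 1)) ℂ).toBasis ∘ r.succAbove := by
      funext a
      simp [coordVec]
    rw [he]
    exact this
  have hk : LinearMap.ker (complexLinearOf _ (ofComplexMatrix_commute U)) = ⊥ := by
    rw [LinearMap.ker_eq_bot]
    have hc : ∀ u, ofComplexMatrix U.conjTranspose (ofComplexMatrix U u) = u := by
      intro u
      ext r
      simp [ofComplexMatrix, Matrix.mulVec_mulVec, mul_eq_one_comm.1 hU]
    exact Function.LeftInverse.injective hc
  exact hli.map' _ hk

/-- A real form of degree `2n - 2` that is invariant under the complex structure is determined by its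
matrix. -/
theorem eq_zero_of_cofMatrix_eq_zero {Φ : CForm (p + 1) (2 * p)} (hre : ∀ u, (Φ u).im = 0)
    (hJ : Φ.compContinuousLinearMap (complexJ (p + 1)) = Φ) (h0 : cofMatrix Φ = 0) : Φ = 0 := by
  have hK : ∀ ξ η, cofForm Φ ξ η = 0 := by
    intro ξ η
    rw [cofForm_eq_sum, h0]
    simp
  have hJJ : ∀ u, complexJ (p + 1) (complexJ (p + 1) u) = complexJ (p + 1) (complexJ (p + 1) u) :=
    fun _ => rfl
  have hdet : Complex.normSq (complexMatrix (complexJ (p + 1))).det = 1 := by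
    apply normSq_det_of_unitary
    have : complexMatrix (complexJ (p + 1)) = Complex.I • (1 : Matrix (Fin (p + 1)) (Fin (p + 1)) ℂ) := by
      ext r s
      simp [complexMatrix, complexJ_apply, coordVec, Matrix.one_apply]
    rw [this]
    simp [Matrix.conjTranspose_smul, smul_smul]
  -- by invariance, the `J`-anti-invariant part of a two-form does not contribute to its product with `Φ`
  have hB : ∀ ξ η : Covec (p + 1),
      (wedgeTwo (ξ.smulRight η : RealBilin (p + 1)) Φ (stdFrame (p + 1))).re = 0 := by
    intro ξ η
    set B : RealBilin (p + 1) := ξ.smulRight η with hBdef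
    have h1 := top_re_comp (wedgeTwo B Φ) hJJ
    rw [hdet, one_mul] at h1
    have h2 := wedgeTwo_comp B Φ (complexJ (p + 1))
    rw [hJ] at h2
    have h3 : leviBilin (p + 1) ξ (η ∘L complexJ (p + 1)) =
        B + B.bilinearComp (complexJ (p + 1)) (complexJ (p + 1)) := by
      ext u w
      simp [leviBilin_apply, hBdef, complexJ_complexJ]
      ring
    have h4 := hK ξ (η ∘L complexJ (p + 1))
    rw [cofForm_eq, h3, map_add, wedgeTwoL_apply, wedgeTwoL_apply, h2] at h4
    have h5 : ∀ a b : CForm (p + 1) (2 * p + 1 + 1),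
      ((a + b) (stdFrame (p + 1))).re = (a (stdFrame (p + 1))).re + (b (stdFrame (p + 1))).re :=
      fun a b => rfl
    rw [h5] at h4
    have h6 : ((ContinuousAlternatingMap.compContinuousLinearMap (wedgeTwo B Φ) (complexJ (p + 1)))
      (stdFrame (p + 1))).re = ((wedgeTwo B Φ) (stdFrame (p + 1))).re := h1
    linarith
-- a form of top degree is determined by its value on a basis
  have hB' : ∀ (ξ η : Covec (p + 1)) (v : Fin (2 * (p + 1)) → CSpace (p + 1)),
      (wedgeTwo (ξ.smulRight η : RealBilin (p + 1)) Φ v).re = 0 := by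
    intro ξ η v
    let φ : CSpace (p + 1) [⋀^Fin (2 * (p + 1))]→ₗ[ℝ] ℝ := Complex.reLm.compAlternatingMap
      (wedgeTwo (ξ.smulRight η : RealBilin (p + 1)) Φ : CForm (p + 1) (2 * (p + 1))).toAlternatingMap
    have hb : ⇑(stdBasis (p + 1)) = stdFrame (p + 1) := by simp [stdBasis]
    have h1 : φ v = 0 := by
      rw [φ.eq_smul_basis_det (stdBasis (p + 1)), hb]
      have : φ (stdFrame (p + 1)) = 0 := hB ξ η
      rw [this]; simp
    exact h1
  have hfin : Φ.toAlternatingMap = 0 := by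
    refine Module.Basis.ext_alternating (stdBasis (p + 1)) fun v hv => ?_
    -- `a` and `c` are the two basis vectors that do not occur among the arguments; the product of `Φ`
    -- with the dual two-form recovers the value of `Φ` on `v`
    obtain ⟨a, c, hac, ha, hc⟩ : ∃ a c : Fin (2 * (p + 1)), a ≠ c ∧ (∀ i, v i ≠ a) ∧ (∀ i, v i ≠ c) := by
      have hcard : (Finset.univ.image v)ᶜ.card = 2 := by
        rw [Finset.card_compl, Finset.card_image_of_injective _ hv]
        simp
        omega
      obtain ⟨a, c, hac, h⟩ := Finset.card_eq_two.1 hcard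
      refine ⟨a, c, hac, fun i hi => ?_, fun i hi => ?_⟩
      · have : a ∈ (Finset.univ.image v)ᶜ := by rw [h]; simp
        rw [Finset.mem_compl] at this
        exact this (Finset.mem_image.2 ⟨i, Finset.mem_univ _, hi⟩)
      · have : c ∈ (Finset.univ.image v)ᶜ := by rw [h]; simp
        rw [Finset.mem_compl] at this
        exact this (Finset.mem_image.2 ⟨i, Finset.mem_univ _, hi⟩)
    set b := stdBasis (p + 1) with hb
    let ξ : Covec (p + 1) := LinearMap.toContinuousLinearMap (b.coord a)
    let η : Covec (p + 1) := LinearMap.toContinuousLinearMap (b.coord c)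
    have hξ : ∀ i, ξ (b i) = if i = a then 1 else 0 := by
      intro i; simp [ξ, Finsupp.single_apply]
    have hη : ∀ i, η (b i) = if i = c then 1 else 0 := by
      intro i; simp [η, Finsupp.single_apply]
    have h1 := hB' ξ η (Fin.cons (b a) (Fin.cons (b c) fun i => b (v i)) :
      Fin (2 * p + 1 + 1) → CSpace (p + 1))
    rw [wedgeTwo_apply_of_vanish] at h1
    · have e1 : ξ (b a) = 1 := by rw [hξ, if_pos rfl]
      have e2 : η (b c) = 1 := by rw [hη, if_pos rfl]
      have e3 : η (b a) = 0 := by rw [hη, if_neg hac]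
      simp only [ContinuousLinearMap.smulRight_apply, smul_apply, smul_eq_mul, e1, e2, e3,
        mul_zero, sub_zero, one_smul, Complex.real_smul, Complex.re_ofReal_mul] at h1
      have h1 : (Φ fun i => b (v i)).re = 0 := by linarith
      apply Complex.ext
      · exact h1
      · exact hre _
    · intro i
      ext w
      simp [hξ, ha]
    · intro w i
      simp [hη, hc]
  exact ContinuousAlternatingMap.toAlternatingMap_injective hfin

end CofactorMatrix

/-! ### Powers of the fundamental form -/

section Powers

open scoped ComplexOrder

variable {n p : ℕ}

/-- The standard inner product of `ℂⁿ`. -/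
def stdBilin (n : ℕ) : RealBilin n := matrixBilin ((1 / 2 : ℂ) • (1 : Matrix (Fin n) (Fin n) ℂ))

theorem stdBilin_apply (u w : CSpace n) : stdBilin n u w = (∑ r, u r * star (w r)).re := by
  rw [stdBilin, matrixBilin_apply]
  simp [Matrix.one_apply, mul_assoc, ← Finset.mul_sum]

theorem stdBilin_unitary {U : Matrix (Fin n) (Fin n) ℂ} (hU : U * U.conjTranspose = 1) :
    (stdBilin n).bilinearComp (ofComplexMatrix U) (ofComplexMatrix U) = stdBilin n := by
  have hU' : U.conjTranspose * U = 1 := mul_eq_one_comm.1 hU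
  have h := congrArg Matrix.transpose hU'
  rw [Matrix.transpose_mul, Matrix.conjTranspose, Matrix.transpose_map, Matrix.transpose_transpose,
    Matrix.transpose_one] at h
  rw [stdBilin, matrixBilin_comp _ (ofComplexMatrix_commute U), complexMatrix_ofComplexMatrix]
  rw [Matrix.mul_smul, Matrix.smul_mul, Matrix.mul_one, h]

theorem fundPow_stdBilin_interleaveJ {k : ℕ} {σ : Fin k → Fin n} (hσ : Function.Injective σ) :
    fundPow (stdBilin n) k (interleaveJ (coordVec ∘ σ)) = (k.factorial : ℂ) := by
  apply fundPow_interleaveJ <;> intro a b <;>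
    simp [fundBilin_apply, stdBilin_apply, complexJ_apply, coordVec, hσ.eq_iff, apply_ite] <;>
    (split_ifs with h; exacts [h.symm, Ne.symm h])

theorem cofMatrix_fundPow_stdBilin :
    cofMatrix (fundPow (stdBilin (p + 1)) p) =
      (p.factorial : ℂ) • (1 : Matrix (Fin (p + 1)) (Fin (p + 1)) ℂ) := by
  obtain ⟨U, hU, hd⟩ := exists_unitary_cofMatrix_comp (fundPow (stdBilin (p + 1)) p)
  rw [← fundPow_comp _ (ofComplexMatrix_commute U), stdBilin_unitary hU] at hd
  ext r s
  rcases eq_or_ne r s with rfl | h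
  · rw [cofMatrix_self, fundPow_stdBilin_interleaveJ r.succAbove_right_injective]
    simp
  · rw [hd, Matrix.diagonal_apply_ne _ h]
    simp [Matrix.one_apply_ne h]

open scoped MatrixOrder Matrix.Norms.L2Operator in
theorem exists_eq_conjTranspose_mul {H : Matrix (Fin n) (Fin n) ℂ} (hH : H.PosDef) :
    ∃ B : Matrix (Fin n) (Fin n) ℂ, H = B.conjTranspose * B ∧ B.det ≠ 0 := by
  obtain ⟨B, hB⟩ := CStarAlgebra.nonneg_iff_eq_star_mul_self.1 hH.posSemidef.nonneg
  refine ⟨B, hB, fun h => hH.det_pos.ne' ?_⟩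
  rw [hB, Matrix.det_mul, h, mul_zero]

/-- Every positive definite Hermitian form is the pull-back of the standard one. -/
theorem exists_stdBilin_comp {H : Matrix (Fin n) (Fin n) ℂ} (hH : H.PosDef) :
    ∃ A : Matrix (Fin n) (Fin n) ℂ, A.det ≠ 0 ∧ (2 : ℂ) • H.transpose = A.conjTranspose * A ∧
      matrixBilin H = (stdBilin n).bilinearComp (ofComplexMatrix A) (ofComplexMatrix A) := by
  have h2 : ((2 : ℂ) • H.transpose).PosDef := hH.transpose.smul (by norm_num)
  obtain ⟨A, hA, hdet⟩ := exists_eq_conjTranspose_mul h2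
  refine ⟨A, hdet, hA, ?_⟩
  rw [stdBilin, matrixBilin_comp _ (ofComplexMatrix_commute A), complexMatrix_ofComplexMatrix]
  congr 1
  have h := congrArg Matrix.transpose hA
  rw [Matrix.transpose_smul, Matrix.transpose_transpose, Matrix.transpose_mul, Matrix.conjTranspose,
    Matrix.transpose_map, Matrix.transpose_transpose] at h
  rw [Matrix.mul_smul, Matrix.smul_mul, Matrix.mul_one, ← h, smul_smul]
  norm_num

/-- The matrix of `ω^{n-1}` is `(n - 1)!` times the transposed cofactor matrix of the metric. -/
theorem cofMatrix_fundPow {H : Matrix (Fin (p + 1)) (Fin (p + 1)) ℂ} (hH : H.PosDef) :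
    cofMatrix (fundPow (matrixBilin H) p) =
      ((p.factorial : ℂ) * ((2 : ℂ) • H.transpose).det) • ((2 : ℂ) • H.transpose)⁻¹ := by
  obtain ⟨A, hdet, hA, hG⟩ := exists_stdBilin_comp hH
  have hu : IsUnit A.det := hdet.isUnit
  have hu' : IsUnit A.conjTranspose.det := by
    rw [Matrix.det_conjTranspose]; exact hu.star
  rw [hG, fundPow_comp _ (ofComplexMatrix_commute A), hA]
  have h := cofMatrix_comp (fundPow (stdBilin (p + 1)) p) (ofComplexMatrix_commute A)
  rw [complexMatrix_ofComplexMatrix, cofMatrix_fundPow_stdBilin] at h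
  rw [Matrix.mul_inv_rev, Matrix.det_mul, Matrix.det_conjTranspose]
  have h2 := congrArg (fun X => A⁻¹ * X * (A.conjTranspose)⁻¹) h
  simp only [Matrix.mul_assoc, Matrix.mul_nonsing_inv _ hu', Matrix.mul_one] at h2
  rw [← Matrix.mul_assoc, Matrix.nonsing_inv_mul _ hu, Matrix.one_mul] at h2
  rw [h2]
  simp only [smul_smul, Matrix.smul_mul, Matrix.mul_smul, Matrix.one_mul]
  congr 1
  rw [Complex.star_def, mul_comm (starRingEnd ℂ _), Complex.mul_conj]
  ring

/-- With `P⁻¹ = CᴴC` the trace is that of the nonzero positive semidefinite matrix `C S Cᴴ`. -/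
theorem trace_inv_mul_pos {P S : Matrix (Fin n) (Fin n) ℂ} (hP : P.PosDef) (hS : S.PosSemidef)
    (h0 : S ≠ 0) : 0 < (P⁻¹ * S).trace.re := by
  obtain ⟨C, hC, hdet⟩ := exists_eq_conjTranspose_mul hP.inv
  have hu : IsUnit C.det := hdet.isUnit
  have hu' : IsUnit C.conjTranspose.det := by
    rw [Matrix.det_conjTranspose]; exact hu.star
  have h1 := hS.mul_mul_conjTranspose_same C
  have h2 : (P⁻¹ * S).trace = (C * S * C.conjTranspose).trace := by
    rw [hC, Matrix.mul_assoc, Matrix.trace_mul_comm, Matrix.mul_assoc]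
  rw [h2]
  refine (Complex.pos_iff.1 (lt_of_le_of_ne h1.trace_nonneg fun h => h0 ?_)).1
  have h3 := h1.trace_eq_zero_iff.1 h.symm
  have h4 := congrArg (fun X => C⁻¹ * X * (C.conjTranspose)⁻¹) h3
  simp only [Matrix.mul_assoc, Matrix.mul_nonsing_inv _ hu', Matrix.mul_one] at h4
  rw [← Matrix.mul_assoc, Matrix.nonsing_inv_mul _ hu, Matrix.one_mul] at h4
  simpa using h4

/-- The unitary group acts transitively on the directions of covectors. -/
theorem exists_unitary_comp_eq_smul_dx {ξ : Covec (p + 1)} (hξ : ξ ≠ 0) :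
    ∃ (U : Matrix (Fin (p + 1)) (Fin (p + 1)) ℂ) (t : ℝ), U * U.conjTranspose = 1 ∧ t ≠ 0 ∧
      ξ ∘L ofComplexMatrix U = t • dx 0 := by
-- the first vector of the frame is the normalized dual vector of `ξ`
  set w : CSpace (p + 1) := WithLp.toLp 2 (fun r => star (covecCoord ξ r)) with hw
  have hw0 : w ≠ 0 := by
    intro h
    apply hξ
    ext u
    rw [apply_eq_re_sum]
    have : ∀ r, covecCoord ξ r = 0 := by
      intro r
      have := congrArg (fun u : CSpace (p + 1) => u r) h
      simpa [hw] using this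
    simp [this]
  have hn : (‖w‖ : ℂ) ≠ 0 := by simpa using hw0
  let v : Fin (p + 1) → CSpace (p + 1) := fun _ => (‖w‖ : ℂ)⁻¹ • w
  have hv : Orthonormal ℂ (Set.domRestrict {0} v) := by
    constructor
    · intro i
      change ‖(‖w‖ : ℂ)⁻¹ • w‖ = 1
      simp [norm_smul, hw0]
    · intro i j hij
      exact absurd (Subsingleton.elim i j) hij
  obtain ⟨b, hb⟩ := hv.exists_orthonormalBasis_extension_of_card_eq (by simp)
  have hb0 := hb 0 rfl
  have hU : (Matrix.of fun r s => b s r).conjTranspose * (Matrix.of fun r s => b s r) = 1 := by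
    ext s t
    have := orthonormal_iff_ite.1 b.orthonormal s t
    rw [PiLp.inner_apply] at this
    simp only [Matrix.mul_apply, Matrix.conjTranspose_apply, Matrix.of_apply, Matrix.one_apply]
    rw [← this]
    refine Finset.sum_congr rfl fun r _ => ?_
    simp [mul_comm]
  refine ⟨Matrix.of fun r s => b s r, ‖w‖, mul_eq_one_comm.1 hU, by simpa using hw0, ?_⟩
  have hin : ∀ s, ∑ r, covecCoord ξ r * b s r = if s = 0 then (‖w‖ : ℂ) else 0 := by
    intro s
    have h1 := orthonormal_iff_ite.1 b.orthonormal 0 s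
    rw [hb0, inner_smul_left, PiLp.inner_apply] at h1
    have h2 : ∑ r, covecCoord ξ r * b s r = ∑ r, inner ℂ (w r) (b s r) := by
      refine Finset.sum_congr rfl fun r _ => ?_
      simp [hw, mul_comm]
    rw [h2]
    simp only [map_inv₀, Complex.conj_ofReal] at h1
    rw [inv_mul_eq_iff_eq_mul₀ hn] at h1
    rw [h1]
    simp [eq_comm]
  ext u
  rw [ContinuousLinearMap.comp_apply, apply_eq_re_sum]
  simp only [ofComplexMatrix_apply, Finset.mul_sum, Matrix.of_apply, smul_apply, dx_apply, smul_eq_mul]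
  rw [Finset.sum_comm]
  have : ∀ s, ∑ r, covecCoord ξ r * (b s r * u s) = (if s = 0 then (‖w‖ : ℂ) else 0) * u s := by
    intro s
    rw [← hin, Finset.sum_mul]
    exact Finset.sum_congr rfl fun r _ => by ring
  simp [this]

end Powers

/-! ### Roots of positive forms of degree `2n - 2` -/

section Root

open scoped ComplexOrder

variable {n p m : ℕ}

theorem complexMatrix_det_ne_zero {A A' : CSpace n →L[ℝ] CSpace n}
    (hA : ∀ u, A (complexJ n u) = complexJ n (A u)) (h : ∀ u, A (A' u) = u) :
    (complexMatrix A).det ≠ 0 := by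
  have h1 : A ∘L A' = ContinuousLinearMap.id ℝ _ := by ext1 u; exact h u
  have h2 := congrArg (fun X => (complexMatrix X).det) h1
  simp only [complexMatrix_comp hA, complexMatrix_id, Matrix.det_mul, Matrix.det_one] at h2
  exact left_ne_zero_of_mul (h2 ▸ one_ne_zero)

/-- The matrix `c (det P / c^n)^{1/p} (Pᵀ)⁻¹ / 2` with `c = p!`, `n = p + 1`: the Hermitian metric whose `p`-th power has the
matrix `P`. -/
def rootMatrix (P : Matrix (Fin (p + 1)) (Fin (p + 1)) ℂ) : Matrix (Fin (p + 1)) (Fin (p + 1)) ℂ :=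
  ((1 / 2 * (p.factorial * (P.det.re / p.factorial ^ (p + 1)) ^ ((1 : ℝ) / p)) : ℝ) : ℂ) •
    (P.transpose)⁻¹

/-- The Hermitian form whose `p`-th power is the positive form `Φ` of degree `2p`. -/
def rootForm (Φ : CForm (p + 1) (2 * p)) : RealBilin (p + 1) := matrixBilin (rootMatrix (cofMatrix Φ))

theorem hermMatrix_rootForm (Φ : CForm (p + 1) (2 * p)) :
    hermMatrix (rootForm Φ) = rootMatrix (cofMatrix Φ) := hermMatrix_matrixBilin _

theorem det_re_eq {P : Matrix (Fin n) (Fin n) ℂ} (hP : P.IsHermitian) : (P.det.re : ℂ) = P.det := by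
  have h : star P.det = P.det := by rw [← Matrix.det_conjTranspose, hP.eq]
  exact Complex.conj_eq_iff_re.1 h

theorem rootMatrix_posDef {P : Matrix (Fin (p + 1)) (Fin (p + 1)) ℂ} (hP : P.PosDef) :
    (rootMatrix P).PosDef := by
  refine Matrix.PosDef.smul hP.transpose.inv ?_
  have : 0 < P.det.re := (Complex.pos_iff.1 hP.det_pos).1
  rw [Complex.zero_lt_real]
  positivity

/-- The matrix `rootMatrix` inverts the cofactor expression in `cofMatrix_fundPow`, where `N = 2 H`. -/
theorem rootMatrix_cofactor {N : Matrix (Fin (p + 1)) (Fin (p + 1)) ℂ} (hp : p ≠ 0)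
    (hN : N.PosDef) :
    rootMatrix (((p.factorial : ℂ) * N.transpose.det) • (N.transpose)⁻¹) = (1 / 2 : ℂ) • N := by
  have hd : 0 < N.det.re := (Complex.pos_iff.1 hN.det_pos).1
  have hdr := det_re_eq hN.isHermitian
  set D := N.det.re with hD
  have hc : (0 : ℝ) < p.factorial := by positivity
  have hdet : (((p.factorial : ℂ) * N.transpose.det) • (N.transpose)⁻¹).det =
      ((p.factorial ^ (p + 1) * D ^ p : ℝ) : ℂ) := by
    rw [Matrix.det_smul, Matrix.det_transpose, Matrix.det_nonsing_inv, Ring.inverse_eq_inv',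
      Matrix.det_transpose, Fintype.card_fin, ← hdr]
    have : (D : ℂ) ≠ 0 := by exact_mod_cast hd.ne'
    push_cast
    rw [mul_pow, pow_succ (D : ℂ)]
    field_simp
  rw [rootMatrix, hdet, Complex.ofReal_re, mul_div_cancel_left₀ _ (by positivity), one_div (p : ℝ),
    Real.pow_rpow_inv_natCast hd.le hp]
  have hu : IsUnit N.transpose.det := by
    rw [Matrix.det_transpose, ← hdr]
    exact isUnit_iff_ne_zero.2 (by exact_mod_cast hd.ne')
  rw [Matrix.transpose_smul, Matrix.transpose_nonsing_inv, Matrix.transpose_transpose,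
    Matrix.det_transpose, ← hdr]
  have hne : (p.factorial : ℂ) * (D : ℂ) ≠ 0 := by
    have : (D : ℂ) ≠ 0 := by exact_mod_cast hd.ne'
    have h2 : (p.factorial : ℂ) ≠ 0 := by exact_mod_cast hc.ne'
    exact mul_ne_zero h2 this
  have huN : IsUnit N.det := by rwa [Matrix.det_transpose] at hu
  have hinv : (((p.factorial : ℂ) * (D : ℂ)) • N⁻¹)⁻¹ = ((p.factorial : ℂ) * (D : ℂ))⁻¹ • N := by
    apply Matrix.inv_eq_right_inv
    rw [Matrix.smul_mul, Matrix.mul_smul, Matrix.nonsing_inv_mul _ huN, smul_smul,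
      mul_inv_cancel₀ hne, one_smul]
  rw [hinv, smul_smul]
  congr 1
  push_cast
  field_simp

/-- The cofactor expression in `cofMatrix_fundPow` inverts `rootMatrix`. -/
theorem cofactor_rootMatrix {P : Matrix (Fin (p + 1)) (Fin (p + 1)) ℂ} (hp : p ≠ 0)
    (hP : P.PosDef) :
    ((p.factorial : ℂ) * ((2 : ℂ) • (rootMatrix P).transpose).det) •
      ((2 : ℂ) • (rootMatrix P).transpose)⁻¹ = P := by
  have hd : 0 < P.det.re := (Complex.pos_iff.1 hP.det_pos).1
  have hdr := det_re_eq hP.isHermitian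
  set D := P.det.re with hD
  have hc : (0 : ℝ) < p.factorial := by positivity
  set t : ℝ := p.factorial * (D / p.factorial ^ (p + 1)) ^ ((1 : ℝ) / p) with ht
  have ht0 : 0 < t := by positivity
-- `P = p! det(K) K⁻¹` for `K = t P⁻¹` if and only if `t ^ p p! = det P`
  have htp : t ^ p * p.factorial = D := by
    rw [ht, mul_pow, one_div, Real.rpow_inv_natCast_pow (by positivity) hp]
    field_simp
    rw [pow_succ]
  have hu : IsUnit P.det := by
    rw [← hdr]
    exact isUnit_iff_ne_zero.2 (by exact_mod_cast hd.ne')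
  have h1 : (2 : ℂ) • (rootMatrix P).transpose = (t : ℂ) • P⁻¹ := by
    rw [rootMatrix, Matrix.transpose_smul, Matrix.transpose_nonsing_inv, Matrix.transpose_transpose,
      smul_smul]
    congr 1
    push_cast [ht]
    ring
  have htc : (t : ℂ) ≠ 0 := by exact_mod_cast ht0.ne'
  have hDc : (D : ℂ) ≠ 0 := by exact_mod_cast hd.ne'
  have hinv : ((t : ℂ) • P⁻¹)⁻¹ = (t : ℂ)⁻¹ • P := by
    apply Matrix.inv_eq_right_inv
    rw [Matrix.smul_mul, Matrix.mul_smul, Matrix.nonsing_inv_mul _ hu, smul_smul,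
      mul_inv_cancel₀ htc, one_smul]
  rw [h1, hinv, Matrix.det_smul, Matrix.det_nonsing_inv, Ring.inverse_eq_inv', Fintype.card_fin,
    ← hdr, smul_smul]
  have htp' : (t : ℂ) ^ p * p.factorial = D := by exact_mod_cast htp
  have : (p.factorial : ℂ) * ((t : ℂ) ^ (p + 1) * (D : ℂ)⁻¹) * (t : ℂ)⁻¹ = 1 := by
    rw [pow_succ]
    field_simp
    rw [mul_comm]; exact htp'
  rw [this, one_smul]

theorem wedgeTwo_im {k : ℕ} (B : RealBilin n) {α : CForm n k} (hα : ∀ u, (α u).im = 0)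
    (u : Fin (k + 1 + 1) → CSpace n) : (wedgeTwo B α u).im = 0 := by
  rw [wedgeTwo_apply, Complex.real_smul, Complex.im_ofReal_mul, Complex.im_sum,
    Finset.sum_eq_zero, mul_zero]
  intro i _
  rw [Complex.im_sum]
  refine Finset.sum_eq_zero fun j _ => ?_
  rcases neg_one_pow_eq_or ℤ (i : ℕ) with h | h <;> rcases neg_one_pow_eq_or ℤ (j : ℕ) with h' | h' <;>
    simp [h, h', hα]

theorem fundPow_im (G : RealBilin n) (k : ℕ) (u : Fin (2 * k) → CSpace n) : (fundPow G k u).im = 0 := by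
  induction k with
  | zero => simp [fundPow]
  | succ k ih => exact wedgeTwo_im _ ih _

theorem fundPow_compJ {G : RealBilin n} (hJ : ∀ u w, G (complexJ n u) (complexJ n w) = G u w) (k : ℕ) :
    (fundPow G k).compContinuousLinearMap (complexJ n) = fundPow G k := by
  rw [← fundPow_comp G (fun _ => rfl)]
  congr 1
  ext u w
  exact hJ u w

theorem cofForm_sub (Φ Ψ : CForm (p + 1) (2 * p)) (ξ η : Covec (p + 1)) :
    cofForm (Φ - Ψ) ξ η = cofForm Φ ξ η - cofForm Ψ ξ η := by
  simp only [cofForm_eq, map_sub]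
  rfl

theorem cofMatrix_sub (Φ Ψ : CForm (p + 1) (2 * p)) :
    cofMatrix (Φ - Ψ) = cofMatrix Φ - cofMatrix Ψ := by
  ext r s
  simp only [cofMatrix, Matrix.of_apply, cofForm_sub, Matrix.sub_apply]
  push_cast
  ring

/-- Existence of the root: `ω^p` and `Φ` have the same matrix. -/
theorem fundPow_rootForm (hp : p ≠ 0) {Φ : CForm (p + 1) (2 * p)} (hre : ∀ u, (Φ u).im = 0)
    (hJ : Φ.compContinuousLinearMap (complexJ (p + 1)) = Φ) (hpos : (cofMatrix Φ).PosDef) :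
    fundPow (rootForm Φ) p = Φ := by
  have h : fundPow (rootForm Φ) p - Φ = 0 := by
    refine eq_zero_of_cofMatrix_eq_zero (fun u => ?_) ?_ ?_
    · have := fundPow_im (rootForm Φ) p u
      rw [ContinuousAlternatingMap.sub_apply, Complex.sub_im, this, hre, sub_zero]
    · have h1 : ∀ a b : CForm (p + 1) (2 * p), (a - b).compContinuousLinearMap (complexJ (p + 1)) =
        a.compContinuousLinearMap (complexJ (p + 1)) - b.compContinuousLinearMap (complexJ (p + 1)) :=
        fun a b => rfl
      rw [h1, hJ, rootForm, fundPow_compJ (matrixBilin_invariant _)]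
    · rw [cofMatrix_sub, rootForm, cofMatrix_fundPow (rootMatrix_posDef hpos),
        cofactor_rootMatrix hp hpos, sub_self]
  exact sub_eq_zero.1 h

/-- Uniqueness of the root. -/
theorem rootForm_fundPow (hp : p ≠ 0) {G : RealBilin (p + 1)} (hs : ∀ u w, G u w = G w u)
    (hJ : ∀ u w, G (complexJ (p + 1) u) (complexJ (p + 1) w) = G u w)
    (hpos : ∀ u, u ≠ 0 → 0 < G u u) : rootForm (fundPow G p) = G := by
  have hH := hermMatrix_posDef hs hJ hpos
  have h1 := matrixBilin_hermMatrix hJ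
  have h2 := cofMatrix_fundPow hH
  rw [h1] at h2
  have h3 : ((2 : ℂ) • hermMatrix G).PosDef := hH.smul (by norm_num)
  have h4 := rootMatrix_cofactor hp h3
  rw [Matrix.transpose_smul] at h4
  rw [rootForm, h2, h4, smul_smul]
  norm_num
  exact h1

/-- The root is natural under complex linear isomorphisms. -/
theorem rootForm_comp (hp : p ≠ 0) {Φ : CForm (p + 1) (2 * p)} (hpos : 0 < (cofMatrix Φ).det.re)
    {A : CSpace (p + 1) →L[ℝ] CSpace (p + 1)}
    (hA : ∀ u, A (complexJ (p + 1) u) = complexJ (p + 1) (A u)) (hdet : (complexMatrix A).det ≠ 0) :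
    rootForm (Φ.compContinuousLinearMap A) = (rootForm Φ).bilinearComp A A := by
  have h := cofMatrix_comp Φ hA
  rw [rootForm, rootForm, matrixBilin_comp _ hA]
  congr 1
  set a := complexMatrix A with ha
  set P' := cofMatrix (Φ.compContinuousLinearMap A) with hP'
  set P := cofMatrix Φ with hP
  set N := Complex.normSq a.det with hN
  have hN0 : 0 < N := Complex.normSq_pos.2 hdet
  have hNc : (N : ℂ) ≠ 0 := by exact_mod_cast hN0.ne'
  have hu : IsUnit a.det := hdet.isUnit
-- `a P' aᴴ = N P` with `N = |det a|²` gives `det P' = N ^ p det P`, so that the `p`-th root scales by `N`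
  have hdet' : P'.det.re = N ^ p * P.det.re := by
    have h1 := congrArg Matrix.det h
    rw [Matrix.det_mul, Matrix.det_mul, Matrix.det_conjTranspose, Matrix.det_smul, Fintype.card_fin,
      mul_right_comm, Complex.star_def, Complex.mul_conj, ← hN, pow_succ, mul_comm (_ ^ p), mul_assoc] at h1
    have h2 := mul_left_cancel₀ hNc h1
    rw [h2, ← Complex.ofReal_pow, Complex.re_ofReal_mul]
  have hinv : (P'.transpose)⁻¹ = (N : ℂ)⁻¹ • (a.transpose * (P.transpose)⁻¹ * a.map star) := by
    have h1 := congrArg (fun X => (Matrix.transpose X)⁻¹) h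
    have h2 : a.conjTranspose.transpose = a.map star := by
      rw [Matrix.conjTranspose, Matrix.transpose_map, Matrix.transpose_transpose]
    have hu2 : IsUnit (a.map star).det := by
      rw [← h2, Matrix.det_transpose, Matrix.det_conjTranspose]; exact hu.star
    have hu3 : IsUnit a.transpose.det := by rwa [Matrix.det_transpose]
    simp only [Matrix.transpose_mul, Matrix.mul_inv_rev, Matrix.transpose_smul, h2] at h1
    have h3 : ((N : ℂ) • P.transpose)⁻¹ = (N : ℂ)⁻¹ • (P.transpose)⁻¹ := by
      have hPu : IsUnit P.transpose.det := by
        rw [Matrix.det_transpose]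
        refine isUnit_iff_ne_zero.2 fun h0 => ?_
        rw [h0] at hpos
        simp at hpos
      apply Matrix.inv_eq_right_inv
      rw [Matrix.smul_mul, Matrix.mul_smul, Matrix.mul_nonsing_inv _ hPu, smul_smul,
        mul_inv_cancel₀ hNc, one_smul]
    rw [h3] at h1
    have h4 := congrArg (fun X => a.transpose * X * a.map star) h1
    simp only [Matrix.mul_assoc, Matrix.nonsing_inv_mul _ hu2, Matrix.mul_one] at h4
    rw [← Matrix.mul_assoc, Matrix.mul_nonsing_inv _ hu3, Matrix.one_mul] at h4
    rw [h4]
    simp only [Matrix.mul_smul, Matrix.smul_mul, Matrix.mul_assoc]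
  rw [rootMatrix, rootMatrix, hdet', hinv, Matrix.mul_smul, Matrix.smul_mul, smul_smul]
  congr 1
  rw [mul_div_assoc, Real.mul_rpow (by positivity) (by positivity), one_div (p : ℝ),
    Real.pow_rpow_inv_natCast hN0.le hp]
  push_cast
  field_simp

end Root

/-! ### Positivity of the symbol of the complex Hessian -/

section LeviPositivity

open scoped ComplexOrder

variable {n p m : ℕ}

/-- The form `i (ξ' ∧ η'' + η' ∧ ξ'') ∧ ω^m` on `ℂ^{m+2}`, where `ξ'` and `ξ''` are the complex linear and the
antilinear part of `ξ`. -/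
def leviForm (G : RealBilin (m + 1 + 1)) (ξ η : Covec (m + 1 + 1)) :
    CForm (m + 1 + 1) (2 * (m + 1)) :=
  wedgeTwo (leviBilin (m + 1 + 1) ξ η) (fundPow G m)

theorem leviForm_comp (G : RealBilin (m + 1 + 1)) (ξ η : Covec (m + 1 + 1))
    {A : CSpace (m + 1 + 1) →L[ℝ] CSpace (m + 1 + 1)}
    (hA : ∀ u, A (complexJ (m + 1 + 1) u) = complexJ (m + 1 + 1) (A u)) :
    leviForm (G.bilinearComp A A) (ξ ∘L A) (η ∘L A) = (leviForm G ξ η).compContinuousLinearMap A := by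
  rw [leviForm, leviBilin_comp hA, fundPow_comp _ hA, wedgeTwo_comp]
  rfl

/-- For the standard metric and `ξ = dx⁰` the matrix of the symbol is `m! diag(0, 1, …, 1)`. -/
theorem cofMatrix_leviForm_dx : cofMatrix (leviForm (stdBilin (m + 1 + 1)) (dx 0) (dx 0)) =
    Matrix.diagonal fun r => if r = 0 then (0 : ℂ) else (m.factorial : ℂ) := by
  have hd0 : ∀ s : Fin (m + 1 + 1), s ≠ 0 → dx 0 (coordVec s) = 0 ∧
      dx 0 (complexJ (m + 1 + 1) (coordVec s)) = 0 := by
    intro s hs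
    simp [dx_apply, coordVec, complexJ_apply, hs.symm]
  ext r s
  rcases eq_or_ne r s with rfl | hrs
  · rw [cofMatrix_self, Matrix.diagonal_apply_eq]
    refine Fin.cases ?_ (fun r' => ?_) r
    · -- every vector of the frame is annihilated by the covector
      have hv : ∀ i, dx 0 (interleaveJ (coordVec ∘ (0 : Fin (m + 1 + 1)).succAbove) i) = 0 ∧
          dx 0 (complexJ (m + 1 + 1) (interleaveJ (coordVec ∘ (0 : Fin (m + 1 + 1)).succAbove) i)) = 0 := by
        intro i
        simp only [interleaveJ, Function.comp_apply]
        split_ifs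
        · exact hd0 _ (Fin.succAbove_ne _ _)
        · exact ⟨(hd0 _ (Fin.succAbove_ne _ _)).2, by
            rw [complexJ_complexJ, map_neg, (hd0 _ (Fin.succAbove_ne _ _)).1, neg_zero]⟩
      have h : leviForm (stdBilin (m + 1 + 1)) (dx 0) (dx 0)
          (interleaveJ (coordVec ∘ (0 : Fin (m + 1 + 1)).succAbove)) = 0 := by
        rw [leviForm]
        refine (wedgeTwo_apply _ _ _).trans ?_
        rw [Finset.sum_eq_zero, smul_zero]
        intro i _
        refine Finset.sum_eq_zero fun j _ => ?_
        rw [leviBilin_apply, (hv i).1]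
        have := (hv i).2
        rw [this]
        simp
      rw [h]
      simp
-- the covector pairs only with the first two vectors of the frame
    · have hcons : (coordVec ∘ (Fin.succ r').succAbove : Fin (m + 1) → CSpace (m + 1 + 1)) =
          Fin.cons (coordVec 0) (coordVec ∘ (Fin.succ ∘ r'.succAbove)) := by
        funext i
        refine Fin.cases ?_ (fun i => ?_) i
        · simp
        · simp [Fin.succ_succAbove_succ]
      have hv : ∀ i, dx 0 (interleaveJ (coordVec ∘ (Fin.succ ∘ r'.succAbove)) i) = 0 ∧
          dx 0 (complexJ (m + 1 + 1) (interleaveJ (coordVec ∘ (Fin.succ ∘ r'.succAbove)) i)) = 0 := by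
        intro i
        simp only [interleaveJ, Function.comp_apply]
        split_ifs
        · exact hd0 _ (Fin.succ_ne_zero _)
        · exact ⟨(hd0 _ (Fin.succ_ne_zero _)).2, by
            rw [complexJ_complexJ, map_neg, (hd0 _ (Fin.succ_ne_zero _)).1, neg_zero]⟩
      have hr : dx 0 (coordVec (0 : Fin (m + 1 + 1))) = 1 := by simp [dx_apply, coordVec]
      have hr' : dx 0 (complexJ (m + 1 + 1) (coordVec 0)) = 0 := by
        simp [dx_apply, coordVec, complexJ_apply]
      have h : leviForm (stdBilin (m + 1 + 1)) (dx 0) (dx 0)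
          (interleaveJ (coordVec ∘ (Fin.succ r').succAbove)) = (m.factorial : ℂ) := by
        rw [hcons, interleaveJ_cons]
        refine (wedgeTwo_apply_of_vanish _ ?_ ?_).trans ?_
        · intro i
          ext w
          simp [leviBilin_apply, hv]
        · intro w i
          simp [leviBilin_apply, hv]
        · rw [fundPow_stdBilin_interleaveJ ((Fin.succ_injective _).comp r'.succAbove_right_injective)]
          simp [leviBilin_apply, complexJ_complexJ, hr, hr']
          norm_num
          ring
      rw [h]
      simp
  · rw [Matrix.diagonal_apply_ne _ hrs]
    -- invariance under the rotation of one coordinate by `i` multiplies the entry by `-i`, so it vanishes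
    set U : Matrix (Fin (m + 1 + 1)) (Fin (m + 1 + 1)) ℂ :=
      Matrix.diagonal fun k => if k = r then Complex.I else 1 with hU
    have hUU : U * U.conjTranspose = 1 := by
      rw [hU, Matrix.diagonal_conjTranspose, Matrix.diagonal_mul_diagonal, ← Matrix.diagonal_one]
      congr 1
      funext k
      simp only [Pi.star_apply]
      split_ifs <;> simp
    have hdx : leviForm (stdBilin (m + 1 + 1)) (dx 0 ∘L ofComplexMatrix U) (dx 0 ∘L ofComplexMatrix U) =
        leviForm (stdBilin (m + 1 + 1)) (dx 0) (dx 0) := by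
      have hUu : ∀ u : CSpace (m + 1 + 1), ofComplexMatrix U u 0 =
          (if 0 = r then Complex.I else 1) * u 0 := by
        intro u
        rw [ofComplexMatrix_apply, hU]
        simp [Matrix.diagonal_apply]
      rcases eq_or_ne 0 r with h0 | h0
      · have : dx 0 ∘L ofComplexMatrix U = dx 0 ∘L complexJ (m + 1 + 1) := by
          ext u
          rw [ContinuousLinearMap.comp_apply, dx_apply, hUu, if_pos h0]
          simp [dx_apply, complexJ_apply]
        rw [this, leviForm, leviBilin_compJ, leviForm]
      · have : dx 0 ∘L ofComplexMatrix U = dx 0 := by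
          ext u
          simp [dx_apply, hUu, h0]
        rw [this]
    have h1 := cofMatrix_comp_unitary (leviForm (stdBilin (m + 1 + 1)) (dx 0) (dx 0)) hUU
    rw [← leviForm_comp _ _ _ (ofComplexMatrix_commute U), stdBilin_unitary hUU, hdx] at h1
    have h2 := congrFun (congrFun h1 r) s
    rw [hU, Matrix.diagonal_conjTranspose, Matrix.mul_diagonal, Matrix.diagonal_mul] at h2
    simp only [Pi.star_apply, if_true, if_neg hrs.symm, mul_one, Complex.star_def,
      Complex.conj_I] at h2
    have h3 : (1 + Complex.I) * cofMatrix (leviForm (stdBilin (m + 1 + 1)) (dx 0) (dx 0)) r s = 0 := by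
      linear_combination h2
    refine (mul_eq_zero.1 h3).resolve_left fun h => ?_
    have := congrArg Complex.re h
    simp at this

/-- The principal symbol of `v ↦ i∂∂̄v ∧ ω^{n-2}`, in terms of matrices, is positive semidefinite and
nonzero. -/
theorem cofMatrix_leviForm_posSemidef {H : Matrix (Fin (m + 1 + 1)) (Fin (m + 1 + 1)) ℂ}
    (hH : H.PosDef) {ξ : Covec (m + 1 + 1)} (hξ : ξ ≠ 0) :
    (cofMatrix (leviForm (matrixBilin H) ξ ξ)).PosSemidef ∧
      cofMatrix (leviForm (matrixBilin H) ξ ξ) ≠ 0 := by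
-- a change of frame reduces the statement to the standard metric and a multiple of `dx⁰`
  obtain ⟨A, hdet, -, hG⟩ := exists_stdBilin_comp hH
  have hu : IsUnit A.det := hdet.isUnit
  have hinv : ∀ u, ofComplexMatrix A⁻¹ (ofComplexMatrix A u) = u := by
    intro u
    ext r
    simp [ofComplexMatrix, Matrix.mulVec_mulVec, Matrix.nonsing_inv_mul _ hu]
  have hξ' : ξ ∘L ofComplexMatrix A⁻¹ ≠ 0 := by
    intro h
    apply hξ
    ext u
    have := congrArg (fun η : Covec (m + 1 + 1) => η (ofComplexMatrix A u)) h
    simpa [hinv] using this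
  obtain ⟨U, t, hU, ht, hξU⟩ := exists_unitary_comp_eq_smul_dx hξ'
  set S := cofMatrix (leviForm (matrixBilin H) ξ ξ) with hS
  set T := A⁻¹ * U with hT
  have hTdet : T.det ≠ 0 := by
    rw [hT, Matrix.det_mul, Matrix.det_nonsing_inv, Ring.inverse_eq_inv']
    refine mul_ne_zero (inv_ne_zero hdet) fun h => ?_
    have := normSq_det_of_unitary hU
    simp [h] at this
  have hTe : ofComplexMatrix T = ofComplexMatrix A⁻¹ ∘L ofComplexMatrix U := by
    ext u r
    simp [ofComplexMatrix, hT, Matrix.mulVec_mulVec]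
  have h1 := leviForm_comp (matrixBilin H) ξ ξ (ofComplexMatrix_commute T)
  have hGT : (matrixBilin H).bilinearComp (ofComplexMatrix T) (ofComplexMatrix T) =
      stdBilin (m + 1 + 1) := by
    rw [← stdBilin_unitary hU, hG, hTe]
    ext u w
    have hinv' : ∀ u, ofComplexMatrix A (ofComplexMatrix A⁻¹ u) = u := by
      intro u
      ext r
      simp [ofComplexMatrix, Matrix.mulVec_mulVec, Matrix.mul_nonsing_inv _ hu]
    simp [hinv']
  have hξT : ξ ∘L ofComplexMatrix T = t • dx 0 := by
    rw [hTe, ← ContinuousLinearMap.comp_assoc, hξU]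
  have hlin : leviForm (stdBilin (m + 1 + 1)) (t • dx 0) (t • dx 0) =
      (t ^ 2 : ℝ) • leviForm (stdBilin (m + 1 + 1)) (dx 0) (dx 0) := by
    rw [leviForm, leviForm, ← wedgeTwoL_apply, ← wedgeTwoL_apply]
    simp only [map_smul, smul_apply, smul_smul, pow_two]
  rw [hGT, hξT, hlin] at h1
  have h2 := cofMatrix_comp (leviForm (matrixBilin H) ξ ξ) (ofComplexMatrix_commute T)
  rw [← h1, complexMatrix_ofComplexMatrix, ← hS] at h2
  have hsm : cofMatrix ((t ^ 2 : ℝ) • leviForm (stdBilin (m + 1 + 1)) (dx 0) (dx 0)) =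
      ((t ^ 2 : ℝ) : ℂ) • cofMatrix (leviForm (stdBilin (m + 1 + 1)) (dx 0) (dx 0)) := by
    ext r s
    simp only [cofMatrix, Matrix.of_apply, Matrix.smul_apply, cofForm_eq, map_smul, smul_apply,
      ContinuousAlternatingMap.smul_apply, Complex.real_smul, Complex.re_ofReal_mul, smul_eq_mul]
    push_cast
    ring
  rw [hsm, cofMatrix_leviForm_dx] at h2
  have hN : 0 < Complex.normSq T.det := Complex.normSq_pos.2 hTdet
  set D : Matrix (Fin (m + 1 + 1)) (Fin (m + 1 + 1)) ℂ :=
    Matrix.diagonal fun r => if r = 0 then (0 : ℂ) else (m.factorial : ℂ) with hD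
  have hDp : D.PosSemidef := by
    rw [hD, Matrix.posSemidef_diagonal_iff]
    intro r
    split_ifs
    · exact le_rfl
    · positivity
  have hNc : (Complex.normSq T.det : ℂ) ≠ 0 := by exact_mod_cast hN.ne'
  have h3 : S = ((Complex.normSq T.det)⁻¹ : ℂ) • (T * (((t ^ 2 : ℝ) : ℂ) • D) * T.conjTranspose) := by
    rw [h2, smul_smul, inv_mul_cancel₀ hNc, one_smul]
  constructor
  · rw [h3]
    refine Matrix.PosSemidef.smul ((hDp.smul ?_).mul_mul_conjTranspose_same T) ?_
    · exact_mod_cast sq_nonneg t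
    · rw [← Complex.ofReal_inv, Complex.zero_le_real]; positivity
  · intro h0
    rw [h0, smul_zero] at h2
    have huT : IsUnit T.det := hTdet.isUnit
    have hu' : IsUnit T.conjTranspose.det := by
      rw [Matrix.det_conjTranspose]; exact huT.star
    have h4 := congrArg (fun X => T⁻¹ * X * (T.conjTranspose)⁻¹) h2
    simp only [Matrix.mul_assoc, Matrix.mul_nonsing_inv _ hu', Matrix.mul_one] at h4
    rw [← Matrix.mul_assoc, Matrix.nonsing_inv_mul _ huT, Matrix.one_mul] at h4
    have h5 := congrFun (congrFun h4 1) 1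
    simp [hD, ht, Nat.factorial_ne_zero] at h5

end LeviPositivity

/-! ### The operator `i∂∂̄` and holomorphic pull-backs -/

section DelDelbar

open Filter Topology

variable {n k m : ℕ}

theorem delForm_congr {α β : CSpace n → CForm n k} {z : CSpace n} (h : α =ᶠ[𝓝 z] β) :
    delForm α z = delForm β z := by
  rw [delForm, delForm, h.fderiv_eq]

theorem delbarForm_congr {α β : CSpace n → CForm n k} {z : CSpace n} (h : α =ᶠ[𝓝 z] β) :
    delbarForm α z = delbarForm β z := by
  rw [delbarForm, delbarForm, h.fderiv_eq]

theorem iDelDelbar_congr {α β : CSpace n → CForm n k} {z : CSpace n} (h : α =ᶠ[𝓝 z] β) :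
    iDelDelbar α z = iDelDelbar β z := by
  rw [iDelDelbar, iDelDelbar, delForm_congr]
  exact h.eventuallyEq_nhds.mono fun y hy => delbarForm_congr hy

/-- The derivative of `delbarForm α` is a linear expression in the derivative of `α`. -/
def delbarL (n k : ℕ) : (CSpace n →L[ℝ] CForm n k) →L[ℝ] CForm n (k + 1) :=
  ContinuousAlternatingMap.alternatizeUncurryFinCLM ℝ (CSpace n) ℂ ∘L
    ((1 / 2 : ℂ) • (ContinuousLinearMap.id ℝ (CSpace n →L[ℝ] CForm n k) +
      Complex.I • (ContinuousLinearMap.compL ℝ (CSpace n) (CSpace n) (CForm n k)).flip (complexJ n)))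

/-- The bilinear map `(u, w) ↦ (S(iu, w) - S(u, iw)) / 4`. -/
def levi (V : Type*) [NormedAddCommGroup V] [NormedSpace ℝ V] :
    (CSpace n →L[ℝ] CSpace n →L[ℝ] V) →L[ℝ] (CSpace n →L[ℝ] CSpace n →L[ℝ] V) :=
  (1 / 4 : ℝ) • ((ContinuousLinearMap.compL ℝ (CSpace n) (CSpace n) (CSpace n →L[ℝ] V)).flip (complexJ n) -
    ContinuousLinearMap.compL ℝ (CSpace n) (CSpace n →L[ℝ] V) (CSpace n →L[ℝ] V)
      ((ContinuousLinearMap.compL ℝ (CSpace n) (CSpace n) V).flip (complexJ n)))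

theorem levi_apply {V : Type*} [NormedAddCommGroup V] [NormedSpace ℝ V]
    (S : CSpace n →L[ℝ] CSpace n →L[ℝ] V) (u w : CSpace n) :
    levi V S u w = (1 / 4 : ℝ) • (S (complexJ n u) w - S u (complexJ n w)) := rfl

/-- The operator `i∂∂̄` is the double alternatization of the real bilinear form
`(u, w) ↦ (D²α(iu, w) - D²α(u, iw)) / 4`. -/
theorem iDelDelbar_eq {α : CSpace n → CForm n k} {z : CSpace n} (hα : ContDiffAt ℝ 2 α z) :
    iDelDelbar α z = altTwo n k (levi _ (fderiv ℝ (fderiv ℝ α) z)) := by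
  set S := fderiv ℝ (fderiv ℝ α) z with hS
  have hsymm : ∀ u w, S u w = S w u := fun u w => by
    have := hα.isSymmSndFDerivAt (by simp)
    exact this u w
  have hd : DifferentiableAt ℝ (fderiv ℝ α) z :=
    (hα.fderiv_right (m := 1) (by norm_num)).differentiableAt one_ne_zero
  have hder : fderiv ℝ (delbarForm α) z = delbarL n k ∘L S := by
    have : delbarForm α = fun y => delbarL n k (fderiv ℝ α y) := rfl
    rw [this]
    exact ((delbarL n k).hasFDerivAt.comp z hd.hasFDerivAt).fderiv
  -- `T` is the second derivative with the coefficients of `∂` and `∂̄`; its symmetric part does not contribute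
  let T : CSpace n →L[ℝ] CSpace n →L[ℝ] CForm n k :=
    (Complex.I * (1 / 4)) • (S + Complex.I •
      (ContinuousLinearMap.compL ℝ (CSpace n) (CSpace n →L[ℝ] CForm n k) (CSpace n →L[ℝ] CForm n k)
      ((ContinuousLinearMap.compL ℝ (CSpace n) (CSpace n) (CForm n k)).flip (complexJ n)) S) -
      Complex.I • (S ∘L complexJ n) + (ContinuousLinearMap.compL ℝ (CSpace n) (CSpace n →L[ℝ] CForm n k) (CSpace n →L[ℝ] CForm n k)
      ((ContinuousLinearMap.compL ℝ (CSpace n) (CSpace n) (CForm n k)).flip (complexJ n)) S) ∘L complexJ n)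
  have hT : ∀ u w, T u w = (Complex.I * (1 / 4)) • (S u w + Complex.I • S u (complexJ n w) -
      Complex.I • S (complexJ n u) w + S (complexJ n u) (complexJ n w)) := fun u w => rfl
  have h1 : iDelDelbar α z = altTwo n k T := by
    ext v
    rw [iDelDelbar, delForm, hder, altTwo_apply, ContinuousAlternatingMap.smul_apply,
      ContinuousAlternatingMap.alternatizeUncurryFin_apply, Finset.smul_sum]
    refine Finset.sum_congr rfl fun i _ => ?_
    have e : ∀ u, delbarL n k (S u) = (1 / 2 : ℂ) • (ContinuousAlternatingMap.alternatizeUncurryFin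
        (S u + Complex.I • (S u ∘L complexJ n))) := by
      intro u
      rw [← ContinuousAlternatingMap.alternatizeUncurryFin_smul]; rfl
    simp only [smul_apply, sub_apply, ContinuousLinearMap.comp_apply, e,
      ContinuousAlternatingMap.smul_apply, ContinuousAlternatingMap.sub_apply,
      ContinuousAlternatingMap.alternatizeUncurryFin_apply, add_apply,
      ContinuousAlternatingMap.add_apply]
    rw [← Finset.smul_sum, smul_comm Complex.I]
    congr 1
    simp only [hT, ContinuousAlternatingMap.smul_apply, ContinuousAlternatingMap.sub_apply,
      ContinuousAlternatingMap.add_apply, smul_eq_mul, Finset.mul_sum, ← Finset.sum_sub_distrib]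
    refine Finset.sum_congr rfl fun j _ => ?_
    simp only [zsmul_eq_mul]
    linear_combination (-(1 / 4 : ℂ) * Complex.I * (((-1 : ℤ) ^ (j : ℕ) : ℤ) : ℂ) * S (complexJ n (v i)) (complexJ n (i.removeNth v j))
      (j.removeNth (i.removeNth v))) * Complex.I_sq
  rw [h1]
  apply altTwo_congr_skew
  intro u w
  rw [hT, hT, levi_apply, levi_apply, hsymm w u, hsymm (complexJ n w) (complexJ n u),
    hsymm (complexJ n w) u, hsymm w (complexJ n u)]
  ext v
  simp only [ContinuousAlternatingMap.smul_apply, ContinuousAlternatingMap.sub_apply,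
      ContinuousAlternatingMap.add_apply, smul_eq_mul, Complex.real_smul]
  push_cast
  linear_combination (1 / 2 : ℂ) * (S u (complexJ n w) v - S (complexJ n u) w v) * Complex.I_sq

/-- The pull-back of forms by the complex structure. -/
def pullJ (n k : ℕ) : CForm n k →L[ℝ] CForm n k :=
  ContinuousAlternatingMap.compContinuousLinearMapCLM (complexJ n)

/-- The operator `α ↦ d(α ∘ J) ∘ J⁻¹`. It is a combination of `∂` and `∂̄` whose definition uses only
the exterior derivative, and hence is natural under holomorphic maps. -/
def twistedDeriv (α : CSpace n → CForm n k) (z : CSpace n) : CForm n (k + 1) :=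
  (extDeriv (fun y => (α y).compContinuousLinearMap (complexJ n)) z).compContinuousLinearMap
    (-complexJ n)

theorem twistedDeriv_eq {α : CSpace n → CForm n k} {z : CSpace n} (hα : DifferentiableAt ℝ α z) :
    twistedDeriv α z =
      -ContinuousAlternatingMap.alternatizeUncurryFin (fderiv ℝ α z ∘L complexJ n) := by
  have h : fderiv ℝ (fun y => (α y).compContinuousLinearMap (complexJ n)) z =
      pullJ n k ∘L fderiv ℝ α z :=
    ((pullJ n k).hasFDerivAt.comp z hα.hasFDerivAt).fderiv
  ext v
  rw [twistedDeriv, extDeriv, h, ContinuousAlternatingMap.compContinuousLinearMap_apply,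
    ContinuousAlternatingMap.neg_apply, ContinuousAlternatingMap.alternatizeUncurryFin_apply,
    ContinuousAlternatingMap.alternatizeUncurryFin_apply, ← Finset.sum_neg_distrib]
  refine Finset.sum_congr rfl fun i _ => ?_
  have hv : (⇑(complexJ n) ∘ i.removeNth (⇑(-complexJ n) ∘ v)) = i.removeNth v := by
    funext j
    simp [Fin.removeNth, complexJ_complexJ]
  rw [← smul_neg]
  congr 1
  change (fderiv ℝ α z ((-complexJ n) (v i))) (⇑(complexJ n) ∘ i.removeNth (⇑(-complexJ n) ∘ v)) = _
  rw [hv]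
  simp

theorem delForm_eq_twisted {α : CSpace n → CForm n k} {z : CSpace n} (hα : DifferentiableAt ℝ α z) :
    delForm α z = (1 / 2 : ℂ) • (extDeriv α z + Complex.I • twistedDeriv α z) := by
  rw [twistedDeriv_eq hα, delForm, extDeriv, ContinuousAlternatingMap.alternatizeUncurryFin_smul,
    sub_eq_add_neg, ContinuousAlternatingMap.alternatizeUncurryFin_add, smul_neg,
    ← ContinuousAlternatingMap.alternatizeUncurryFin_smul]
  congr 2
  ext v
  simp only [ContinuousAlternatingMap.alternatizeUncurryFin_apply, ContinuousAlternatingMap.neg_apply,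
    ContinuousAlternatingMap.smul_apply, smul_apply, neg_apply, ContinuousLinearMap.comp_apply,
    ← Finset.sum_neg_distrib]
  exact Finset.sum_congr rfl fun i _ => by simp

theorem delbarForm_eq_twisted {α : CSpace n → CForm n k} {z : CSpace n} (hα : DifferentiableAt ℝ α z) :
    delbarForm α z = (1 / 2 : ℂ) • (extDeriv α z - Complex.I • twistedDeriv α z) := by
  rw [twistedDeriv_eq hα, delbarForm, extDeriv, ContinuousAlternatingMap.alternatizeUncurryFin_smul,
    ContinuousAlternatingMap.alternatizeUncurryFin_add, smul_neg, sub_neg_eq_add,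
    ← ContinuousAlternatingMap.alternatizeUncurryFin_smul]

/-- The pull-back of a form by a map. -/
def pullForm (F : CSpace n → CSpace n) (α : CSpace n → CForm n k) (z : CSpace n) : CForm n k :=
  (α (F z)).compContinuousLinearMap (fderiv ℝ F z)

/-- `F` is smooth, with complex linear derivatives, near `z`. -/
structure IsHolo (F : CSpace n → CSpace n) (z : CSpace n) : Prop where
  eventually_smooth : ∀ᶠ y in 𝓝 z, ContDiffAt ℝ ∞ F y
  commute : ∀ᶠ y in 𝓝 z, ∀ u, fderiv ℝ F y (complexJ n u) = complexJ n (fderiv ℝ F y u)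

theorem IsHolo.smooth {F : CSpace n → CSpace n} {z : CSpace n} (hF : IsHolo F z) : ContDiffAt ℝ ∞ F z :=
  hF.eventually_smooth.self_of_nhds

theorem IsHolo.eventually {F : CSpace n → CSpace n} {z : CSpace n} (hF : IsHolo F z) :
    ∀ᶠ y in 𝓝 z, IsHolo F y := by
  filter_upwards [hF.eventually_smooth.eventually_nhds, hF.commute.eventually_nhds] with y h1 h2
  exact ⟨h1, h2⟩

theorem IsHolo.two {F : CSpace n → CSpace n} {z : CSpace n} (hF : IsHolo F z) : ContDiffAt ℝ 2 F z :=
  hF.smooth.of_le ENat.LEInfty.out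

theorem IsHolo.eventually_two {F : CSpace n → CSpace n} {z : CSpace n} (hF : IsHolo F z) :
    ∀ᶠ y in 𝓝 z, ContDiffAt ℝ 2 F y :=
  hF.two.eventually (by simp)

theorem extDeriv_pullForm {F : CSpace n → CSpace n} {z : CSpace n} (hF : ContDiffAt ℝ 2 F z)
    {α : CSpace n → CForm n k} (hα : DifferentiableAt ℝ α (F z)) :
    extDeriv (pullForm F α) z = (extDeriv α (F z)).compContinuousLinearMap (fderiv ℝ F z) :=
  extDeriv_pullback hα hF (by simp)

theorem differentiableAt_pullForm {F : CSpace n → CSpace n} {z : CSpace n} (hF : ContDiffAt ℝ 2 F z)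
    {α : CSpace n → CForm n k} (hα : DifferentiableAt ℝ α (F z)) :
    DifferentiableAt ℝ (pullForm F α) z := by
  have h1 : DifferentiableAt ℝ (fderiv ℝ F) z :=
    (hF.fderiv_right (m := 1) (by norm_num)).differentiableAt one_ne_zero
  exact (hα.comp z (hF.differentiableAt (by norm_num))).continuousAlternatingMapCompContinuousLinearMap h1

theorem twistedDeriv_pullForm {F : CSpace n → CSpace n} {z : CSpace n} (hF : ContDiffAt ℝ 2 F z)
    (hJ : ∀ᶠ y in 𝓝 z, ∀ u, fderiv ℝ F y (complexJ n u) = complexJ n (fderiv ℝ F y u))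
    {α : CSpace n → CForm n k} (hα : DifferentiableAt ℝ α (F z)) :
    twistedDeriv (pullForm F α) z = (twistedDeriv α (F z)).compContinuousLinearMap (fderiv ℝ F z) := by
  have h1 : (fun y => (pullForm F α y).compContinuousLinearMap (complexJ n)) =ᶠ[𝓝 z]
      pullForm F (fun y => (α y).compContinuousLinearMap (complexJ n)) := by
    filter_upwards [hJ] with y hy
    ext v
    simp only [pullForm, ContinuousAlternatingMap.compContinuousLinearMap_apply]
    congr 1
    funext i
    exact hy _
  have h2 : DifferentiableAt ℝ (fun y => (α y).compContinuousLinearMap (complexJ n)) (F z) :=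
    (pullJ n k).differentiableAt.comp _ hα
  rw [twistedDeriv, h1.extDeriv_eq, extDeriv_pullForm hF h2, twistedDeriv]
  ext v
  simp only [ContinuousAlternatingMap.compContinuousLinearMap_apply]
  congr 1
  funext i
  have := hJ.self_of_nhds (v i)
  simp [this]

theorem delForm_pullForm {F : CSpace n → CSpace n} {z : CSpace n} (hF : ContDiffAt ℝ 2 F z)
    (hJ : ∀ᶠ y in 𝓝 z, ∀ u, fderiv ℝ F y (complexJ n u) = complexJ n (fderiv ℝ F y u))
    {α : CSpace n → CForm n k} (hα : DifferentiableAt ℝ α (F z)) :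
    delForm (pullForm F α) z = (delForm α (F z)).compContinuousLinearMap (fderiv ℝ F z) := by
  rw [delForm_eq_twisted (differentiableAt_pullForm hF hα), delForm_eq_twisted hα,
    extDeriv_pullForm hF hα, twistedDeriv_pullForm hF hJ hα]
  rfl

theorem delbarForm_pullForm {F : CSpace n → CSpace n} {z : CSpace n} (hF : ContDiffAt ℝ 2 F z)
    (hJ : ∀ᶠ y in 𝓝 z, ∀ u, fderiv ℝ F y (complexJ n u) = complexJ n (fderiv ℝ F y u))
    {α : CSpace n → CForm n k} (hα : DifferentiableAt ℝ α (F z)) :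
    delbarForm (pullForm F α) z = (delbarForm α (F z)).compContinuousLinearMap (fderiv ℝ F z) := by
  rw [delbarForm_eq_twisted (differentiableAt_pullForm hF hα), delbarForm_eq_twisted hα,
    extDeriv_pullForm hF hα, twistedDeriv_pullForm hF hJ hα]
  rfl

theorem iDelDelbar_pullForm {F : CSpace n → CSpace n} {z : CSpace n} (hF : IsHolo F z)
    {α : CSpace n → CForm n k} (hα : ContDiffAt ℝ 2 α (F z)) :
    iDelDelbar (pullForm F α) z = (iDelDelbar α (F z)).compContinuousLinearMap (fderiv ℝ F z) := by
  have h1 : delbarForm (pullForm F α) =ᶠ[𝓝 z] pullForm F (delbarForm α) := by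
    have hc : ∀ᶠ y in 𝓝 z, DifferentiableAt ℝ α (F y) := by
      have : ∀ᶠ y in 𝓝 (F z), ContDiffAt ℝ 2 α y := hα.eventually (by simp)
      exact (hF.two.continuousAt.eventually this).mono fun y hy => hy.differentiableAt (by norm_num)
    filter_upwards [hF.eventually_two, hF.commute.eventually_nhds, hc] with y h2 hJ hd
    exact delbarForm_pullForm h2 hJ hd
  have h2 : DifferentiableAt ℝ (delbarForm α) (F z) :=
    (delbarL n k).differentiableAt.comp _
      ((hα.fderiv_right (m := 1) (by norm_num)).differentiableAt one_ne_zero)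
  rw [iDelDelbar, delForm_congr h1, delForm_pullForm hF.two hF.commute h2, iDelDelbar]
  rfl

end DelDelbar

/-! ### The perturbed form in coordinates -/

section Perturbation

open Filter Topology

variable {n k m : ℕ}

/-- A continuous linear map commutes with second derivatives. -/
theorem fderiv_fderiv_clm_comp {E V W : Type*} [NormedAddCommGroup E] [NormedSpace ℝ E]
    [NormedAddCommGroup V] [NormedSpace ℝ V] [NormedAddCommGroup W] [NormedSpace ℝ W]
    (Λ : V →L[ℝ] W) {α : E → V} {z : E} (hα : ContDiffAt ℝ 2 α z) (a b : E) :
    fderiv ℝ (fderiv ℝ (fun y => Λ (α y))) z a b = Λ (fderiv ℝ (fderiv ℝ α) z a b) := by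
  have h1 : fderiv ℝ (fun y => Λ (α y)) =ᶠ[𝓝 z] fun y => Λ ∘L fderiv ℝ α y := by
    have : ∀ᶠ y in 𝓝 z, ContDiffAt ℝ 2 α y := hα.eventually (by simp)
    filter_upwards [this] with y hy
    exact (Λ.hasFDerivAt.comp y (hy.differentiableAt (by norm_num)).hasFDerivAt).fderiv
  have hd : DifferentiableAt ℝ (fderiv ℝ α) z :=
    (hα.fderiv_right (m := 1) (by norm_num)).differentiableAt one_ne_zero
  have h2 : HasFDerivAt (fun y => Λ ∘L fderiv ℝ α y)
      ((ContinuousLinearMap.compL ℝ E V W Λ) ∘L fderiv ℝ (fderiv ℝ α) z) z :=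
    (ContinuousLinearMap.compL ℝ E V W Λ).hasFDerivAt.comp z hd.hasFDerivAt
  rw [h1.fderiv_eq, h2.fderiv]
  rfl

theorem altTwo_im {T : CSpace n →L[ℝ] CSpace n →L[ℝ] CForm n k}
    (hT : ∀ a b v, (T a b v).im = 0) (u : Fin (k + 1 + 1) → CSpace n) : (altTwo n k T u).im = 0 := by
  rw [altTwo_apply, Complex.im_sum, Finset.sum_eq_zero]
  intro i _
  rw [Complex.im_sum]
  refine Finset.sum_eq_zero fun j _ => ?_
  rcases neg_one_pow_eq_or ℤ (i : ℕ) with h | h <;> rcases neg_one_pow_eq_or ℤ (j : ℕ) with h' | h' <;>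
    simp [h, h', hT]

theorem iDelDelbar_im {α : CSpace n → CForm n k} {z : CSpace n} (hα : ContDiffAt ℝ 2 α z)
    (hre : ∀ᶠ y in 𝓝 z, ∀ v, (α y v).im = 0) (v : Fin (k + 1 + 1) → CSpace n) :
    (iDelDelbar α z v).im = 0 := by
  rw [iDelDelbar_eq hα]
  refine altTwo_im (fun a b v => ?_) v
  have h : ∀ a b, (fderiv ℝ (fderiv ℝ α) z a b v).im = 0 := by
    intro a b
    let Λ : CForm n k →L[ℝ] ℝ := Complex.imCLM ∘L ContinuousAlternatingMap.apply ℝ (CSpace n) ℂ v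
    have h1 := fderiv_fderiv_clm_comp Λ hα a b
    have h2 : (fun y => Λ (α y)) =ᶠ[𝓝 z] fun _ => 0 := hre.mono fun y hy => hy v
    rw [h2.fderiv.fderiv_eq] at h1
    simp at h1
    exact h1.symm
  rw [levi_apply, ContinuousAlternatingMap.smul_apply, ContinuousAlternatingMap.sub_apply]
  simp [h]

theorem iDelDelbar_compJ {α : CSpace n → CForm n k} {z : CSpace n} (hα : ContDiffAt ℝ 2 α z)
    (hJ : ∀ᶠ y in 𝓝 z, (α y).compContinuousLinearMap (complexJ n) = α y) :
    (iDelDelbar α z).compContinuousLinearMap (complexJ n) = iDelDelbar α z := by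
  rw [iDelDelbar_eq hα]
  refine (altTwo_comp _ _ _ fun u w => ?_).symm
  have h : ∀ a b, (fderiv ℝ (fderiv ℝ α) z a b).compContinuousLinearMap (complexJ n) =
      fderiv ℝ (fderiv ℝ α) z a b := by
    intro a b
    have h1 := fderiv_fderiv_clm_comp (pullJ n k) hα a b
    have h2 : (fun y => pullJ n k (α y)) =ᶠ[𝓝 z] α := hJ
    rw [h2.fderiv.fderiv_eq] at h1
    exact h1.symm
  rw [levi_apply, levi_apply, complexJ_complexJ, complexJ_complexJ]
  have h3 : ∀ (c : ℝ) (a b : CForm n k), (c • (a - b)).compContinuousLinearMap (complexJ n) =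
    c • (a.compContinuousLinearMap (complexJ n) - b.compContinuousLinearMap (complexJ n)) :=
    fun _ _ _ => rfl
  rw [h3]
  simp only [map_neg, neg_apply]
  have h4 : ∀ a : CForm n k, (-a).compContinuousLinearMap (complexJ n) =
    -(a.compContinuousLinearMap (complexJ n)) := fun _ => rfl
  rw [h4, h4, h, h]
  congr 1
  abel

theorem contDiffAt_fundPow {X : Type*} [NormedAddCommGroup X] [NormedSpace ℝ X] {N : ℕ∞ω}
    {G : X → RealBilin n} {x : X} (hG : ContDiffAt ℝ N G x) (k : ℕ) :
    ContDiffAt ℝ N (fun y => fundPow (G y) k) x := by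
  induction k with
  | zero => exact contDiffAt_const
  | succ k ih =>
    have h1 : ContDiffAt ℝ N (fun y => fundBilin (G y)) x :=
      (((ContinuousLinearMap.compL ℝ (CSpace n) (CSpace n) (CSpace n →L[ℝ] ℝ)).flip
        (complexJ n)).contDiff.contDiffAt).comp x hG
    have h2 : ContDiffAt ℝ N (fun y => wedgeTwoL n (2 * k) (fundPow (G y) k)) x :=
      (wedgeTwoL n (2 * k)).contDiff.contDiffAt.comp x ih
    exact h2.clm_apply h1

/-- Derivatives in the second variable are jointly smooth. -/
theorem contDiffAt_fderiv_param {X E V : Type*} [NormedAddCommGroup X] [NormedSpace ℝ X]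
    [NormedAddCommGroup E] [NormedSpace ℝ E] [NormedAddCommGroup V] [NormedSpace ℝ V]
    {f : X → E → V} {q : X × E} (hf : ContDiffAt ℝ ∞ (fun q : X × E => f q.1 q.2) q) :
    ContDiffAt ℝ ∞ (fun q : X × E => fderiv ℝ (f q.1) q.2) q := by
  have h : ContDiffAt ℝ ∞ (Function.uncurry fun (q : X × E) (y : E) => f q.1 y) (q, q.2) := by
    have h1 : ContDiffAt ℝ ∞ (fun r : (X × E) × E => (r.1.1, r.2)) (q, q.2) := by fun_prop
    exact ContDiffAt.comp (q, q.2) (g := fun q : X × E => f q.1 q.2) hf h1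
  exact ContDiffAt.fderiv (f := fun (q : X × E) (y : E) => f q.1 y) (g := fun q => q.2) h
    contDiffAt_snd le_rfl

theorem contDiffAt_iDelDelbar_param {X : Type*} [NormedAddCommGroup X] [NormedSpace ℝ X]
    {α : X → CSpace n → CForm n k} {q : X × CSpace n}
    (hα : ContDiffAt ℝ ∞ (fun q : X × CSpace n => α q.1 q.2) q) :
    ContDiffAt ℝ ∞ (fun q : X × CSpace n => iDelDelbar (α q.1) q.2) q := by
  have h1 : ContDiffAt ℝ ∞ (fun q : X × CSpace n => delbarForm (α q.1) q.2) q :=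
    (delbarL n k).contDiff.contDiffAt.comp q (contDiffAt_fderiv_param hα)
  have h2 := contDiffAt_fderiv_param (f := fun p => delbarForm (α p)) h1
  let L : (CSpace n →L[ℝ] CForm n (k + 1)) →L[ℝ] CForm n (k + 1 + 1) :=
    Complex.I • (ContinuousAlternatingMap.alternatizeUncurryFinCLM ℝ (CSpace n) ℂ ∘L
    ((1 / 2 : ℂ) • (ContinuousLinearMap.id ℝ (CSpace n →L[ℝ] CForm n (k + 1)) -
      Complex.I • (ContinuousLinearMap.compL ℝ (CSpace n) (CSpace n) (CForm n (k + 1))).flip (complexJ n))))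
  exact L.contDiff.contDiffAt.comp q h2

/-- The coordinate expression of the form `ω^{n-1} + i∂∂̄(u ω^{n-2})`, `n = m + 2`, for the metric `G`. -/
def localPerturbed (G : CSpace (m + 1 + 1) → RealBilin (m + 1 + 1)) (u : CSpace (m + 1 + 1) → ℝ)
    (z : CSpace (m + 1 + 1)) : CForm (m + 1 + 1) (2 * (m + 1)) :=
  fundPow (G z) (m + 1) + iDelDelbar (fun y => u y • fundPow (G y) m) z

/-- The pull-back of a metric by a map. -/
def pullMetric (F : CSpace n → CSpace n) (G : CSpace n → RealBilin n) (z : CSpace n) : RealBilin n :=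
  (G (F z)).bilinearComp (fderiv ℝ F z) (fderiv ℝ F z)

theorem localPerturbed_congr {G G' : CSpace (m + 1 + 1) → RealBilin (m + 1 + 1)}
    {u u' : CSpace (m + 1 + 1) → ℝ} {z : CSpace (m + 1 + 1)} (hG : G =ᶠ[𝓝 z] G') (hu : u =ᶠ[𝓝 z] u') :
    localPerturbed G u z = localPerturbed G' u' z := by
  rw [localPerturbed, localPerturbed, hG.self_of_nhds, iDelDelbar_congr]
  filter_upwards [hG, hu] with y h1 h2
  rw [h1, h2]

theorem contDiffAt_smul_fundPow {G : CSpace n → RealBilin n} {u : CSpace n → ℝ} {z : CSpace n} {N : ℕ∞ω}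
    (hG : ContDiffAt ℝ N G z) (hu : ContDiffAt ℝ N u z) (k : ℕ) :
    ContDiffAt ℝ N (fun y => u y • fundPow (G y) k) z :=
  hu.smul (contDiffAt_fundPow hG k)

theorem localPerturbed_pull {F : CSpace (m + 1 + 1) → CSpace (m + 1 + 1)} {z : CSpace (m + 1 + 1)}
    (hF : IsHolo F z) {G : CSpace (m + 1 + 1) → RealBilin (m + 1 + 1)} {u : CSpace (m + 1 + 1) → ℝ}
    (hG : ContDiffAt ℝ 2 G (F z)) (hu : ContDiffAt ℝ 2 u (F z)) :
    localPerturbed (pullMetric F G) (fun y => u (F y)) z =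
      (localPerturbed G u (F z)).compContinuousLinearMap (fderiv ℝ F z) := by
  have h1 : (fun y => u (F y) • fundPow (pullMetric F G y) m) =ᶠ[𝓝 z]
      pullForm F (fun y => u y • fundPow (G y) m) := by
    filter_upwards [hF.commute] with y hy
    rw [pullMetric, fundPow_comp _ hy, pullForm]
    rfl
  rw [localPerturbed, iDelDelbar_congr h1, iDelDelbar_pullForm hF (contDiffAt_smul_fundPow hG hu m),
    pullMetric, fundPow_comp _ hF.commute.self_of_nhds]
  rfl

theorem localPerturbed_im {G : CSpace (m + 1 + 1) → RealBilin (m + 1 + 1)} {u : CSpace (m + 1 + 1) → ℝ}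
    {z : CSpace (m + 1 + 1)} (hG : ContDiffAt ℝ 2 G z) (hu : ContDiffAt ℝ 2 u z)
    (v : Fin (2 * (m + 1)) → CSpace (m + 1 + 1)) : (localPerturbed G u z v).im = 0 := by
  have h1 := iDelDelbar_im (contDiffAt_smul_fundPow hG hu m)
    (Eventually.of_forall fun y v => by simp [fundPow_im]) v
  have h2 := fundPow_im (G z) (m + 1) v
  rw [localPerturbed, ContinuousAlternatingMap.add_apply, Complex.add_im, h2, zero_add]
  exact h1

theorem localPerturbed_compJ {G : CSpace (m + 1 + 1) → RealBilin (m + 1 + 1)} {u : CSpace (m + 1 + 1) → ℝ}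
    {z : CSpace (m + 1 + 1)} (hG : ContDiffAt ℝ 2 G z) (hu : ContDiffAt ℝ 2 u z)
    (hJ : ∀ᶠ y in 𝓝 z, ∀ a b, G y (complexJ _ a) (complexJ _ b) = G y a b) :
    (localPerturbed G u z).compContinuousLinearMap (complexJ _) = localPerturbed G u z := by
  have h1 := iDelDelbar_compJ (contDiffAt_smul_fundPow hG hu m) (by
    filter_upwards [hJ] with y hy
    have : ∀ (c : ℝ) (a : CForm (m + 1 + 1) (2 * m)), (c • a).compContinuousLinearMap (complexJ _) =
      c • a.compContinuousLinearMap (complexJ _) := fun _ _ => rfl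
    rw [this, fundPow_compJ hy])
  have h2 := fundPow_compJ hJ.self_of_nhds (m + 1)
  have h3 : ∀ a b : CForm (m + 1 + 1) (2 * (m + 1)), (a + b).compContinuousLinearMap (complexJ _) =
    a.compContinuousLinearMap (complexJ _) + b.compContinuousLinearMap (complexJ _) := fun _ _ => rfl
  rw [localPerturbed, h3, h2]
  congr 1

theorem contDiffAt_localPerturbed_param {X : Type*} [NormedAddCommGroup X] [NormedSpace ℝ X]
    {G : CSpace (m + 1 + 1) → RealBilin (m + 1 + 1)} {u : X → CSpace (m + 1 + 1) → ℝ}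
    {q : X × CSpace (m + 1 + 1)} (hG : ContDiffAt ℝ ∞ G q.2)
    (hu : ContDiffAt ℝ ∞ (fun q : X × CSpace (m + 1 + 1) => u q.1 q.2) q) :
    ContDiffAt ℝ ∞ (fun q : X × CSpace (m + 1 + 1) => localPerturbed G (u q.1) q.2) q := by
  have h1 : ContDiffAt ℝ ∞ (fun q : X × CSpace (m + 1 + 1) => G q.2) q := hG.comp q contDiffAt_snd
  have h2 : ContDiffAt ℝ ∞ (fun q : X × CSpace (m + 1 + 1) => u q.1 q.2 • fundPow (G q.2) m) q :=
    hu.smul (contDiffAt_fundPow h1 m)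
  exact (contDiffAt_fundPow h1 (m + 1)).add
    (contDiffAt_iDelDelbar_param (α := fun p y => u p y • fundPow (G y) m) h2)

theorem contDiffAt_localPerturbed {G : CSpace (m + 1 + 1) → RealBilin (m + 1 + 1)}
    {u : CSpace (m + 1 + 1) → ℝ} {z : CSpace (m + 1 + 1)} (hG : ContDiffAt ℝ ∞ G z)
    (hu : ContDiffAt ℝ ∞ u z) : ContDiffAt ℝ ∞ (localPerturbed G u) z := by
  have h := contDiffAt_localPerturbed_param (X := ℝ) (u := fun _ => u) (q := (0, z)) hG
    (hu.comp (0, z) contDiffAt_snd)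
  exact h.comp z (contDiffAt_const.prodMk contDiffAt_id)

end Perturbation

/-! ### Naturality of the Levi-Civita connection -/

section LeviCivita

open Filter Topology

variable {n : ℕ}

/-- `G` is, near `z`, a smooth Hermitian metric. -/
structure IsHermitianAt (G : CSpace n → RealBilin n) (z : CSpace n) : Prop where
  smooth : ContDiffAt ℝ ∞ G z
  symm : ∀ᶠ y in 𝓝 z, ∀ u w, G y u w = G y w u
  pos : ∀ᶠ y in 𝓝 z, ∀ u, u ≠ 0 → 0 < G y u u
  invariant : ∀ᶠ y in 𝓝 z, ∀ u w, G y (complexJ n u) (complexJ n w) = G y u w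

/-- For `k` finite, smoothness at a point gives `C^k` regularity near the point. -/
theorem contDiffAt_infty_eventually {E V : Type*} [NormedAddCommGroup E] [NormedSpace ℝ E]
    [NormedAddCommGroup V] [NormedSpace ℝ V] {f : E → V} {z : E} (hf : ContDiffAt ℝ ∞ f z) (k : ℕ) :
    ∀ᶠ y in 𝓝 z, ContDiffAt ℝ k f y :=
  (hf.of_le ENat.LEInfty.out : ContDiffAt ℝ k f z).eventually (by simp)

theorem isInvertible_of_pos {B : RealBilin n} (hB : ∀ u, u ≠ 0 → 0 < B u u) :
    B.IsInvertible := by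
  have hinj : LinearMap.ker (B : CSpace n →ₗ[ℝ] Covec n) = ⊥ := by
    rw [LinearMap.ker_eq_bot']
    intro u hu
    by_contra h
    have h1 := hB u h
    have h2 : B u = 0 := hu
    simp [h2] at h1
  have hfin : Module.finrank ℝ (CSpace n) = Module.finrank ℝ (Covec n) := by
    rw [← (LinearMap.toContinuousLinearMap (𝕜 := ℝ) (E := CSpace n) (F' := ℝ)).finrank_eq]
    exact (Subspace.dual_finrank_eq (K := ℝ) (V := CSpace n)).symm
  refine ⟨(LinearEquiv.ofInjectiveOfFinrankEq (B : CSpace n →ₗ[ℝ] Covec n)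
    (LinearMap.ker_eq_bot.1 hinj) hfin).toContinuousLinearEquiv, ?_⟩
  ext1 u
  rfl

/-- The Koszul formula. -/
theorem metric_leviCivitaGamma {G : CSpace n → RealBilin n} {z : CSpace n}
    (hG : ∀ u, u ≠ 0 → 0 < G z u u) (u w y : CSpace n) :
    G z (leviCivitaGamma G z u w) y = koszul G z u w y := by
  obtain ⟨e, he⟩ := isInvertible_of_pos hG
  have h : leviCivitaGamma G z u w = (G z).inverse (koszul G z u w) := rfl
  rw [h, ← he, ContinuousLinearMap.inverse_equiv]
  simp

theorem leviCivitaGamma_symm {G : CSpace n → RealBilin n} {z : CSpace n}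
    (hd : DifferentiableAt ℝ G z) (hs : ∀ᶠ y in 𝓝 z, ∀ u w, G y u w = G y w u) (u w : CSpace n) :
    leviCivitaGamma G z u w = leviCivitaGamma G z w u := by
  have h1 : ∀ u w y, fderiv ℝ G z u w y = fderiv ℝ G z u y w := by
    intro u w y
    have h2 : (fun x => G x w y) =ᶠ[𝓝 z] fun x => G x y w := hs.mono fun x hx => hx w y
    have h3 := h2.fderiv_eq (𝕜 := ℝ)
    have h4 : ∀ w y, fderiv ℝ (fun x => G x w y) z u = fderiv ℝ G z u w y := fun w y =>
      congrFun (congrArg DFunLike.coe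
        ((hd.hasFDerivAt.clm_apply (hasFDerivAt_const w z)).clm_apply
          (hasFDerivAt_const y z)).fderiv) u |>.trans (by simp)
    rw [← h4, ← h4, h3]
  have h : koszul G z u w = koszul G z w u := by
    refine ContinuousLinearMap.ext fun y => ?_
    rw [koszul_apply, koszul_apply, h1 y u w]
    ring
  change (G z).inverse (koszul G z u w) = (G z).inverse (koszul G z w u)
  rw [h]

/-- The derivative of a pulled back metric, by the product rule. -/
theorem fderiv_pullMetric {F : CSpace n → CSpace n} {G : CSpace n → RealBilin n} {z : CSpace n}
    (hF : ContDiffAt ℝ 2 F z) (hG : DifferentiableAt ℝ G (F z)) (a u w : CSpace n) :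
    fderiv ℝ (pullMetric F G) z a u w =
      fderiv ℝ G (F z) (fderiv ℝ F z a) (fderiv ℝ F z u) (fderiv ℝ F z w) +
      G (F z) (fderiv ℝ (fderiv ℝ F) z a u) (fderiv ℝ F z w) +
      G (F z) (fderiv ℝ F z u) (fderiv ℝ (fderiv ℝ F) z a w) := by
  have hdF : HasFDerivAt F (fderiv ℝ F z) z := (hF.differentiableAt (by norm_num)).hasFDerivAt
  have hd2 : DifferentiableAt ℝ (fderiv ℝ F) z :=
    (hF.fderiv_right (m := 1) (by norm_num)).differentiableAt one_ne_zero
  have hGF : HasFDerivAt (fun y => G (F y)) (fderiv ℝ G (F z) ∘L fderiv ℝ F z) z :=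
    hG.hasFDerivAt.comp z hdF
  have hp : DifferentiableAt ℝ (pullMetric F G) z := by
    have : pullMetric F G = fun y =>
        (ContinuousLinearMap.compL ℝ (CSpace n) (CSpace n →L[ℝ] ℝ) (CSpace n →L[ℝ] ℝ)
          ((ContinuousLinearMap.compL ℝ (CSpace n) (CSpace n) ℝ).flip (fderiv ℝ F y)))
          (G (F y) ∘L fderiv ℝ F y) := rfl
    rw [this]
    have h1 : DifferentiableAt ℝ (fun y =>
        ContinuousLinearMap.compL ℝ (CSpace n) (CSpace n →L[ℝ] ℝ) (CSpace n →L[ℝ] ℝ)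
          ((ContinuousLinearMap.compL ℝ (CSpace n) (CSpace n) ℝ).flip (fderiv ℝ F y))) z :=
      (ContinuousLinearMap.differentiableAt _).comp z
        ((ContinuousLinearMap.differentiableAt _).comp z hd2)
    exact h1.clm_apply (hGF.differentiableAt.clm_comp hd2)
  have e1 : fderiv ℝ (fun y => pullMetric F G y u w) z a = fderiv ℝ (pullMetric F G) z a u w :=
    congrFun (congrArg DFunLike.coe
        ((hp.hasFDerivAt.clm_apply (hasFDerivAt_const u z)).clm_apply
          (hasFDerivAt_const w z)).fderiv) a |>.trans (by simp)
  have hu : ∀ u, HasFDerivAt (fun y => fderiv ℝ F y u)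
      ((ContinuousLinearMap.apply ℝ (CSpace n) u) ∘L fderiv ℝ (fderiv ℝ F) z) z := fun u =>
    (ContinuousLinearMap.apply ℝ (CSpace n) u).hasFDerivAt.comp z hd2.hasFDerivAt
  have e2 := congrFun (congrArg DFunLike.coe ((hGF.clm_apply (hu u)).clm_apply (hu w)).fderiv) a
  rw [← e1]
  change fderiv ℝ (fun y => G (F y) (fderiv ℝ F y u) (fderiv ℝ F y w)) z a = _
  rw [e2]
  simp
  ring

/-- The transformation law of the Christoffel symbols. -/
theorem leviCivitaGamma_pull {F : CSpace n → CSpace n} {G : CSpace n → RealBilin n} {z : CSpace n}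
    (hF : ContDiffAt ℝ 2 F z) (hinj : Function.Injective (fderiv ℝ F z))
    (hG : DifferentiableAt ℝ G (F z)) (hs : ∀ u w, G (F z) u w = G (F z) w u)
    (hp : ∀ u, u ≠ 0 → 0 < G (F z) u u) (u w : CSpace n) :
    fderiv ℝ F z (leviCivitaGamma (pullMetric F G) z u w) =
      leviCivitaGamma G (F z) (fderiv ℝ F z u) (fderiv ℝ F z w) +
        fderiv ℝ (fderiv ℝ F) z u w := by
  have hsurj : Function.Surjective (fderiv ℝ F z) :=
    (LinearMap.injective_iff_surjective (f := (fderiv ℝ F z : CSpace n →ₗ[ℝ] CSpace n))).1 hinj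
  have hp' : ∀ u, u ≠ 0 → 0 < pullMetric F G z u u := fun u hu =>
    hp _ fun h => hu (hinj (h.trans (map_zero _).symm))
  have hsymm : ∀ u w, fderiv ℝ (fderiv ℝ F) z u w = fderiv ℝ (fderiv ℝ F) z w u := fun u w => by
    have := hF.isSymmSndFDerivAt (by simp)
    exact this u w
  obtain ⟨e, he⟩ := isInvertible_of_pos hp
  have hGinj : Function.Injective (G (F z)) := by rw [← he]; exact e.injective
  apply hGinj
  ext1 y
  obtain ⟨y, rfl⟩ := hsurj y
  have h1 := metric_leviCivitaGamma hp' u w y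
  have h2 : pullMetric F G z (leviCivitaGamma (pullMetric F G) z u w) y =
    G (F z) (fderiv ℝ F z (leviCivitaGamma (pullMetric F G) z u w)) (fderiv ℝ F z y) := rfl
  rw [map_add, add_apply, metric_leviCivitaGamma hp, ← h2, h1, koszul_apply, koszul_apply,
    fderiv_pullMetric hF hG, fderiv_pullMetric hF hG, fderiv_pullMetric hF hG, hsymm w u,
    hsymm y u, hsymm y w, hs (fderiv ℝ F z w), hs (fderiv ℝ F z u) (fderiv ℝ (fderiv ℝ F) z w y)]
  ring

/-- The covariant derivative is compatible with pull-backs, for connections related by the transformation law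
of Christoffel symbols. -/
theorem covDeriv_pull {k : ℕ} {F : CSpace n → CSpace n} {z : CSpace n} (hF : ContDiffAt ℝ 2 F z)
    {Γ Γ' : CSpace n → CSpace n →L[ℝ] CSpace n →L[ℝ] CSpace n}
    (hΓ : ∀ u w, fderiv ℝ F z (Γ' z u w) =
      Γ (F z) (fderiv ℝ F z u) (fderiv ℝ F z w) + fderiv ℝ (fderiv ℝ F) z u w)
    {T T' : CSpace n → CovTensor n k} (hT : DifferentiableAt ℝ T (F z))
    (hTT : T' =ᶠ[𝓝 z] fun y => (T (F y)).compContinuousLinearMap fun _ => fderiv ℝ F y) :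
    covDeriv Γ' T' z = (covDeriv Γ T (F z)).compContinuousLinearMap fun _ => fderiv ℝ F z := by
  have hdF : HasFDerivAt F (fderiv ℝ F z) z := (hF.differentiableAt (by norm_num)).hasFDerivAt
  have hd2 : DifferentiableAt ℝ (fderiv ℝ F) z :=
    (hF.fderiv_right (m := 1) (by norm_num)).differentiableAt one_ne_zero
  have h1 := ((hT.hasFDerivAt.comp z hdF).continuousMultilinearMapCompContinuousLinearMap
    (g := fun _ y => fderiv ℝ F y) (fun _ => hd2.hasFDerivAt)).fderiv
  have h1' := hTT.fderiv_eq.trans h1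
  ext u
  rw [covDeriv_apply, h1', hTT.self_of_nhds, ContinuousMultilinearMap.compContinuousLinearMap_apply,
    covDeriv_apply]
  simp only [add_apply, ContinuousLinearMap.comp_apply,
    ContinuousMultilinearMap.compContinuousLinearMapL_apply,
    ContinuousMultilinearMap.compContinuousLinearMap_apply,
    ContinuousMultilinearMap.fderivCompContinuousLinearMap_apply]
  have hup : ∀ (j : Fin k) (x : CSpace n), (fun i => fderiv ℝ F z (Function.update (Fin.tail u) j x i)) =
      Function.update (fun i => fderiv ℝ F z (Fin.tail u i)) j (fderiv ℝ F z x) := by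
    intro j x
    funext i
    rcases eq_or_ne i j with rfl | h
    · simp
    · simp [h]
  have hsum : ∑ j : Fin k, T (F z) (fun i => fderiv ℝ F z (Function.update (Fin.tail u) j (Γ' z (u 0) (Fin.tail u j)) i)) =
      ∑ j : Fin k, T (F z) (Function.update (fun i => fderiv ℝ F z (Fin.tail u i)) j
        (Γ (F z) (fderiv ℝ F z (u 0)) (fderiv ℝ F z (Fin.tail u j)))) +
      ∑ j : Fin k, T (F z) (Function.update (fun i => fderiv ℝ F z (Fin.tail u i)) j
        (fderiv ℝ (fderiv ℝ F) z (u 0) (Fin.tail u j))) := by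
    rw [← Finset.sum_add_distrib]
    refine Finset.sum_congr rfl fun j _ => ?_
    rw [hup, hΓ, ContinuousMultilinearMap.map_update_add]
  have hsum2 : ∑ j : Fin k, T (F z) (fun i => Function.update (fun _ => fderiv ℝ F z) j
      (ContinuousLinearMap.pi (fun _ : Fin k => fderiv ℝ (fderiv ℝ F) z) (u 0) j) i (Fin.tail u i)) =
      ∑ j : Fin k, T (F z) (Function.update (fun i => fderiv ℝ F z (Fin.tail u i)) j
        (fderiv ℝ (fderiv ℝ F) z (u 0) (Fin.tail u j))) := by
    refine Finset.sum_congr rfl fun j _ => ?_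
    congr 1
    funext i
    rcases eq_or_ne i j with rfl | h
    · simp
    · simp [h]
  rw [hsum]
  erw [hsum2]
  have ht : Fin.tail (fun i => fderiv ℝ F z (u i)) = fun i => fderiv ℝ F z (Fin.tail u i) := rfl
  rw [ht]
  ring_nf

/-- `F` is a holomorphic map near `z` whose derivatives are injective. -/
structure IsBiholo (F : CSpace n → CSpace n) (z : CSpace n) : Prop extends IsHolo F z where
  inj : ∀ᶠ y in 𝓝 z, Function.Injective (fderiv ℝ F y)

theorem contDiffAt_pullMetric {F : CSpace n → CSpace n} {G : CSpace n → RealBilin n} {z : CSpace n}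
    (hF : ContDiffAt ℝ ∞ F z) (hG : ContDiffAt ℝ ∞ G (F z)) : ContDiffAt ℝ ∞ (pullMetric F G) z := by
  have hd : ContDiffAt ℝ ∞ (fderiv ℝ F) z := hF.fderiv_right le_rfl
  have : pullMetric F G = fun y =>
      (ContinuousLinearMap.compL ℝ (CSpace n) (CSpace n →L[ℝ] ℝ) (CSpace n →L[ℝ] ℝ)
        ((ContinuousLinearMap.compL ℝ (CSpace n) (CSpace n) ℝ).flip (fderiv ℝ F y)))
        (G (F y) ∘L fderiv ℝ F y) := rfl
  rw [this]
  have h1 : ContDiffAt ℝ ∞ (fun y =>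
      ContinuousLinearMap.compL ℝ (CSpace n) (CSpace n →L[ℝ] ℝ) (CSpace n →L[ℝ] ℝ)
        ((ContinuousLinearMap.compL ℝ (CSpace n) (CSpace n) ℝ).flip (fderiv ℝ F y))) z :=
    (ContinuousLinearMap.contDiff _).contDiffAt.comp z
      ((ContinuousLinearMap.contDiff _).contDiffAt.comp z hd)
  exact h1.clm_apply ((hG.comp z hF).clm_comp hd)

theorem IsHermitianAt.pull {F : CSpace n → CSpace n} {G : CSpace n → RealBilin n} {z : CSpace n}
    (hF : IsBiholo F z) (hG : IsHermitianAt G (F z)) : IsHermitianAt (pullMetric F G) z where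
  smooth := contDiffAt_pullMetric hF.smooth hG.smooth
  symm := by
    filter_upwards [hF.smooth.continuousAt.eventually hG.symm] with y hy u w
    exact hy _ _
  pos := by
    filter_upwards [hF.smooth.continuousAt.eventually hG.pos, hF.inj] with y hy hi u hu
    exact hy _ fun h => hu (hi (h.trans (map_zero _).symm))
  invariant := by
    filter_upwards [hF.smooth.continuousAt.eventually hG.invariant, hF.commute] with y hy hc u w
    simp only [pullMetric, ContinuousLinearMap.bilinearComp_apply, hc, hy]

theorem contDiffAt_koszul {G : CSpace n → RealBilin n} {z : CSpace n} (hG : ContDiffAt ℝ ∞ G z) :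
    ContDiffAt ℝ ∞ (koszul G) z := by
  have hd : ContDiffAt ℝ ∞ (fderiv ℝ G) z := hG.fderiv_right le_rfl
  let fl : (CSpace n →L[ℝ] CSpace n →L[ℝ] Covec n) →L[ℝ] (CSpace n →L[ℝ] CSpace n →L[ℝ] Covec n) :=
    (ContinuousLinearMap.flipₗᵢ ℝ (CSpace n) (CSpace n) (Covec n)).toContinuousLinearEquiv.toContinuousLinearMap
  have hflip : ContDiffAt ℝ ∞ (fun y => fl (fderiv ℝ G y)) z := fl.contDiff.contDiffAt.comp z hd
  exact ((hd.add hflip).sub ((ContinuousLinearMap.compL ℝ (CSpace n) (CSpace n →L[ℝ] Covec n)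
    (CSpace n →L[ℝ] Covec n) (ContinuousLinearMap.flipₗᵢ ℝ (CSpace n) (CSpace n)
      ℝ).toContinuousLinearEquiv.toContinuousLinearMap).contDiff.contDiffAt.comp z hflip)).const_smul
      (1 / 2 : ℝ)

theorem IsHermitianAt.contDiffAt_leviCivitaGamma {G : CSpace n → RealBilin n} {z : CSpace n}
    (hG : IsHermitianAt G z) : ContDiffAt ℝ ∞ (leviCivitaGamma G) z := by
  obtain ⟨e, he⟩ := isInvertible_of_pos hG.pos.self_of_nhds
  have h1 : ContDiffAt ℝ ∞ (fun y => (G y).inverse) z := by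
    have := contDiffAt_map_inverse (𝕜 := ℝ) (n := ∞) e
    rw [he] at this
    exact this.comp z hG.smooth
  exact ((ContinuousLinearMap.compL ℝ (CSpace n) (Covec n) (CSpace n)).contDiff.contDiffAt.comp z
    h1).clm_comp (contDiffAt_koszul hG.smooth)

/-- The terms of the covariant derivative that involve the connection. -/
def connTerm (n k : ℕ) : CovTensor n k →L[ℝ] (CSpace n →L[ℝ] CSpace n) →L[ℝ] CovTensor n k :=
  ∑ j : Fin k, ((ContinuousMultilinearMap.compContinuousLinearMapContinuousMultilinear ℝ
      (fun _ : Fin k => CSpace n) (fun _ : Fin k => CSpace n) ℝ).toContinuousLinearMap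
        (fun _ => ContinuousLinearMap.id ℝ (CSpace n)) j).flip

/-- Currying of covariant tensors. -/
def uncurryCLM (n k : ℕ) : (CSpace n →L[ℝ] CovTensor n k) →L[ℝ] CovTensor n (k + 1) :=
  (continuousMultilinearCurryLeftEquiv ℝ (fun _ : Fin (k + 1) => CSpace n) ℝ).symm.toContinuousLinearEquiv.toContinuousLinearMap

theorem covDeriv_eq {k : ℕ} (Γ : CSpace n → CSpace n →L[ℝ] CSpace n →L[ℝ] CSpace n)
    (T : CSpace n → CovTensor n k) (z : CSpace n) :
    covDeriv Γ T z = uncurryCLM n k (fderiv ℝ T z) - uncurryCLM n k (connTerm n k (T z) ∘L Γ z) := by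
  rw [← map_sub, covDeriv]
  change _ = ContinuousLinearMap.uncurryLeft _
  congr 2
  ext u
  simp [connTerm]

theorem contDiffAt_covDeriv_param {X : Type*} [NormedAddCommGroup X] [NormedSpace ℝ X] {k : ℕ}
    {Γ : CSpace n → CSpace n →L[ℝ] CSpace n →L[ℝ] CSpace n} {T : X → CSpace n → CovTensor n k}
    {q : X × CSpace n} (hΓ : ContDiffAt ℝ ∞ Γ q.2)
    (hT : ContDiffAt ℝ ∞ (fun q : X × CSpace n => T q.1 q.2) q) :
    ContDiffAt ℝ ∞ (fun q : X × CSpace n => covDeriv Γ (T q.1) q.2) q := by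
  simp only [covDeriv_eq]
  refine ((uncurryCLM n k).contDiff.contDiffAt.comp q (contDiffAt_fderiv_param hT)).sub
    ((uncurryCLM n k).contDiff.contDiffAt.comp q ?_)
  exact ((connTerm n k).contDiff.contDiffAt.comp q hT).clm_comp (hΓ.comp q contDiffAt_snd)

theorem contDiffAt_iterCovDeriv_param {X : Type*} [NormedAddCommGroup X] [NormedSpace ℝ X]
    {G : CSpace n → RealBilin n} {u : X → CSpace n → ℝ} {q : X × CSpace n}
    (hG : IsHermitianAt G q.2) (hu : ContDiffAt ℝ ∞ (fun q : X × CSpace n => u q.1 q.2) q) (k : ℕ) :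
    ContDiffAt ℝ ∞ (fun q : X × CSpace n => iterCovDeriv G (u q.1) k q.2) q := by
  induction k with
  | zero =>
    have h : (fun q : X × CSpace n => iterCovDeriv G (u q.1) 0 q.2) = fun q =>
        (continuousMultilinearCurryFin0 ℝ (CSpace n) ℝ).symm (u q.1 q.2) := by
      funext q
      ext v
      rfl
    rw [h]
    exact (continuousMultilinearCurryFin0 ℝ (CSpace n) ℝ).symm.contDiff.contDiffAt.comp q hu
  | succ k ih =>
    exact contDiffAt_covDeriv_param (T := fun p => iterCovDeriv G (u p) k) hG.contDiffAt_leviCivitaGamma ih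

theorem contDiffAt_iterCovDeriv {G : CSpace n → RealBilin n} {u : CSpace n → ℝ} {z : CSpace n}
    (hG : IsHermitianAt G z) (hu : ContDiffAt ℝ ∞ u z) (k : ℕ) :
    ContDiffAt ℝ ∞ (iterCovDeriv G u k) z := by
  have h := contDiffAt_iterCovDeriv_param (X := ℝ) (u := fun _ => u) (q := (0, z)) hG
    (hu.comp (0, z) contDiffAt_snd) k
  exact h.comp z (contDiffAt_const.prodMk contDiffAt_id)

theorem covDeriv_congr {k : ℕ} {Γ Γ' : CSpace n → CSpace n →L[ℝ] CSpace n →L[ℝ] CSpace n}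
    {T T' : CSpace n → CovTensor n k} {z : CSpace n} (hΓ : Γ z = Γ' z) (hT : T =ᶠ[𝓝 z] T') :
    covDeriv Γ T z = covDeriv Γ' T' z := by
  rw [covDeriv_eq, covDeriv_eq, hΓ, hT.fderiv_eq, hT.self_of_nhds]

theorem leviCivitaGamma_congr {G G' : CSpace n → RealBilin n} {z : CSpace n} (h : G =ᶠ[𝓝 z] G') :
    leviCivitaGamma G z = leviCivitaGamma G' z := by
  rw [leviCivitaGamma, leviCivitaGamma, koszul, koszul, h.fderiv_eq, h.self_of_nhds]

theorem iterCovDeriv_congr {G G' : CSpace n → RealBilin n} {u u' : CSpace n → ℝ} {z : CSpace n}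
    (hG : G =ᶠ[𝓝 z] G') (hu : u =ᶠ[𝓝 z] u') (k : ℕ) :
    iterCovDeriv G u k =ᶠ[𝓝 z] iterCovDeriv G' u' k := by
  induction k with
  | zero => exact hu.mono fun y hy => by simp only [iterCovDeriv, hy]
  | succ k ih =>
    filter_upwards [ih.eventuallyEq_nhds, hG.eventuallyEq_nhds] with y h1 h2
    exact covDeriv_congr (leviCivitaGamma_congr h2) h1

/-- The iterated covariant derivatives are natural. -/
theorem iterCovDeriv_pull {F : CSpace n → CSpace n} {G : CSpace n → RealBilin n} {u : CSpace n → ℝ}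
    {z : CSpace n} (hF : IsBiholo F z) (hG : IsHermitianAt G (F z)) (hu : ContDiffAt ℝ ∞ u (F z)) (k : ℕ) :
    iterCovDeriv (pullMetric F G) (fun y => u (F y)) k =ᶠ[𝓝 z]
      fun y => (iterCovDeriv G u k (F y)).compContinuousLinearMap fun _ => fderiv ℝ F y := by
  induction k with
  | zero =>
    refine Eventually.of_forall fun y => ?_
    ext v
    rfl
  | succ k ih =>
    have hc := hF.smooth.continuousAt
    filter_upwards [ih.eventuallyEq_nhds, hF.eventually_two, hF.inj, hc.eventually hG.symm,
      hc.eventually hG.pos, hc.eventually (contDiffAt_infty_eventually hG.smooth 1),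
      hc.eventually (contDiffAt_infty_eventually (contDiffAt_iterCovDeriv hG hu k) 1)]
      with y h1 h2 h3 h4 h5 h6 h7
    exact covDeriv_pull h2 (leviCivitaGamma_pull h2 h3 (h6.differentiableAt (by norm_num)) h4 h5)
      (h7.differentiableAt (by norm_num)) h1

theorem iterCovDeriv_add {G : CSpace n → RealBilin n} {u w : CSpace n → ℝ} {z : CSpace n}
    (hG : IsHermitianAt G z) (hu : ContDiffAt ℝ ∞ u z) (hw : ContDiffAt ℝ ∞ w z) (k : ℕ) :
    iterCovDeriv G (fun y => u y + w y) k =ᶠ[𝓝 z]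
      fun y => iterCovDeriv G u k y + iterCovDeriv G w k y := by
  induction k with
  | zero =>
    refine Eventually.of_forall fun y => ?_
    ext v
    rfl
  | succ k ih =>
    filter_upwards [ih.eventuallyEq_nhds,
      contDiffAt_infty_eventually (contDiffAt_iterCovDeriv hG hu k) 1,
      contDiffAt_infty_eventually (contDiffAt_iterCovDeriv hG hw k) 1] with y h1 h2 h3
    simp only [iterCovDeriv]
    rw [covDeriv_congr rfl h1, covDeriv_eq, covDeriv_eq, covDeriv_eq,
      fderiv_fun_add (h2.differentiableAt (by norm_num)) (h3.differentiableAt (by norm_num)), map_add,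
      map_add, ContinuousLinearMap.add_comp, map_add]
    abel

/-- The second covariant derivative is symmetric. -/
theorem iterCovDeriv_two_symm {G : CSpace n → RealBilin n} {u : CSpace n → ℝ} {z : CSpace n}
    (hG : IsHermitianAt G z) (hu : ContDiffAt ℝ ∞ u z) (a b : CSpace n) :
    iterCovDeriv G u 2 z ![a, b] = iterCovDeriv G u 2 z ![b, a] := by
  have h1 : ∀ y, DifferentiableAt ℝ u y → ∀ v, iterCovDeriv G u 1 y v = fderiv ℝ u y (v 0) := by
    intro y hy v
    have h : iterCovDeriv G u 0 = fun y => (continuousMultilinearCurryFin0 ℝ (CSpace n) ℝ).symm (u y) := by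
      funext q
      ext v
      rfl
    have h3 : fderiv ℝ (iterCovDeriv G u 0) y = ((continuousMultilinearCurryFin0 ℝ (CSpace n)
        ℝ).symm.toContinuousLinearEquiv.toContinuousLinearMap) ∘L fderiv ℝ u y := by
      rw [h]
      exact (((continuousMultilinearCurryFin0 ℝ (CSpace n)
        ℝ).symm.toContinuousLinearEquiv.toContinuousLinearMap).hasFDerivAt.comp y hy.hasFDerivAt).fderiv
    change covDeriv (leviCivitaGamma G) (iterCovDeriv G u 0) y v = _
    rw [covDeriv_apply, h3]
    simp
  have hd2 : DifferentiableAt ℝ (fderiv ℝ u) z :=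
    ((hu.of_le ENat.LEInfty.out : ContDiffAt ℝ 2 u z).fderiv_right (m := 1)
      (by norm_num)).differentiableAt one_ne_zero
  have hd : DifferentiableAt ℝ u z := hu.differentiableAt (by simp)
  have hT : DifferentiableAt ℝ (iterCovDeriv G u 1) z :=
    (contDiffAt_iterCovDeriv hG hu 1).differentiableAt (by simp)
-- the Hessian is the second derivative minus a term with the symmetric Christoffel symbols
  have h2 : ∀ a b, iterCovDeriv G u 2 z ![a, b] =
      fderiv ℝ (fderiv ℝ u) z a b - fderiv ℝ u z (leviCivitaGamma G z a b) := by
    intro a b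
    have e1 : (fun y => iterCovDeriv G u 1 y ![b]) =ᶠ[𝓝 z] fun y => fderiv ℝ u y b := by
      filter_upwards [contDiffAt_infty_eventually hu 1] with y hy
      exact h1 y (hy.differentiableAt (by norm_num)) _
    have e2 : fderiv ℝ (fun y => iterCovDeriv G u 1 y ![b]) z a =
        fderiv ℝ (iterCovDeriv G u 1) z a ![b] := by
      rw [(hT.hasFDerivAt.continuousMultilinear_apply_const ![b]).fderiv]
      rfl
    have e3 : fderiv ℝ (fun y => fderiv ℝ u y b) z a = fderiv ℝ (fderiv ℝ u) z a b := by
      rw [(hd2.hasFDerivAt.clm_apply (hasFDerivAt_const b z)).fderiv]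
      simp
    change covDeriv (leviCivitaGamma G) (iterCovDeriv G u 1) z ![a, b] = _
    rw [covDeriv_apply]
    have e4 : Fin.tail ![a, b] = ![b] := rfl
    have e5 : (![a, b] : Fin 2 → CSpace n) 0 = a := rfl
    rw [e4, e5, ← e2, e1.fderiv_eq, e3]
    simp [h1 z hd]
  rw [h2, h2, leviCivitaGamma_symm (hG.smooth.differentiableAt (by simp)) hG.symm]
  have := (hu.of_le ENat.LEInfty.out : ContDiffAt ℝ 2 u z).isSymmSndFDerivAt (by simp)
  rw [this a b]

end LeviCivita

/-! ### Functions that vanish to a given order -/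

section Vanishing

open Filter Topology

variable {E V W X : Type} [NormedAddCommGroup E] [NormedSpace ℝ E]
    [NormedAddCommGroup V] [NormedSpace ℝ V] [NormedAddCommGroup W] [NormedSpace ℝ W]
    [NormedAddCommGroup X] [NormedSpace ℝ X]

/-- `f` is smooth at `z` and its derivatives of order less than `N` vanish there. -/
structure VanishesTo (N : ℕ) (f : E → V) (z : E) : Prop where
  smooth : ContDiffAt ℝ ∞ f z
  zero : ∀ j < N, iteratedFDeriv ℝ j f z = 0

namespace VanishesTo

variable {N k : ℕ} {f g : E → V} {z : E}

theorem mono {M : ℕ} (h : VanishesTo N f z) (hM : M ≤ N) : VanishesTo M f z :=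
  ⟨h.smooth, fun j hj => h.zero j (hj.trans_le hM)⟩

theorem congr (h : VanishesTo N f z) (hfg : g =ᶠ[𝓝 z] f) : VanishesTo N g z :=
  ⟨h.smooth.congr_of_eventuallyEq hfg, fun j hj => by rw [(hfg.iteratedFDeriv ℝ j).self_of_nhds, h.zero j hj]⟩

theorem of_smooth (h : ContDiffAt ℝ ∞ f z) : VanishesTo 0 f z :=
  ⟨h, fun j hj => absurd hj (Nat.not_lt_zero j)⟩

theorem eq_zero (h : VanishesTo (N + 1) f z) : f z = 0 := by
  have := h.zero 0 N.succ_pos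
  have h2 := iteratedFDeriv_zero_apply (𝕜 := ℝ) (f := f) (x := z) 0
  rw [this] at h2
  exact h2.symm

theorem succ (h : VanishesTo N f z) (h0 : iteratedFDeriv ℝ N f z = 0) : VanishesTo (N + 1) f z :=
  ⟨h.smooth, fun j hj => (Nat.lt_succ_iff_lt_or_eq.1 hj).elim (h.zero j) fun h => h ▸ h0⟩

end VanishesTo

variable {N k : ℕ} {f g : E → V} {z : E}

theorem vanishesTo_succ_iff :
    VanishesTo (N + 1) f z ↔ ContDiffAt ℝ ∞ f z ∧ f z = 0 ∧ VanishesTo N (fderiv ℝ f) z := by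
  constructor
  · intro h
    refine ⟨h.smooth, h.eq_zero, h.smooth.fderiv_right le_rfl, fun j hj => ?_⟩
    have := h.zero (j + 1) (Nat.succ_lt_succ hj)
    rw [iteratedFDeriv_succ_eq_comp_right] at this
    exact (LinearIsometryEquiv.map_eq_zero_iff _).1 this
  · rintro ⟨h1, h2, h3⟩
    refine ⟨h1, fun j hj => ?_⟩
    cases j with
    | zero =>
      ext v
      simpa using h2
    | succ j =>
      rw [iteratedFDeriv_succ_eq_comp_right]
      exact (LinearIsometryEquiv.map_eq_zero_iff _).2 (h3.zero j (Nat.lt_of_succ_lt_succ hj))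

namespace VanishesTo

theorem fderiv (h : VanishesTo (N + 1) f z) : VanishesTo N (fderiv ℝ f) z :=
  (vanishesTo_succ_iff.1 h).2.2

theorem add (hf : VanishesTo N f z) (hg : VanishesTo N g z) :
    VanishesTo N (fun y => f y + g y) z := by
  refine ⟨hf.smooth.add hg.smooth, fun j hj => ?_⟩
  have := iteratedFDeriv_add_apply (i := j) (hf.smooth.of_le (ENat.LEInfty.out))
    (hg.smooth.of_le (ENat.LEInfty.out))
  change iteratedFDeriv ℝ j (f + g) z = 0
  rw [this, hf.zero j hj, hg.zero j hj, add_zero]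

theorem clm_comp (Λ : V →L[ℝ] W) (hf : VanishesTo N f z) : VanishesTo N (fun y => Λ (f y)) z := by
  refine ⟨Λ.contDiff.contDiffAt.comp z hf.smooth, fun j hj => ?_⟩
  have := Λ.iteratedFDeriv_comp_left (i := j) (n := ∞) hf.smooth ENat.LEInfty.out
  change iteratedFDeriv ℝ j (Λ ∘ f) z = 0
  rw [this, hf.zero j hj]
  ext v
  simp

theorem neg (hf : VanishesTo N f z) : VanishesTo N (fun y => -f y) z :=
  hf.clm_comp (-ContinuousLinearMap.id ℝ V)

theorem sub (hf : VanishesTo N f z) (hg : VanishesTo N g z) :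
    VanishesTo N (fun y => f y - g y) z := by
  simp only [sub_eq_add_neg]
  exact hf.add hg.neg

end VanishesTo

theorem eventually_fderiv_bilin (B : V →L[ℝ] W →L[ℝ] X) {f : E → V} {g : E → W}
    (hf : ContDiffAt ℝ ∞ f z) (hg : ContDiffAt ℝ ∞ g z) :
    fderiv ℝ (fun y => B (f y) (g y)) =ᶠ[𝓝 z]
      fun y => B.precompR E (f y) (fderiv ℝ g y) + B.precompL E (fderiv ℝ f y) (g y) := by
  filter_upwards [contDiffAt_infty_eventually hf 1, contDiffAt_infty_eventually hg 1] with y h1 h2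
  exact B.fderiv_of_bilinear (h1.differentiableAt (by norm_num)) (h2.differentiableAt (by norm_num))

theorem contDiffAt_bilin (B : V →L[ℝ] W →L[ℝ] X) {f : E → V} {g : E → W}
    (hf : ContDiffAt ℝ ∞ f z) (hg : ContDiffAt ℝ ∞ g z) :
    ContDiffAt ℝ ∞ (fun y => B (f y) (g y)) z :=
  (B.contDiff.contDiffAt.comp z hf).clm_apply hg

theorem VanishesTo.bilin_right {N : ℕ} {V W X : Type}
    [NormedAddCommGroup V] [NormedSpace ℝ V] [NormedAddCommGroup W] [NormedSpace ℝ W]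
    [NormedAddCommGroup X] [NormedSpace ℝ X] (B : V →L[ℝ] W →L[ℝ] X) {f : E → V} {g : E → W}
    (hf : ContDiffAt ℝ ∞ f z) (hg : VanishesTo N g z) : VanishesTo N (fun y => B (f y) (g y)) z := by
  induction N generalizing V W X with
  | zero => exact VanishesTo.of_smooth (contDiffAt_bilin B hf hg.smooth)
  | succ N ih =>
    refine vanishesTo_succ_iff.2 ⟨contDiffAt_bilin B hf hg.smooth, by simp [hg.eq_zero], ?_⟩
    exact ((ih _ hf hg.fderiv).add (ih _ (hf.fderiv_right le_rfl) (hg.mono N.le_succ))).congr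
      (eventually_fderiv_bilin B hf hg.smooth)

theorem VanishesTo.bilin_left (B : V →L[ℝ] W →L[ℝ] X) {f : E → V} {g : E → W}
    (hf : VanishesTo N f z) (hg : ContDiffAt ℝ ∞ g z) : VanishesTo N (fun y => B (f y) (g y)) z :=
  VanishesTo.bilin_right B.flip hg hf

/-- Multiplication by a function that vanishes at `z` raises the order of vanishing. -/
theorem VanishesTo.bilin_succ {N : ℕ} {V W X : Type}
    [NormedAddCommGroup V] [NormedSpace ℝ V] [NormedAddCommGroup W] [NormedSpace ℝ W]
    [NormedAddCommGroup X] [NormedSpace ℝ X] (B : V →L[ℝ] W →L[ℝ] X) {f : E → V} {g : E → W}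
    (hf : VanishesTo N f z) (hg : ContDiffAt ℝ ∞ g z) (h0 : g z = 0) :
    VanishesTo (N + 1) (fun y => B (f y) (g y)) z := by
  induction N generalizing V W X with
  | zero =>
    refine vanishesTo_succ_iff.2 ⟨contDiffAt_bilin B hf.smooth hg, by simp [h0], VanishesTo.of_smooth ?_⟩
    exact (contDiffAt_bilin B hf.smooth hg).fderiv_right le_rfl
  | succ N ih =>
    refine vanishesTo_succ_iff.2 ⟨contDiffAt_bilin B hf.smooth hg, by simp [h0], ?_⟩
    exact ((hf.bilin_left _ (hg.fderiv_right le_rfl)).add (ih _ hf.fderiv hg h0)).congr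
      (eventually_fderiv_bilin B hf.smooth hg)

theorem contDiffAt_iteratedFDeriv (hf : ContDiffAt ℝ ∞ f z) (k : ℕ) :
    ContDiffAt ℝ ∞ (iteratedFDeriv ℝ k f) z :=
  hf.iteratedFDeriv_right le_rfl

theorem VanishesTo.iteratedFDeriv (hf : VanishesTo (N + k) f z) :
    VanishesTo N (iteratedFDeriv ℝ k f) z := by
  induction k generalizing N with
  | zero =>
    rw [iteratedFDeriv_zero_eq_comp]
    exact hf.clm_comp (continuousMultilinearCurryFin0 ℝ E V).symm.toContinuousLinearEquiv.toContinuousLinearMap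
  | succ k ih =>
    have h : VanishesTo (N + 1) (_root_.iteratedFDeriv ℝ k f) z := ih (hf.mono (by omega))
    rw [iteratedFDeriv_succ_eq_comp_left]
    exact h.fderiv.clm_comp (continuousMultilinearCurryLeftEquiv ℝ (fun _ : Fin (k + 1) => E)
      V).symm.toContinuousLinearEquiv.toContinuousLinearMap

/-- Iterated derivatives are symmetric. -/
theorem iteratedFDeriv_comp_swap (hf : ContDiffAt ℝ ∞ f z) (k : ℕ) :
    ∀ᶠ y in 𝓝 z, ∀ (i : Fin k) (v : Fin (k + 1) → E),
      iteratedFDeriv ℝ (k + 1) f y (v ∘ Equiv.swap i.castSucc i.succ) =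
        iteratedFDeriv ℝ (k + 1) f y v := by
  induction k with
  | zero => exact Eventually.of_forall fun y i => i.elim0
  | succ k ih =>
    filter_upwards [ih.eventually_nhds, contDiffAt_infty_eventually hf (k + 3)] with y hy hs i v
    have hD1 : DifferentiableAt ℝ (iteratedFDeriv ℝ (k + 1) f) y :=
      hs.differentiableAt_iteratedFDeriv (by norm_cast; omega)
    refine Fin.cases ?_ (fun i => ?_) i
    · have hD : ContDiffAt ℝ 2 (iteratedFDeriv ℝ k f) y :=
        hs.iteratedFDeriv_right (by norm_cast; omega)
      have hd2 : DifferentiableAt ℝ (fderiv ℝ (iteratedFDeriv ℝ k f)) y :=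
        (hD.fderiv_right (m := 1) (by norm_num)).differentiableAt one_ne_zero
      have h : ∀ v : Fin (k + 2) → E, iteratedFDeriv ℝ (k + 2) f y v =
          fderiv ℝ (fderiv ℝ (iteratedFDeriv ℝ k f)) y (v 0) (v 1) (Fin.tail (Fin.tail v)) := by
        intro v
        rw [iteratedFDeriv_succ_apply_left, iteratedFDeriv_succ_eq_comp_left]
        have := ((continuousMultilinearCurryLeftEquiv ℝ (fun _ : Fin (k + 1) => E)
          V).symm.toContinuousLinearEquiv.toContinuousLinearMap.hasFDerivAt.comp y hd2.hasFDerivAt).fderiv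
        erw [this]
        rfl
      rw [h, h]
      have hs := hD.isSymmSndFDerivAt (by simp)
      have e0 : (v ∘ Equiv.swap (Fin.castSucc (0 : Fin (k + 1))) (Fin.succ 0)) 0 = v 1 := by simp
      have e1 : (v ∘ Equiv.swap (Fin.castSucc (0 : Fin (k + 1))) (Fin.succ 0)) 1 = v 0 := by
        simp
      have e2 : Fin.tail (Fin.tail (v ∘ Equiv.swap (Fin.castSucc (0 : Fin (k + 1))) (Fin.succ 0))) =
          Fin.tail (Fin.tail v) := by
        funext j
        simp only [Fin.tail, Function.comp]
        rw [Equiv.swap_apply_of_ne_of_ne]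
        · simp [Fin.ext_iff]
        · simp [Fin.ext_iff]
      rw [e0, e1, e2, hs (v 1) (v 0)]
    · have h := iteratedFDeriv_succ_apply_left (𝕜 := ℝ) (f := f) (x := y) (n := k + 1)
      rw [h, h]
      have e0 : (v ∘ Equiv.swap (Fin.castSucc i.succ) (Fin.succ i.succ)) 0 = v 0 := by
        simp only [Function.comp]
        rw [Equiv.swap_apply_of_ne_of_ne]
        · simp [Fin.ext_iff]
        · simp [Fin.ext_iff]
      have e1 : Fin.tail (v ∘ Equiv.swap (Fin.castSucc i.succ) (Fin.succ i.succ)) =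
          Fin.tail v ∘ Equiv.swap i.castSucc i.succ := by
        funext j
        simp only [Fin.tail, Function.comp, ← Fin.succ_castSucc]
        rw [(Fin.succ_injective _).swap_apply]
      rw [e0, e1]
      have h3 : (fun x => iteratedFDeriv ℝ (k + 1) f x (Fin.tail v ∘ Equiv.swap i.castSucc i.succ)) =ᶠ[𝓝 y]
          fun x => iteratedFDeriv ℝ (k + 1) f x (Fin.tail v) := hy.mono fun x hx => hx i _
      have h4 : ∀ w, fderiv ℝ (fun x => iteratedFDeriv ℝ (k + 1) f x w) y (v 0) =
          fderiv ℝ (iteratedFDeriv ℝ (k + 1) f) y (v 0) w := fun w => by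
        rw [(hD1.hasFDerivAt.continuousMultilinear_apply_const w).fderiv]
        rfl
      rw [← h4, ← h4, h3.fderiv_eq]

theorem iteratedFDeriv_comp_perm_of_smooth (hf : ContDiffAt ℝ ∞ f z) (k : ℕ) (σ : Equiv.Perm (Fin k))
    (v : Fin k → E) : iteratedFDeriv ℝ k f z (v ∘ σ) = iteratedFDeriv ℝ k f z v := by
  cases k with
  | zero => congr 1; funext i; exact i.elim0
  | succ k =>
    have h := (iteratedFDeriv_comp_swap hf k).self_of_nhds
    have hσ : σ ∈ Submonoid.closure (Set.range fun i : Fin k => Equiv.swap i.castSucc i.succ) := by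
      rw [Equiv.Perm.mclosure_swap_castSucc_succ]; trivial
    induction hσ using Submonoid.closure_induction generalizing v with
    | mem x hx => obtain ⟨i, rfl⟩ := hx; exact h i v
    | one => rfl
    | mul x y _ _ hx hy =>
      have : v ∘ (x * y : Equiv.Perm (Fin (k + 1))) = (v ∘ x) ∘ y := rfl
      rw [this, hy, hx]

/-- A symmetric multilinear map that vanishes on the diagonal is zero. -/
theorem eq_zero_of_diagonal (T : E [×k]→L[ℝ] V) (hs : ∀ (σ : Equiv.Perm (Fin k)) v, T (v ∘ σ) = T v)
    (hd : ∀ a, T (fun _ => a) = 0) : T = 0 := by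
  ext v
  have h := T.iteratedFDeriv_comp_diagonal 0 v
  have h0 : (fun x : E => T fun _ => x) = fun _ => 0 := funext hd
  have h1 : ∑ σ : Equiv.Perm (Fin k), T (fun i => v (σ i)) = (Fintype.card (Equiv.Perm (Fin k)) : ℝ) • T v := by
    have hh : ∀ σ : Equiv.Perm (Fin k), T (fun i => v (σ i)) = T v := fun σ => hs σ v
    rw [Finset.sum_congr rfl fun σ _ => hh σ, Finset.sum_const, Finset.card_univ, Nat.cast_smul_eq_nsmul]
  rw [h0, h1] at h
  have h2 : iteratedFDeriv ℝ k (fun _ : E => (0 : V)) 0 = 0 := by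
    rw [iteratedFDeriv_fun_zero]; rfl
  rw [h2] at h
  have h3 : (Fintype.card (Equiv.Perm (Fin k)) : ℝ) ≠ 0 := by
    exact_mod_cast Fintype.card_ne_zero
  simpa [h3] using h.symm

theorem VanishesTo.succ_of_diagonal (hf : VanishesTo N f z)
    (hd : ∀ a, _root_.iteratedFDeriv ℝ N f z (fun _ => a) = 0) : VanishesTo (N + 1) f z :=
  hf.succ (eq_zero_of_diagonal _ (iteratedFDeriv_comp_perm_of_smooth hf.smooth N) hd)

/-- If `f` vanishes to order `N`, the leading term of `f • β` is the leading term of `f` times `β`. -/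
theorem VanishesTo.iteratedFDeriv_smul {N : ℕ} {f : E → ℝ} {β : E → V} (hf : VanishesTo N f z)
    (hβ : ContDiffAt ℝ ∞ β z) (v : Fin N → E) :
    _root_.iteratedFDeriv ℝ N (fun y => f y • β y) z v = _root_.iteratedFDeriv ℝ N f z v • β z := by
  induction N generalizing f β with
  | zero => simp
  | succ N ih =>
    have hsm : ContDiffAt ℝ ∞ (fun y => f y • β y) z := hf.smooth.smul hβ
    have h1 : ∀ {W : Type} [NormedAddCommGroup W] [NormedSpace ℝ W] {h : E → W}, ContDiffAt ℝ ∞ h z →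
        _root_.iteratedFDeriv ℝ (N + 1) h z v =
          _root_.iteratedFDeriv ℝ N (fun y => _root_.fderiv ℝ h y (v (Fin.last N))) z (Fin.init v) := by
      intro W _ _ h hh
      have h4 : ContDiffAt ℝ ∞ (_root_.fderiv ℝ h) z := hh.fderiv_right le_rfl
      have h5 := (ContinuousLinearMap.apply ℝ W (v (Fin.last N))).iteratedFDeriv_comp_left (i := N) h4
        ENat.LEInfty.out
      rw [iteratedFDeriv_succ_apply_right]
      exact (congrArg (fun x => x (Fin.init v)) h5).symm
    rw [h1 hsm, h1 hf.smooth]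
    set a := v (Fin.last N)
    have h2 : (fun y => _root_.fderiv ℝ (fun y => f y • β y) y a) =ᶠ[𝓝 z]
        (fun y => _root_.fderiv ℝ f y a • β y) + fun y => f y • _root_.fderiv ℝ β y a := by
      filter_upwards [contDiffAt_infty_eventually hf.smooth 1, contDiffAt_infty_eventually hβ 1]
        with y hy1 hy2
      rw [fderiv_fun_smul (hy1.differentiableAt (by norm_num)) (hy2.differentiableAt (by norm_num))]
      simp [add_comm]
    have hfa : VanishesTo N (fun y => _root_.fderiv ℝ f y a) z :=
      hf.fderiv.clm_comp (ContinuousLinearMap.apply ℝ ℝ a)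
    have hβa : ContDiffAt ℝ ∞ (fun y => _root_.fderiv ℝ β y a) z :=
      (hβ.fderiv_right le_rfl).clm_apply contDiffAt_const
    have h3 : VanishesTo (N + 1) (fun y => f y • _root_.fderiv ℝ β y a) z :=
      VanishesTo.bilin_left (ContinuousLinearMap.lsmul ℝ ℝ) hf hβa
    have h6 : ContDiffAt ℝ ∞ (fun y => _root_.fderiv ℝ f y a • β y) z := hfa.smooth.smul hβ
    rw [(h2.iteratedFDeriv ℝ N).self_of_nhds, iteratedFDeriv_add_apply (h6.of_le ENat.LEInfty.out)
      (h3.smooth.of_le ENat.LEInfty.out), h3.zero N N.lt_succ_self, add_zero, ih hfa hβ]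

/-- Homogeneous polynomials of degree `k` in `y - z`, with smooth coefficients. -/
theorem vanishesTo_homogeneous {j k : ℕ} {T : E → E [×k]→L[ℝ] V} (hT : VanishesTo j T z) :
    VanishesTo (j + k) (fun y => T y fun _ => y - z) z := by
  induction k generalizing j with
  | zero =>
    have h := hT.clm_comp (continuousMultilinearCurryFin0 ℝ E V).toContinuousLinearEquiv.toContinuousLinearMap
    refine h.congr (Eventually.of_forall fun y => ?_)
    change T y _ = T y 0
    congr 1
    funext i
    exact i.elim0
  | succ k ih =>
    have h := hT.clm_comp (continuousMultilinearCurryLeftEquiv ℝ (fun _ : Fin (k + 1) => E)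
      V).toContinuousLinearEquiv.toContinuousLinearMap
    have h2 : VanishesTo (j + 1) (fun y => (continuousMultilinearCurryLeftEquiv ℝ (fun _ : Fin (k + 1) => E)
      V).toContinuousLinearEquiv.toContinuousLinearMap (T y) (y - z)) z :=
      VanishesTo.bilin_succ (ContinuousLinearMap.id ℝ (E →L[ℝ] E [×k]→L[ℝ] V)) h
        (contDiffAt_id.sub contDiffAt_const) (by simp)
    have h3 := ih h2
    rw [show j + (k + 1) = j + 1 + k by omega]
    refine h3.congr (Eventually.of_forall fun y => ?_)
    change T y _ = T y (Fin.cons (y - z) fun _ => y - z)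
    congr 1
    funext i
    refine Fin.cases ?_ (fun i => ?_) i <;> simp

end Vanishing

/-! ### Functions with a prescribed jet -/

section Jets

open Filter Topology

variable {n N k : ℕ} {G : CSpace n → RealBilin n} {u w : CSpace n → ℝ} {z : CSpace n}

/-- The covariant derivatives of a function that vanishes to high order vanish to the expected order, and agree with the
ordinary derivatives to one order more. -/
theorem VanishesTo.iterCovDeriv (hG : IsHermitianAt G z) (hw : VanishesTo (N + k) w z) :
    VanishesTo N (iterCovDeriv G w k) z ∧
      VanishesTo (N + 1) (fun y => _root_.iterCovDeriv G w k y - _root_.iteratedFDeriv ℝ k w y) z := by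
  induction k generalizing N with
  | zero =>
    have h : _root_.iterCovDeriv G w 0 = _root_.iteratedFDeriv ℝ 0 w := by
      funext y
      ext v
      simp [_root_.iterCovDeriv]
    have h2 : VanishesTo N (_root_.iteratedFDeriv ℝ 0 w) z := VanishesTo.iteratedFDeriv hw
    refine ⟨h ▸ h2, ?_⟩
    simp only [h, sub_self]
    refine ⟨contDiffAt_const, fun j _ => ?_⟩
    rw [iteratedFDeriv_fun_zero]
    rfl
  | succ k ih =>
    have hw' : VanishesTo (N + 1 + k) w z := hw.mono (by omega)
    obtain ⟨h1, h2⟩ := ih hw'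
    have hT := h1.smooth
    have hD := contDiffAt_iteratedFDeriv hw.smooth k
-- the connection terms involve only the covariant derivative of the preceding order
    have key : VanishesTo (N + 1) (fun y => _root_.iterCovDeriv G w (k + 1) y - _root_.iteratedFDeriv ℝ (k + 1) w y) z := by
      have h3 := (h2.fderiv.clm_comp (uncurryCLM n k)).sub
        ((h1.bilin_left ((ContinuousLinearMap.compL ℝ (CSpace n) (CSpace n →L[ℝ] CSpace n) (CovTensor n k)) ∘L connTerm n k)
          hG.contDiffAt_leviCivitaGamma).clm_comp (uncurryCLM n k))
      refine h3.congr ?_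
      filter_upwards [contDiffAt_infty_eventually hT 1, contDiffAt_infty_eventually hD 1] with y hy1 hy2
      rw [fderiv_fun_sub (hy1.differentiableAt (by norm_num)) (hy2.differentiableAt (by norm_num)), map_sub]
      change covDeriv _ _ _ - _ = _
      rw [covDeriv_eq, iteratedFDeriv_succ_eq_comp_left]
      change _ - uncurryCLM n k _ = _
      simp only [ContinuousLinearMap.comp_apply, ContinuousLinearMap.compL_apply]
      abel
    refine ⟨?_, key⟩
    have h4 : VanishesTo N (_root_.iteratedFDeriv ℝ (k + 1) w) z := VanishesTo.iteratedFDeriv hw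
    refine ((key.mono N.le_succ).add h4).congr (Eventually.of_forall fun y => ?_)
    simp

theorem VanishesTo.iterCovDeriv_eq (hG : IsHermitianAt G z) (hw : VanishesTo k w z) :
    _root_.iterCovDeriv G w k z = _root_.iteratedFDeriv ℝ k w z :=
  sub_eq_zero.1 (VanishesTo.iterCovDeriv (N := 0) hG (by simpa using hw)).2.eq_zero

theorem VanishesTo.iterCovDeriv_eq_zero (hG : IsHermitianAt G z) (hw : VanishesTo N w z) (hk : k < N) :
    _root_.iterCovDeriv G w k z = 0 :=
  (VanishesTo.iterCovDeriv (N := 1) hG (hw.mono (by omega))).1.eq_zero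

/-- The leading term of a function is symmetric, hence determined by its restriction to the diagonal. -/
theorem vanishesTo_of_diagonal (hG : IsHermitianAt G z) (hw : ContDiffAt ℝ ∞ w z)
    (h : ∀ k < N, ∀ a, iterCovDeriv G w k z (fun _ => a) = 0) : VanishesTo N w z := by
  induction N with
  | zero => exact VanishesTo.of_smooth hw
  | succ N ih =>
    have h1 := ih fun k hk => h k (hk.trans N.lt_succ_self)
    refine h1.succ_of_diagonal fun a => ?_
    rw [← h1.iterCovDeriv_eq hG]
    exact h N N.lt_succ_self a

/-- A function is determined to order `N` by the restrictions to the diagonal of its covariant derivatives of order less than `N`. -/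
theorem vanishesTo_sub (hG : IsHermitianAt G z) (hu : ContDiffAt ℝ ∞ u z) (hw : ContDiffAt ℝ ∞ w z)
    (h : ∀ k < N, ∀ a, iterCovDeriv G u k z (fun _ => a) = iterCovDeriv G w k z (fun _ => a)) :
    VanishesTo N (fun y => u y - w y) z := by
  refine vanishesTo_of_diagonal hG (hu.sub hw) fun k hk a => ?_
  have h1 := (iterCovDeriv_add hG (hu.sub hw) hw k).self_of_nhds
  simp only [sub_add_cancel] at h1
  have h2 := h k hk a
  rw [h1] at h2
  simpa using h2

/-- The component of degree `k` of a jet. -/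
def jetComp (n N k : ℕ) : JetTuple n N →L[ℝ] CovTensor n k :=
  if h : k < N then ContinuousLinearMap.proj (R := ℝ) (φ := fun k : Fin N => CovTensor n k) ⟨k, h⟩ else 0

theorem jetComp_apply (ψ : JetTuple n N) (k : Fin N) : jetComp n N k ψ = ψ k := by
  simp [jetComp]

/-- A polynomial of degree less than `k` whose covariant derivatives at `z` have, on the diagonal, the values prescribed by the jet `ψ`. -/
def jetPoly (G : CSpace n → RealBilin n) (z : CSpace n) (ψ : JetTuple n N) : ℕ → CSpace n → ℝ
  | 0 => fun _ => 0
  | k + 1 => fun y => jetPoly G z ψ k y +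
      (1 / k.factorial : ℝ) * (jetComp n N k ψ - iterCovDeriv G (jetPoly G z ψ k) k z) fun _ => y - z

theorem contDiffAt_apply_diagonal {X E : Type*} [NormedAddCommGroup X] [NormedSpace ℝ X]
    [NormedAddCommGroup E] [NormedSpace ℝ E] {T : X → E [×k]→L[ℝ] ℝ} {v : X → E} {q : X}
    (hT : ContDiffAt ℝ ∞ T q) (hv : ContDiffAt ℝ ∞ v q) :
    ContDiffAt ℝ ∞ (fun x => T x fun _ => v x) q := by
  induction k with
  | zero =>
    refine ((continuousMultilinearCurryFin0 ℝ E ℝ).contDiff.contDiffAt.comp q hT).congr_of_eventuallyEq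
      (Eventually.of_forall fun y => ?_)
    change T y _ = T y 0
    congr 1
    funext i
    exact i.elim0
  | succ k ih =>
    have h := ((continuousMultilinearCurryLeftEquiv ℝ (fun _ : Fin (k + 1) => E)
      ℝ).contDiff.contDiffAt.comp q hT).clm_apply hv
    refine (ih h).congr_of_eventuallyEq (Eventually.of_forall fun y => ?_)
    change T y _ = T y (Fin.cons (v y) fun _ => v y)
    congr 1
    funext i
    refine Fin.cases ?_ (fun i => ?_) i <;> simp

/-- The polynomials `jetPoly` depend smoothly on the jet and its base point. -/
theorem contDiffAt_jetPoly_param (hG : IsHermitianAt G z) (ψ : JetTuple n N) (y : CSpace n) :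
    ContDiffAt ℝ ∞ (fun q : (CSpace n × JetTuple n N) × CSpace n => jetPoly G q.1.1 q.1.2 k q.2)
      ((z, ψ), y) := by
  induction k generalizing y with
  | zero => exact contDiffAt_const
  | succ k ih =>
    have h1 := contDiffAt_iterCovDeriv_param (X := CSpace n × JetTuple n N)
      (u := fun p => jetPoly G p.1 p.2 k) (q := ((z, ψ), z)) hG (ih z) k
    have h2 : ContDiffAt ℝ ∞ (fun q : (CSpace n × JetTuple n N) × CSpace n =>
        iterCovDeriv G (jetPoly G q.1.1 q.1.2 k) k q.1.1) ((z, ψ), y) := by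
      have h3 : ContDiffAt ℝ ∞ (fun q : (CSpace n × JetTuple n N) × CSpace n => (q.1, q.1.1))
        ((z, ψ), y) := by fun_prop
      exact ContDiffAt.comp (g := fun q : (CSpace n × JetTuple n N) × CSpace n =>
        iterCovDeriv G (jetPoly G q.1.1 q.1.2 k) k q.2) ((z, ψ), y) h1 h3
    have h4 : ContDiffAt ℝ ∞ (fun q : (CSpace n × JetTuple n N) × CSpace n => jetComp n N k q.1.2) ((z, ψ), y) := by
      fun_prop
    refine (ih y).add (contDiffAt_const.mul (contDiffAt_apply_diagonal (h4.sub h2) ?_))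
    fun_prop

theorem contDiffAt_jetPoly (hG : IsHermitianAt G z) (ψ : JetTuple n N) (y : CSpace n) :
    ContDiffAt ℝ ∞ (jetPoly G z ψ k) y :=
  (contDiffAt_jetPoly_param hG ψ y).comp y (contDiffAt_const.prodMk contDiffAt_id)

/-- The correction added at step `K` vanishes to order `K`, so that it changes the covariant derivatives of order
at most `K` only in order `K`, and there by its ordinary `K`-th derivative. -/
theorem iterCovDeriv_jetPoly (hG : IsHermitianAt G z) (ψ : JetTuple n N) {K : ℕ} (hk : k < K)
    (a : CSpace n) :
    iterCovDeriv G (jetPoly G z ψ K) k z (fun _ => a) = jetComp n N k ψ fun _ => a := by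
  induction K with
  | zero => omega
  | succ K ih =>
    set T := jetComp n N K ψ - iterCovDeriv G (jetPoly G z ψ K) K z with hT
    set p : CSpace n → ℝ := fun y => (1 / K.factorial : ℝ) * T fun _ => y - z with hp
    have h0 : jetPoly G z ψ (K + 1) = fun y => jetPoly G z ψ K y + p y := rfl
    have hv : VanishesTo K p z := by
      have := vanishesTo_homogeneous (j := 0) (k := K) (T := fun _ : CSpace n => T) (z := z)
        (VanishesTo.of_smooth contDiffAt_const)
      rw [zero_add] at this
      exact this.clm_comp ((1 / K.factorial : ℝ) • ContinuousLinearMap.id ℝ ℝ)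
    have hadd := (iterCovDeriv_add hG (contDiffAt_jetPoly (k := K) hG ψ z) hv.smooth k).self_of_nhds
    rw [h0, hadd, _root_.add_apply]
    rcases Nat.lt_succ_iff_lt_or_eq.1 hk with h | rfl
    · rw [hv.iterCovDeriv_eq_zero hG h, ih h]
      simp
    · rw [hv.iterCovDeriv_eq hG]
      have h1 : iteratedFDeriv ℝ k p z (fun _ => a) = T fun _ => a := by
        have h2 : p = ((1 / k.factorial : ℝ) • ContinuousLinearMap.id ℝ ℝ) ∘ fun y => T fun _ => y - z := by
          funext y
          simp [hp]
        have h3 : ContDiffAt ℝ ∞ (fun y => T fun _ => y - z) z :=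
          contDiffAt_apply_diagonal contDiffAt_const (contDiffAt_id.sub contDiffAt_const)
        rw [h2, ContinuousLinearMap.iteratedFDeriv_comp_left _ h3 ENat.LEInfty.out,
          ContinuousLinearMap.compContinuousMultilinearMap_coe, Function.comp_apply,
          iteratedFDeriv_comp_sub k (f := fun y => T fun _ => y) (a := z),
          T.iteratedFDeriv_comp_diagonal]
        simp [Fintype.card_perm, Nat.factorial_ne_zero]
      rw [h1, hT]
      simp

end Jets

/-! ### The Chern scalar curvature as a trace -/

section Chern

open Filter Topology

variable {n : ℕ} {X E ι : Type*} [NormedAddCommGroup E] [NormedSpace ℝ E] [Fintype ι] [DecidableEq ι]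

/-- Jacobi's formula. -/
theorem hasFDerivAt_matrix_det {M : E → Matrix ι ι ℂ} {M' : ι → ι → E →L[ℝ] ℂ} {z : E}
    (h : ∀ i j, HasFDerivAt (fun y => M y i j) (M' i j) z) :
    HasFDerivAt (fun y => (M y).det) (∑ i, ∑ k, (M z).adjugate i k • M' k i) z := by
  have h1 : HasFDerivAt (fun y => ∑ σ : Equiv.Perm ι, (((Equiv.Perm.sign σ : ℤ) : ℂ)) * ∏ i, M y (σ i) i)
      (∑ σ : Equiv.Perm ι, (((Equiv.Perm.sign σ : ℤ) : ℂ)) •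
        ∑ i, (∏ j ∈ Finset.univ.erase i, M z (σ j) j) • M' (σ i) i) z := by
    refine HasFDerivAt.fun_sum fun σ _ => HasFDerivAt.const_mul ?_ _
    exact HasFDerivAt.finsetProd fun i _ => h (σ i) i
  have h2 : (fun y => (M y).det) = fun y => ∑ σ : Equiv.Perm ι, (((Equiv.Perm.sign σ : ℤ) : ℂ)) * ∏ i, M y (σ i) i := by
    funext y
    rw [Matrix.det_apply']
  rw [h2]
  convert! h1 using 1
  ext a
  simp only [sum_apply, smul_apply, smul_eq_mul]
  have h3 : ∀ i, ∑ k, (M z).adjugate i k * M' k i a = ((M z).updateCol i fun k => M' k i a).det := by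
    intro i
    rw [← Matrix.cramer_apply, Matrix.cramer_eq_adjugate_mulVec]
    rfl
  simp only [h3, Matrix.det_apply', Finset.mul_sum]
  rw [Finset.sum_comm]
  refine Finset.sum_congr rfl fun σ _ => Finset.sum_congr rfl fun i _ => ?_
  rw [← Finset.mul_prod_erase Finset.univ _ (Finset.mem_univ i)]
  congr 1
  rw [mul_comm]
  congr 1
  · refine Finset.prod_congr rfl fun j hj => ?_
    rw [Matrix.updateCol_ne (Finset.ne_of_mem_erase hj)]
  · simp

theorem contDiffAt_matrix_det {N : ℕ∞ω} {M : E → Matrix ι ι ℂ} {z : E}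
    (h : ∀ i j, ContDiffAt ℝ N (fun y => M y i j) z) : ContDiffAt ℝ N (fun y => (M y).det) z := by
  simp only [Matrix.det_apply']
  exact ContDiffAt.sum fun σ _ => contDiffAt_const.mul (contDiffAt_prod fun i _ => h _ _)

theorem contDiffAt_matrix_adjugate {N : ℕ∞ω} {M : E → Matrix ι ι ℂ} {z : E}
    (h : ∀ i j, ContDiffAt ℝ N (fun y => M y i j) z) (i j : ι) :
    ContDiffAt ℝ N (fun y => (M y).adjugate i j) z := by
  simp only [Matrix.adjugate_apply]
  refine contDiffAt_matrix_det fun k l => ?_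
  rcases eq_or_ne k j with rfl | hk
  · simpa using contDiffAt_const
  · simpa [Matrix.updateRow_ne hk] using h k l

theorem contDiffAt_matrix_inv {N : ℕ∞ω} {M : E → Matrix ι ι ℂ} {z : E}
    (h : ∀ i j, ContDiffAt ℝ N (fun y => M y i j) z) (hd : (M z).det ≠ 0) (i j : ι) :
    ContDiffAt ℝ N (fun y => (M y)⁻¹ i j) z := by
  simp only [Matrix.inv_def, Ring.inverse_eq_inv', Matrix.smul_apply, smul_eq_mul]
  exact ((contDiffAt_matrix_det h).inv hd).mul (contDiffAt_matrix_adjugate h i j)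

/-- The sesquilinear part `L(u, w) + L(iu, iw) + i (L(iu, w) - L(u, iw))` of a real bilinear form. -/
def sesq (L : RealBilin n) (u w : CSpace n) : ℂ :=
  (L u w + L (complexJ n u) (complexJ n w) : ℝ) + Complex.I * (L (complexJ n u) w - L u (complexJ n w) : ℝ)

theorem sesq_add_left (L : RealBilin n) (u u' w : CSpace n) : sesq L (u + u') w = sesq L u w + sesq L u' w := by
  simp [sesq]; ring

theorem sesq_add_right (L : RealBilin n) (u w w' : CSpace n) : sesq L u (w + w') = sesq L u w + sesq L u w' := by
  simp [sesq]; ring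

theorem complex_smul_eq (c : ℂ) (u : CSpace n) : c • u = c.re • u + c.im • complexJ n u := by
  rw [complexJ_apply]
  ext i
  simp only [PiLp.smul_apply, PiLp.add_apply, smul_eq_mul, Complex.real_smul]
  nth_rewrite 1 [← Complex.re_add_im c]
  ring

theorem sesq_smul_left (L : RealBilin n) (c : ℂ) (u w : CSpace n) :
    sesq L (c • u) w = star c * sesq L u w := by
  apply Complex.ext <;> rw [complex_smul_eq] <;> simp [sesq, complexJ_complexJ] <;> ring

theorem sesq_smul_right (L : RealBilin n) (c : ℂ) (u w : CSpace n) :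
    sesq L u (c • w) = c * sesq L u w := by
  apply Complex.ext <;> rw [complex_smul_eq] <;> simp [sesq, complexJ_complexJ] <;> ring

theorem sesq_sum_left {κ : Type*} (s : Finset κ) (L : RealBilin n) (u : κ → CSpace n) (w : CSpace n) :
    sesq L (∑ i ∈ s, u i) w = ∑ i ∈ s, sesq L (u i) w := by
  induction s using Finset.cons_induction with
  | empty => simp [sesq]
  | cons a s ha ih => rw [Finset.sum_cons, Finset.sum_cons, sesq_add_left, ih]

theorem sesq_sum_right {κ : Type*} (s : Finset κ) (L : RealBilin n) (u : CSpace n) (w : κ → CSpace n) :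
    sesq L u (∑ i ∈ s, w i) = ∑ i ∈ s, sesq L u (w i) := by
  induction s using Finset.cons_induction with
  | empty => simp [sesq]
  | cons a s ha ih => rw [Finset.sum_cons, Finset.sum_cons, sesq_add_right, ih]

/-- The matrix of the sesquilinear part. -/
def sesqMatrix (L : RealBilin n) : Matrix (Fin n) (Fin n) ℂ :=
  Matrix.of fun r s => sesq L (coordVec r) (coordVec s)

/-- The functional `L ↦ ∑ M^{j̄ i} L(∂_{j̄}, ∂_i)`. -/
def chernTrace (M : Matrix (Fin n) (Fin n) ℂ) : RealBilin n →L[ℝ] ℝ :=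
  LinearMap.toContinuousLinearMap
    { toFun := fun L => (1 / 4) * ((M⁻¹).transpose * sesqMatrix L).trace.re
      map_add' := fun L L' => by
        have : sesqMatrix (L + L') = sesqMatrix L + sesqMatrix L' := by
          ext i j; simp [sesqMatrix, sesq]; ring
        rw [this, mul_add, Matrix.trace_add, Complex.add_re, mul_add]
      map_smul' := fun c L => by
        have : sesqMatrix (c • L) = (c : ℂ) • sesqMatrix L := by
          ext i j; simp [sesqMatrix, sesq]; ring
        rw [this, Matrix.mul_smul, Matrix.trace_smul, smul_eq_mul, Complex.re_ofReal_mul]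
        simp only [RingHom.id_apply, smul_eq_mul]
        ring }

theorem chernTrace_apply (M : Matrix (Fin n) (Fin n) ℂ) (L : RealBilin n) :
    chernTrace M L = (1 / 4) * ((M⁻¹).transpose * sesqMatrix L).trace.re := rfl

theorem chernTrace_compJ (M : Matrix (Fin n) (Fin n) ℂ) (L : RealBilin n) :
    chernTrace M (L.bilinearComp (complexJ n) (complexJ n)) = chernTrace M L := by
  have : sesqMatrix (L.bilinearComp (complexJ n) (complexJ n)) = sesqMatrix L := by
    ext i j
    simp [sesqMatrix, sesq, complexJ_complexJ]
    ring
  rw [chernTrace_apply, this, chernTrace_apply]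

/-- The functional `chernTrace` vanishes on the second derivatives of pluriharmonic functions. -/
theorem chernTrace_eq_zero (M : Matrix (Fin n) (Fin n) ℂ) {L : RealBilin n}
    (h : ∀ u w, L (complexJ n u) (complexJ n w) = -L u w) : chernTrace M L = 0 := by
  have h1 : L.bilinearComp (complexJ n) (complexJ n) = -L := by
    ext u w
    simpa using h u w
  have h2 := chernTrace_compJ M L
  rw [h1, map_neg] at h2
  linarith

theorem sesqMatrix_comp {A : CSpace n →L[ℝ] CSpace n} (hA : ∀ u, A (complexJ n u) = complexJ n (A u))
    (L : RealBilin n) :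
    sesqMatrix (L.bilinearComp A A) = (complexMatrix A).conjTranspose * sesqMatrix L * complexMatrix A := by
  have h1 : ∀ u w, sesq (L.bilinearComp A A) u w = sesq L (A u) (A w) := by
    intro u w
    simp [sesq, hA]
  have h2 : ∀ r, A (coordVec r) = ∑ s, complexMatrix A s r • coordVec s := by
    intro r
    conv_lhs => rw [← sum_smul_coordVec (A (coordVec r))]
    rfl
  ext r s
  simp only [sesqMatrix, Matrix.of_apply, h1, h2, sesq_sum_left, sesq_sum_right, sesq_smul_left,
    sesq_smul_right, Matrix.mul_apply, Matrix.conjTranspose_apply, Finset.sum_mul]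
  refine Finset.sum_congr rfl fun i _ => ?_
  rw [Finset.mul_sum]
  refine Finset.sum_congr rfl fun j _ => ?_
  ring

/-- Naturality of `chernTrace` under complex linear isomorphisms. -/
theorem chernTrace_comp {A : CSpace n →L[ℝ] CSpace n} (hA : ∀ u, A (complexJ n u) = complexJ n (A u))
    (hdet : (complexMatrix A).det ≠ 0) (M : Matrix (Fin n) (Fin n) ℂ) (L : RealBilin n) :
    chernTrace ((complexMatrix A).transpose * M * (complexMatrix A).map star) (L.bilinearComp A A) =
      chernTrace M L := by
  set a := complexMatrix A with ha
  have hu : IsUnit a.det := isUnit_iff_ne_zero.2 hdet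
  have hu' : IsUnit a.conjTranspose.det := by
    rw [Matrix.det_conjTranspose]
    exact hu.star
  have h1 : ((a.transpose * M * a.map star)⁻¹).transpose =
      a⁻¹ * (M⁻¹).transpose * (a.conjTranspose)⁻¹ := by
    have h2 : a.map star = a.conjTranspose.transpose := rfl
    rw [Matrix.mul_inv_rev, Matrix.mul_inv_rev, Matrix.transpose_mul, Matrix.transpose_mul, h2,
      Matrix.transpose_nonsing_inv, Matrix.transpose_nonsing_inv, Matrix.transpose_nonsing_inv,
      Matrix.transpose_transpose, Matrix.transpose_transpose, Matrix.mul_assoc]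
  rw [chernTrace_apply, sesqMatrix_comp hA, h1, chernTrace_apply]
  congr 2
  have e : a⁻¹ * M⁻¹.transpose * a.conjTranspose⁻¹ * (a.conjTranspose * sesqMatrix L * a) =
      a⁻¹ * (M⁻¹.transpose * sesqMatrix L * a) := by
    calc _ = a⁻¹ * M⁻¹.transpose * (a.conjTranspose⁻¹ * a.conjTranspose) * sesqMatrix L * a := by
          simp only [Matrix.mul_assoc]
      _ = _ := by
          rw [Matrix.nonsing_inv_mul _ hu', Matrix.mul_one]
          simp only [Matrix.mul_assoc]
  rw [e, Matrix.trace_mul_comm, Matrix.mul_assoc, Matrix.mul_nonsing_inv _ hu, Matrix.mul_one]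

open scoped ComplexOrder Matrix in
theorem chernTrace_pos {M : Matrix (Fin n) (Fin n) ℂ} (hM : M.PosDef) {ξ : Covec n} (hξ : ξ ≠ 0) :
    0 < chernTrace M (ξ.smulRight ξ) := by
  have h1 : ((M⁻¹).transpose * sesqMatrix (ξ.smulRight ξ)).trace =
      star (covecCoord ξ) ⬝ᵥ (M⁻¹ *ᵥ covecCoord ξ) := by
    simp only [Matrix.trace, Matrix.diag, Matrix.mul_apply, Matrix.transpose_apply, dotProduct,
      Matrix.mulVec, Finset.mul_sum, Pi.star_apply]
    rw [Finset.sum_comm]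
    refine Finset.sum_congr rfl fun j _ => Finset.sum_congr rfl fun i _ => ?_
    have : sesqMatrix (ξ.smulRight ξ) j i = star (covecCoord ξ j) * covecCoord ξ i := by
      simp only [sesqMatrix, sesq, covecCoord, Matrix.of_apply, ContinuousLinearMap.smulRight_apply,
        smul_apply, smul_eq_mul]
      apply Complex.ext
      · simp
      · simp
        ring
    rw [this]
    ring
  have h2 : covecCoord ξ ≠ 0 := by
    intro h
    apply hξ
    rw [eq_sum_covecCoord ξ, h]
    simp
  have h3 := (Complex.pos_iff.1 ((Matrix.posDef_iff_dotProduct_mulVec.1 hM.inv).2 h2)).1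
  rw [chernTrace_apply, h1]
  linarith

theorem contDiffAt_hermMatrix {N : ℕ∞ω} {H : E → RealBilin n} {z : E} (hH : ContDiffAt ℝ N H z)
    (r s : Fin n) : ContDiffAt ℝ N (fun y => hermMatrix (H y) r s) z := by
  have h : ∀ u w : CSpace n, ContDiffAt ℝ N (fun y => ((H y u w : ℝ) : ℂ)) z := fun u w =>
    Complex.ofRealCLM.contDiff.contDiffAt.comp z ((hH.clm_apply contDiffAt_const).clm_apply contDiffAt_const)
  exact contDiffAt_const.mul ((h _ _).add (contDiffAt_const.mul (h _ _)))

/-- The Chern scalar curvature is the trace of the complex Hessian of `-log det`. -/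
theorem chernScalarLocal_eq {H : CSpace n → RealBilin n} {z : CSpace n} (hH : ContDiffAt ℝ ∞ H z)
    (hd : ∀ᶠ y in 𝓝 z, 0 < (hermMatrix (H y)).det.re ∧ ((hermMatrix (H y)).det.re : ℂ) = (hermMatrix (H y)).det) :
    chernScalarLocal H z = -chernTrace (hermMatrix (H z))
      (fderiv ℝ (fderiv ℝ fun y => Real.log (hermMatrix (H y)).det.re) z) := by
  set f : CSpace n → ℝ := fun y => Real.log (hermMatrix (H y)).det.re with hf
  have hM : ∀ r s, ContDiffAt ℝ ∞ (fun y => hermMatrix (H y) r s) z := contDiffAt_hermMatrix hH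
  have hdet0 : (hermMatrix (H z)).det ≠ 0 := fun h => by
    have := hd.self_of_nhds.1
    rw [h] at this
    simp at this
  have hfs : ContDiffAt ℝ ∞ f z :=
    (Complex.reCLM.contDiff.contDiffAt.comp z (contDiffAt_matrix_det hM)).log hd.self_of_nhds.1.ne'
  -- the derivative of the logarithm of the determinant
  have hder : ∀ᶠ y in 𝓝 z, ∀ a, (fderiv ℝ f y a : ℂ) =
      ∑ k, ∑ q, fderiv ℝ (fun y => hermMatrix (H y) k q) y a * (hermMatrix (H y))⁻¹ q k := by
    filter_upwards [hd.eventually_nhds, contDiffAt_infty_eventually hH 1] with y hy hHy a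
    have h1 : ∀ r s, HasFDerivAt (fun y => hermMatrix (H y) r s)
        (fderiv ℝ (fun y => hermMatrix (H y) r s) y) y := fun r s =>
      ((contDiffAt_hermMatrix hHy r s).differentiableAt (by norm_num)).hasFDerivAt
    have h2 := hasFDerivAt_matrix_det h1
    set D : CSpace n →L[ℝ] ℂ := ∑ i, ∑ k, (hermMatrix (H y)).adjugate i k •
      fderiv ℝ (fun y => hermMatrix (H y) k i) y with hD
    have h3 : HasFDerivAt (fun y => (hermMatrix (H y)).det.re) _ y := Complex.reCLM.hasFDerivAt.comp y h2
    have h4 := h3.log hy.self_of_nhds.1.ne'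
    have h5 : (fun y => (((hermMatrix (H y)).det.re : ℝ) : ℂ)) =ᶠ[𝓝 y] fun y => (hermMatrix (H y)).det :=
      hy.mono fun x hx => hx.2
    have h6 : HasFDerivAt (fun y => (((hermMatrix (H y)).det.re : ℝ) : ℂ)) _ y :=
      Complex.ofRealCLM.hasFDerivAt.comp y h3
    have h7 : ((D a).re : ℂ) = D a :=
      congrArg (fun L : CSpace n →L[ℝ] ℂ => L a) (h6.unique (h2.congr_of_eventuallyEq h5))
    have h8 : fderiv ℝ f y a = (hermMatrix (H y)).det.re⁻¹ * (D a).re :=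
      congrArg (fun L : CSpace n →L[ℝ] ℝ => L a) h4.fderiv
    rw [h8, Complex.ofReal_mul, h7, Complex.ofReal_inv, hy.self_of_nhds.2, hD]
    simp only [sum_apply, smul_apply, smul_eq_mul, Matrix.inv_def, Ring.inverse_eq_inv',
      Matrix.smul_apply, Finset.mul_sum]
    rw [Finset.sum_comm]
    refine Finset.sum_congr rfl fun i _ => Finset.sum_congr rfl fun k _ => ?_
    ring
-- the trace of the Chern connection is `∂ log det`
  have hgam : ∀ i, (fun y => ∑ k, chernGamma H i k k y) =ᶠ[𝓝 z] fun y =>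
      (1 / 2) * ((fderiv ℝ f y (coordVec i) : ℂ) - Complex.I * (fderiv ℝ f y (complexJ n (coordVec i)) : ℂ)) := by
    intro i
    filter_upwards [hder] with y hy
    simp only [chernGamma, wirt, hy]
    simp only [Finset.mul_sum, ← Finset.sum_sub_distrib]
    refine Finset.sum_congr rfl fun k _ => Finset.sum_congr rfl fun q _ => ?_
    ring
  have hgs : ∀ i k, ContDiffAt ℝ ∞ (chernGamma H i k k) z := by
    intro i k
    refine ContDiffAt.sum fun q _ => ?_
    have h1 : ContDiffAt ℝ ∞ (fderiv ℝ fun y => hermMatrix (H y) k q) z := (hM k q).fderiv_right le_rfl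
    exact (contDiffAt_const.mul ((h1.clm_apply contDiffAt_const).sub
      (contDiffAt_const.mul (h1.clm_apply contDiffAt_const)))).mul (contDiffAt_matrix_inv hM hdet0 q k)
  set L := fderiv ℝ (fderiv ℝ f) z with hL
-- the trace of the curvature is `-∂∂̄ log det`
  have hcurv : ∀ i j, ∑ k, chernCurv H i j k k z = -((1 / 4) * sesq L (coordVec j) (coordVec i)) := by
    intro i j
    have h1 : ∑ k, chernCurv H i j k k z = -wirtBar j (fun y => ∑ k, chernGamma H i k k y) z := by
      simp only [chernCurv, wirtBar]
      rw [fderiv_fun_sum fun k _ => (hgs i k).differentiableAt (by simp)]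
      simp only [sum_apply, Finset.sum_neg_distrib, Finset.mul_sum, ← Finset.sum_add_distrib]
    have hfd : DifferentiableAt ℝ (fderiv ℝ f) z :=
      (hfs.fderiv_right (m := ∞) le_rfl).differentiableAt (by simp)
    have h2 : ∀ u, HasFDerivAt (fun y => (fderiv ℝ f y u : ℂ))
        (Complex.ofRealCLM ∘L (ContinuousLinearMap.apply ℝ ℝ u) ∘L L) z := fun u =>
      Complex.ofRealCLM.hasFDerivAt.comp z
        ((ContinuousLinearMap.apply ℝ ℝ u).hasFDerivAt.comp z hfd.hasFDerivAt)
    have h3 := ((h2 (coordVec i)).sub ((h2 (complexJ n (coordVec i))).const_mul Complex.I)).const_mul (1 / 2 : ℂ)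
    rw [h1, wirtBar, (hgam i).fderiv_eq]
    erw [h3.fderiv]
    simp only [smul_apply, sub_apply, ContinuousLinearMap.comp_apply, ContinuousLinearMap.apply_apply,
      Complex.ofRealCLM_apply, smul_eq_mul, sesq]
    push_cast
    linear_combination (1 / 4 : ℂ) * (L (complexJ n (coordVec j)) (complexJ n (coordVec i)) : ℂ) * Complex.I_sq
  rw [chernScalarLocal, chernTrace_apply]
  have h1 : ∑ i, ∑ j, ∑ k, (hermMatrix (H z))⁻¹ j i * chernCurv H i j k k z =
      ((-(1 / 4) : ℝ) : ℂ) * ((hermMatrix (H z))⁻¹.transpose * sesqMatrix L).trace := by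
    simp only [← Finset.mul_sum, hcurv, Matrix.trace, Matrix.diag, Matrix.mul_apply, Matrix.transpose_apply,
      sesqMatrix, Matrix.of_apply]
    push_cast
    rw [Finset.mul_sum]
    refine Finset.sum_congr rfl fun i _ => ?_
    rw [Finset.mul_sum]
    refine Finset.sum_congr rfl fun j _ => ?_
    ring
  rw [h1, Complex.re_ofReal_mul]
  ring

end Chern

/-! ### The Chern scalar curvature of the root of a form -/

section LogDet

open Filter Topology

variable {n p m : ℕ}

/-- The entries of `cofMatrix`, as continuous linear functionals. -/
def cofEntry (r s : Fin (p + 1)) : CForm (p + 1) (2 * p) →L[ℝ] ℂ :=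
  let F : Covec (p + 1) → Covec (p + 1) → CForm (p + 1) (2 * p) →L[ℝ] ℝ := fun ξ η =>
    Complex.reCLM ∘L (ContinuousAlternatingMap.apply ℝ (CSpace (p + 1)) ℂ (stdFrame (p + 1))) ∘L
      (ContinuousLinearMap.apply ℝ (CForm (p + 1) (2 * p + 1 + 1)) (leviBilin (p + 1) ξ η)) ∘L
        wedgeTwoL (p + 1) (2 * p)
  Complex.ofRealCLM ∘L F (dx r) (dx s) + Complex.I • (Complex.ofRealCLM ∘L F (dx r) (dx s ∘L complexJ (p + 1)))

theorem cofEntry_apply (r s : Fin (p + 1)) (Φ : CForm (p + 1) (2 * p)) : cofEntry r s Φ = cofMatrix Φ r s := rfl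

theorem cofMatrix_smul (c : ℝ) (Φ : CForm (p + 1) (2 * p)) : cofMatrix (c • Φ) = (c : ℂ) • cofMatrix Φ := by
  ext r s
  simp only [← cofEntry_apply, map_smul, Matrix.smul_apply, Complex.real_smul, smul_eq_mul]

theorem contDiffAt_cofMatrix {X : Type*} [NormedAddCommGroup X] [NormedSpace ℝ X] {N : ℕ∞ω}
    {Φ : X → CForm (p + 1) (2 * p)} {x : X} (hΦ : ContDiffAt ℝ N Φ x) (r s : Fin (p + 1)) :
    ContDiffAt ℝ N (fun y => cofMatrix (Φ y) r s) x :=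
  (cofEntry r s).contDiff.contDiffAt.comp x hΦ

theorem cofMatrix_det_re (Φ : CForm (p + 1) (2 * p)) : ((cofMatrix Φ).det.re : ℂ) = (cofMatrix Φ).det :=
  det_re_eq (cofMatrix_isHermitian Φ)

theorem cofMatrix_det_ne_zero {Φ : CForm (p + 1) (2 * p)} (h : 0 < (cofMatrix Φ).det.re) :
    (cofMatrix Φ).det ≠ 0 := fun h0 => by
  rw [h0] at h
  simp at h

/-- The logarithm of the determinant of the metric `ω` with `ω^p = Φ`, up to an additive constant. -/
def logDet (Φ : CForm (p + 1) (2 * p)) : ℝ := (1 / p : ℝ) * Real.log (cofMatrix Φ).det.re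

theorem contDiffAt_logDet {Φ : CForm (p + 1) (2 * p)} (h : 0 < (cofMatrix Φ).det.re) :
    ContDiffAt ℝ ∞ logDet Φ := by
  have h1 : ContDiffAt ℝ ∞ (fun Φ : CForm (p + 1) (2 * p) => (cofMatrix Φ).det.re) Φ :=
    Complex.reCLM.contDiff.contDiffAt.comp Φ (contDiffAt_matrix_det (contDiffAt_cofMatrix contDiffAt_id))
  exact contDiffAt_const.mul (h1.log h.ne')

theorem fderiv_logDet {Φ : CForm (p + 1) (2 * p)} (h : 0 < (cofMatrix Φ).det.re)
    (Ψ : CForm (p + 1) (2 * p)) :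
    fderiv ℝ logDet Φ Ψ = (1 / p : ℝ) * ((cofMatrix Φ)⁻¹ * cofMatrix Ψ).trace.re := by
  have h1 : ∀ r s, HasFDerivAt (fun Φ : CForm (p + 1) (2 * p) => cofMatrix Φ r s) (cofEntry r s) Φ :=
    fun r s => (cofEntry r s).hasFDerivAt
  have h2 := hasFDerivAt_matrix_det h1
  set D : CForm (p + 1) (2 * p) →L[ℝ] ℂ := ∑ i, ∑ k, (cofMatrix Φ).adjugate i k • cofEntry k i with hD
  have h3 : HasFDerivAt (fun Φ : CForm (p + 1) (2 * p) => (cofMatrix Φ).det.re) (Complex.reCLM ∘L D) Φ :=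
    Complex.reCLM.hasFDerivAt.comp Φ h2
  have h4 := (h3.log h.ne').const_mul (1 / p : ℝ)
  have h5 : fderiv ℝ logDet Φ Ψ = (1 / p : ℝ) * ((cofMatrix Φ).det.re⁻¹ * (D Ψ).re) :=
    congrArg (fun L : CForm (p + 1) (2 * p) →L[ℝ] ℝ => L Ψ) h4.fderiv
  rw [h5]
  congr 1
  rw [← Complex.re_ofReal_mul, Complex.ofReal_inv, cofMatrix_det_re]
  congr 1
  simp only [hD, sum_apply, smul_apply, cofEntry_apply, smul_eq_mul, Matrix.trace, Matrix.diag, Matrix.mul_apply,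
    Matrix.inv_def, Ring.inverse_eq_inv', Matrix.smul_apply, Finset.mul_sum]
  refine Finset.sum_congr rfl fun i _ => Finset.sum_congr rfl fun k _ => ?_
  ring

/-- The determinant of `rootMatrix P` is a constant multiple of the `p`-th root of the determinant of `P`. -/
theorem log_det_rootMatrix (hp : p ≠ 0) {P : Matrix (Fin (p + 1)) (Fin (p + 1)) ℂ} (hP : P.IsHermitian)
    (hd : 0 < P.det.re) :
    0 < (rootMatrix P).det.re ∧ ((rootMatrix P).det.re : ℂ) = (rootMatrix P).det ∧
    Real.log (rootMatrix P).det.re =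
      (p + 1) * (Real.log (1 / 2 * p.factorial) - (p + 1) / p * Real.log p.factorial) +
        (1 / p : ℝ) * Real.log P.det.re := by
  have hdr := det_re_eq hP
  set D := P.det.re with hD
  set c : ℝ := 1 / 2 * (p.factorial * (D / p.factorial ^ (p + 1)) ^ ((1 : ℝ) / p)) with hc
  have hf : (0 : ℝ) < p.factorial := by positivity
  have hc0 : 0 < c := by positivity
  have h1 : (rootMatrix P).det = ((c ^ (p + 1) * D⁻¹ : ℝ) : ℂ) := by
    rw [rootMatrix, ← hD, ← hc, Matrix.det_smul, Matrix.det_nonsing_inv, Matrix.det_transpose, Fintype.card_fin,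
      Ring.inverse_eq_inv', ← hdr]
    push_cast
    ring
  rw [h1, Complex.ofReal_re]
  refine ⟨by positivity, rfl, ?_⟩
  have h2 : Real.log c = Real.log (1 / 2 * p.factorial) + (1 / p : ℝ) * (Real.log D - (p + 1) * Real.log p.factorial) := by
    rw [hc, ← mul_assoc, Real.log_mul (by positivity) (by positivity), Real.log_rpow (by positivity),
      Real.log_div hd.ne' (by positivity), Real.log_pow]
    push_cast
    ring
  rw [Real.log_mul (by positivity) (by positivity), Real.log_pow, Real.log_inv, h2]
  have : (p : ℝ) ≠ 0 := by exact_mod_cast hp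
  push_cast
  field_simp
  ring

theorem contDiffAt_rootMatrix {X : Type*} [NormedAddCommGroup X] [NormedSpace ℝ X]
    {P : X → Matrix (Fin (p + 1)) (Fin (p + 1)) ℂ} {x : X} (hP : ∀ r s, ContDiffAt ℝ ∞ (fun y => P y r s) x)
    (hd : 0 < (P x).det.re) (r s : Fin (p + 1)) : ContDiffAt ℝ ∞ (fun y => rootMatrix (P y) r s) x := by
  have h1 : ContDiffAt ℝ ∞ (fun y => (P y).det.re) x :=
    Complex.reCLM.contDiff.contDiffAt.comp x (contDiffAt_matrix_det hP)
  have h2 : ContDiffAt ℝ ∞ (fun y => 1 / 2 * (p.factorial * ((P y).det.re / p.factorial ^ (p + 1)) ^ ((1 : ℝ) / p))) x := by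
    refine contDiffAt_const.mul (contDiffAt_const.mul ?_)
    refine ContDiffAt.rpow_const_of_ne (h1.div_const _) ?_
    positivity
  have h3 : ∀ r s, ContDiffAt ℝ ∞ (fun y => (P y).transpose⁻¹ r s) x :=
    contDiffAt_matrix_inv (fun r s => hP s r) (by
      rw [Matrix.det_transpose]
      intro h0
      rw [h0] at hd
      simp at hd)
  exact (Complex.ofRealCLM.contDiff.contDiffAt.comp x h2).mul (h3 r s)

theorem contDiffAt_rootForm {X : Type*} [NormedAddCommGroup X] [NormedSpace ℝ X]
    {Φ : X → CForm (p + 1) (2 * p)} {x : X} (hΦ : ContDiffAt ℝ ∞ Φ x) (hd : 0 < (cofMatrix (Φ x)).det.re) :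
    ContDiffAt ℝ ∞ (fun y => rootForm (Φ y)) x := by
  have h : ∀ r s, ContDiffAt ℝ ∞ (fun y => rootMatrix (cofMatrix (Φ y)) r s) x :=
    contDiffAt_rootMatrix (contDiffAt_cofMatrix hΦ) hd
  have hre : ∀ r s, ContDiffAt ℝ ∞ (fun y => (rootMatrix (cofMatrix (Φ y)) r s).re) x := fun r s =>
    Complex.reCLM.contDiff.contDiffAt.comp x (h r s)
  have him : ∀ r s, ContDiffAt ℝ ∞ (fun y => (rootMatrix (cofMatrix (Φ y)) r s).im) x := fun r s =>
    Complex.imCLM.contDiff.contDiffAt.comp x (h r s)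
  simp only [rootForm, matrixBilin]
  exact ContDiffAt.sum fun r _ => ContDiffAt.sum fun s _ =>
    ((hre r s).smul contDiffAt_const).add ((him r s).smul contDiffAt_const)

/-- The Chern scalar curvature of the metric `ω` with `ω^p = Φ`, see `chernScalarLocal_rootForm`. -/
def rootScalar (Φ : CSpace (p + 1) → CForm (p + 1) (2 * p)) (z : CSpace (p + 1)) : ℝ :=
  -chernTrace (rootMatrix (cofMatrix (Φ z))) (fderiv ℝ (fderiv ℝ fun y => logDet (Φ y)) z)

theorem eventually_det_pos {X : Type*} [NormedAddCommGroup X] [NormedSpace ℝ X]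
    {Φ : X → CForm (p + 1) (2 * p)} {x : X} (hΦ : ContDiffAt ℝ ∞ Φ x) (hd : 0 < (cofMatrix (Φ x)).det.re) :
    ∀ᶠ y in 𝓝 x, 0 < (cofMatrix (Φ y)).det.re := by
  have h1 : ContDiffAt ℝ ∞ (fun y => (cofMatrix (Φ y)).det.re) x :=
    Complex.reCLM.contDiff.contDiffAt.comp x (contDiffAt_matrix_det (contDiffAt_cofMatrix hΦ))
  exact h1.continuousAt.eventually (lt_mem_nhds hd)

theorem chernScalarLocal_rootForm (hp : p ≠ 0) {Φ : CSpace (p + 1) → CForm (p + 1) (2 * p)} {z : CSpace (p + 1)}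
    (hΦ : ContDiffAt ℝ ∞ Φ z) (hd : 0 < (cofMatrix (Φ z)).det.re) :
    chernScalarLocal (fun y => rootForm (Φ y)) z = rootScalar Φ z := by
  have h1 := eventually_det_pos hΦ hd
  rw [chernScalarLocal_eq (contDiffAt_rootForm hΦ hd)]
  · rw [rootScalar, hermMatrix_rootForm]
    have h2 : (fun y => Real.log (hermMatrix (rootForm (Φ y))).det.re) =ᶠ[𝓝 z] fun y =>
        ((p + 1) * (Real.log (1 / 2 * p.factorial) - (p + 1) / p * Real.log p.factorial)) + logDet (Φ y) := by
      filter_upwards [h1] with y hy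
      rw [hermMatrix_rootForm, (log_det_rootMatrix hp (cofMatrix_isHermitian _) hy).2.2, logDet]
    have h3 : ∀ c : ℝ, fderiv ℝ (fun y => c + logDet (Φ y)) = fderiv ℝ fun y => logDet (Φ y) :=
      fun c => funext fun y => fderiv_const_add c
    rw [h2.fderiv.fderiv_eq, h3]
  · filter_upwards [h1] with y hy
    rw [hermMatrix_rootForm]
    have := log_det_rootMatrix hp (cofMatrix_isHermitian _) hy
    exact ⟨this.1, this.2.1⟩

/-- The chain rule for second derivatives. -/
theorem fderiv_fderiv_comp {E V W : Type*} [NormedAddCommGroup E] [NormedSpace ℝ E]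
    [NormedAddCommGroup V] [NormedSpace ℝ V] [NormedAddCommGroup W] [NormedSpace ℝ W]
    {f : V → W} {g : E → V} {z : E} (hf : ContDiffAt ℝ 2 f (g z)) (hg : ContDiffAt ℝ 2 g z) (a b : E) :
    fderiv ℝ (fderiv ℝ fun y => f (g y)) z a b =
      fderiv ℝ (fderiv ℝ f) (g z) (fderiv ℝ g z a) (fderiv ℝ g z b) +
        fderiv ℝ f (g z) (fderiv ℝ (fderiv ℝ g) z a b) := by
  have h1 : fderiv ℝ (fun y => f (g y)) =ᶠ[𝓝 z] fun y => fderiv ℝ f (g y) ∘L fderiv ℝ g y := by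
    filter_upwards [hg.continuousAt.eventually (hf.eventually (by simp)), hg.eventually (by simp)] with y h1 h2
    exact ((h1.differentiableAt (by norm_num)).hasFDerivAt.comp y
      (h2.differentiableAt (by norm_num)).hasFDerivAt).fderiv
  have h2 : HasFDerivAt (fun y => fderiv ℝ f (g y)) (fderiv ℝ (fderiv ℝ f) (g z) ∘L fderiv ℝ g z) z :=
    ((hf.fderiv_right (m := 1) (by norm_num)).differentiableAt one_ne_zero).hasFDerivAt.comp z
      (hg.differentiableAt (by norm_num)).hasFDerivAt
  have h3 : HasFDerivAt (fderiv ℝ g) (fderiv ℝ (fderiv ℝ g) z) z :=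
    ((hg.fderiv_right (m := 1) (by norm_num)).differentiableAt one_ne_zero).hasFDerivAt
  rw [h1.fderiv_eq, (h2.clm_comp h3).fderiv]
  simp [add_comm]

/-- A perturbation that vanishes to second order changes the curvature by a linear term. -/
theorem rootScalar_add {Φ Ψ : CSpace (p + 1) → CForm (p + 1) (2 * p)} {z : CSpace (p + 1)}
    (hΦ : ContDiffAt ℝ ∞ Φ z) (hΨ : VanishesTo 2 Ψ z) (hd : 0 < (cofMatrix (Φ z)).det.re) :
    rootScalar (fun y => Φ y + Ψ y) z = rootScalar Φ z -
      chernTrace (rootMatrix (cofMatrix (Φ z)))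
        (ContinuousLinearMap.compL ℝ (CSpace (p + 1)) (CForm (p + 1) (2 * p)) ℝ (fderiv ℝ logDet (Φ z)) ∘L
          fderiv ℝ (fderiv ℝ Ψ) z) := by
  have h0 : Ψ z = 0 := hΨ.eq_zero
  have h1 : fderiv ℝ Ψ z = 0 := hΨ.fderiv.eq_zero
  have h2 := contDiffAt_logDet hd
  have hf : fderiv ℝ (fun y => Φ y + Ψ y) =ᶠ[𝓝 z] fun y => fderiv ℝ Φ y + fderiv ℝ Ψ y := by
    filter_upwards [contDiffAt_infty_eventually hΦ 1, contDiffAt_infty_eventually hΨ.smooth 1] with y h1 h2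
    exact fderiv_fun_add (h1.differentiableAt (by norm_num)) (h2.differentiableAt (by norm_num))
  have hΦ1 : ContDiffAt ℝ ∞ (fderiv ℝ Φ) z := hΦ.fderiv_right le_rfl
  have hΨ1 : ContDiffAt ℝ ∞ (fderiv ℝ Ψ) z := hΨ.smooth.fderiv_right le_rfl
  have hf2 : fderiv ℝ (fderiv ℝ fun y => Φ y + Ψ y) z = fderiv ℝ (fderiv ℝ Φ) z + fderiv ℝ (fderiv ℝ Ψ) z := by
    rw [hf.fderiv_eq]
    exact fderiv_fun_add (hΦ1.differentiableAt (by simp)) (hΨ1.differentiableAt (by simp))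
  rw [rootScalar, rootScalar, h0, add_zero, ← neg_add', ← map_add]
  congr 2
  ext a b
  rw [fderiv_fderiv_comp (f := logDet) (g := fun y => Φ y + Ψ y) (by rw [h0, add_zero]; exact h2.of_le ENat.LEInfty.out)
    ((hΦ.add hΨ.smooth).of_le ENat.LEInfty.out), hf2, hf.self_of_nhds]
  simp only [h1, h0, add_zero, add_apply, ContinuousLinearMap.comp_apply, ContinuousLinearMap.compL_apply]
  rw [fderiv_fderiv_comp (f := logDet) (h2.of_le ENat.LEInfty.out) (hΦ.of_le ENat.LEInfty.out), map_add]
  ring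

end LogDet

/-! ### Naturality of the Chern scalar curvature -/

section Naturality

open Filter Topology

variable {n p m : ℕ}

/-- The second derivative of a holomorphic map is complex bilinear. -/
theorem fderiv_fderiv_holomorphic {V : Type*} [NormedAddCommGroup V] [NormedSpace ℝ V] {h : CSpace n → V}
    {z : CSpace n} (hh : ContDiffAt ℝ 2 h z) (T : V →L[ℝ] V)
    (hJ : ∀ᶠ y in 𝓝 z, ∀ u, fderiv ℝ h y (complexJ n u) = T (fderiv ℝ h y u)) (a b : CSpace n) :
    fderiv ℝ (fderiv ℝ h) z a (complexJ n b) = T (fderiv ℝ (fderiv ℝ h) z a b) ∧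
    fderiv ℝ (fderiv ℝ h) z (complexJ n a) b = T (fderiv ℝ (fderiv ℝ h) z a b) := by
  have hd : DifferentiableAt ℝ (fderiv ℝ h) z :=
    (hh.fderiv_right (m := 1) (by norm_num)).differentiableAt one_ne_zero
  have hs : ∀ a b, fderiv ℝ (fderiv ℝ h) z a b = fderiv ℝ (fderiv ℝ h) z b a := fun a b =>
    hh.isSymmSndFDerivAt (by simp) a b
  have h1 : ∀ a b, fderiv ℝ (fderiv ℝ h) z a (complexJ n b) = T (fderiv ℝ (fderiv ℝ h) z a b) := by
    intro a b
    have e : (fun y => fderiv ℝ h y (complexJ n b)) =ᶠ[𝓝 z] fun y => T (fderiv ℝ h y b) :=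
      hJ.mono fun y hy => hy b
    have e1 := (hd.hasFDerivAt.clm_apply (hasFDerivAt_const (complexJ n b) z)).fderiv
    have e2 := (T.hasFDerivAt.comp z (hd.hasFDerivAt.clm_apply (hasFDerivAt_const b z))).fderiv
    have e3 := congrArg (fun L : CSpace n →L[ℝ] V => L a) (e1.symm.trans (e.fderiv_eq.trans e2))
    simpa using e3
  refine ⟨h1 a b, ?_⟩
  rw [hs, h1, hs]

theorem complexMatrix_det_ne_zero_of_injective {A : CSpace n →L[ℝ] CSpace n}
    (hA : ∀ u, A (complexJ n u) = complexJ n (A u)) (hi : Function.Injective A) :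
    (complexMatrix A).det ≠ 0 := by
  let e := LinearEquiv.ofInjectiveEndo (A : CSpace n →ₗ[ℝ] CSpace n) hi
  refine complexMatrix_det_ne_zero (A' := LinearMap.toContinuousLinearMap (e.symm : CSpace n →ₗ[ℝ] CSpace n)) hA fun u => ?_
  exact e.apply_symm_apply u

/-- The complex Jacobian determinant. -/
def jacobian (F : CSpace n → CSpace n) (y : CSpace n) : ℂ := (complexMatrix (fderiv ℝ F y)).det

theorem IsHolo.contDiffAt_jacobian {F : CSpace n → CSpace n} {z : CSpace n} (hF : IsHolo F z) :
    ContDiffAt ℝ ∞ (jacobian F) z := by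
  have h1 : ContDiffAt ℝ ∞ (fderiv ℝ F) z := hF.smooth.fderiv_right le_rfl
  refine contDiffAt_matrix_det fun r s => ?_
  exact ((EuclideanSpace.proj r : CSpace n →L[ℂ] ℂ).restrictScalars ℝ).contDiff.contDiffAt.comp z
    (h1.clm_apply contDiffAt_const)

/-- The Jacobian determinant of a holomorphic map is holomorphic. -/
theorem IsHolo.fderiv_jacobian {F : CSpace n → CSpace n} {z : CSpace n} (hF : IsHolo F z) :
    ∀ᶠ y in 𝓝 z, ∀ u, fderiv ℝ (jacobian F) y (complexJ n u) = Complex.I * fderiv ℝ (jacobian F) y u := by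
  filter_upwards [contDiffAt_infty_eventually hF.smooth 2, hF.commute.eventually_nhds] with y h2 hJ u
  have h2' : ContDiffAt ℝ 2 F y := h2
  have hd : DifferentiableAt ℝ (fderiv ℝ F) y :=
    (h2'.fderiv_right (m := 1) (by norm_num)).differentiableAt one_ne_zero
  have h3 : ∀ r s, HasFDerivAt (fun y => complexMatrix (fderiv ℝ F y) r s)
      (((EuclideanSpace.proj r : CSpace n →L[ℂ] ℂ).restrictScalars ℝ) ∘L
        (ContinuousLinearMap.apply ℝ (CSpace n) (coordVec s)) ∘L fderiv ℝ (fderiv ℝ F) y) y := fun r s =>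
    ((EuclideanSpace.proj r : CSpace n →L[ℂ] ℂ).restrictScalars ℝ).hasFDerivAt.comp y
      ((ContinuousLinearMap.apply ℝ (CSpace n) (coordVec s)).hasFDerivAt.comp y hd.hasFDerivAt)
  have h4 : fderiv ℝ (jacobian F) y = _ := (hasFDerivAt_matrix_det h3).fderiv
  have h5 : ∀ w, fderiv ℝ (fderiv ℝ F) y (complexJ n u) w = complexJ n (fderiv ℝ (fderiv ℝ F) y u w) :=
    fun w => (fderiv_fderiv_holomorphic h2' (complexJ n) hJ u w).2
  rw [h4]
  simp only [sum_apply, smul_apply, ContinuousLinearMap.comp_apply, ContinuousLinearMap.apply_apply, h5,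
    ContinuousLinearMap.coe_restrictScalars', smul_eq_mul, Finset.mul_sum]
  refine Finset.sum_congr rfl fun r _ => Finset.sum_congr rfl fun s _ => ?_
  rw [complexJ_apply, map_smul, smul_eq_mul]
  ring

theorem IsBiholo.jacobian_ne_zero {F : CSpace n → CSpace n} {z : CSpace n} (hF : IsBiholo F z) :
    jacobian F z ≠ 0 :=
  complexMatrix_det_ne_zero_of_injective hF.commute.self_of_nhds hF.inj.self_of_nhds

/-- The logarithm of the squared modulus of the Jacobian determinant is smooth and pluriharmonic. -/
theorem IsBiholo.log_jacobian {F : CSpace n → CSpace n} {z : CSpace n} (hF : IsBiholo F z) :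
    ContDiffAt ℝ ∞ (fun y => Real.log (Complex.normSq (jacobian F y))) z ∧
    ∀ a b, fderiv ℝ (fderiv ℝ fun y => Real.log (Complex.normSq (jacobian F y))) z (complexJ n a) (complexJ n b) =
      -fderiv ℝ (fderiv ℝ fun y => Real.log (Complex.normSq (jacobian F y))) z a b := by
  have hd := hF.toIsHolo.contDiffAt_jacobian
  have hd0 := hF.jacobian_ne_zero
  -- a local branch of the logarithm of the Jacobian determinant
  set h : CSpace n → ℂ := fun y => Complex.log (jacobian F y / jacobian F z) with hh
  have hq : ContDiffAt ℝ ∞ (fun y => jacobian F y / jacobian F z) z := hd.div_const _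
  have hq1 : jacobian F z / jacobian F z = 1 := div_self hd0
  have hslit : ∀ᶠ y in 𝓝 z, jacobian F y / jacobian F z ∈ Complex.slitPlane :=
    hq.continuousAt.eventually (by
      simp only [hq1]
      exact Complex.isOpen_slitPlane.mem_nhds Complex.one_mem_slitPlane)
  have hs : ContDiffAt ℝ ∞ h z := by
    have hl : ContDiffAt ℂ ∞ Complex.log (jacobian F z / jacobian F z) := by
      rw [hq1]; exact Complex.contDiffAt_log Complex.one_mem_slitPlane
    exact (hl.restrict_scalars ℝ).comp z hq
  have hJ : ∀ᶠ y in 𝓝 z, ∀ u, fderiv ℝ h y (complexJ n u) =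
      (Complex.I • ContinuousLinearMap.id ℝ ℂ) (fderiv ℝ h y u) := by
    filter_upwards [hslit, hF.toIsHolo.fderiv_jacobian, contDiffAt_infty_eventually hd 1] with y h1 h2 h3 u
    have h4 : HasFDerivAt (fun y => jacobian F y / jacobian F z) ((jacobian F z)⁻¹ • fderiv ℝ (jacobian F) y) y := by
      simp only [div_eq_mul_inv]
      exact (h3.differentiableAt (by norm_num)).hasFDerivAt.mul_const _
    have h5 := (Complex.hasStrictDerivAt_log h1).hasDerivAt.complexToReal_fderiv
    have h6 := (h5.comp y h4).fderiv
    have h7 : fderiv ℝ h y = _ := h6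
    rw [h7]
    simp [h2]
    ring
  have heq : (fun y => Real.log (Complex.normSq (jacobian F y))) =ᶠ[𝓝 z] fun y =>
      Real.log (Complex.normSq (jacobian F z)) + 2 * (h y).re := by
    filter_upwards [hslit] with y hy
    have h1 : jacobian F y ≠ 0 := fun h0 => by
      rw [h0, zero_div] at hy
      exact Complex.slitPlane_ne_zero hy rfl
    rw [hh, Complex.log_re, Complex.normSq_eq_norm_sq, Complex.normSq_eq_norm_sq, norm_div, Real.log_div
      (norm_ne_zero_iff.2 h1) (norm_ne_zero_iff.2 hd0), Real.log_pow, Real.log_pow]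
    push_cast
    ring
  have hs2 : ContDiffAt ℝ ∞ (fun y => Real.log (Complex.normSq (jacobian F z)) + 2 * (h y).re) z :=
    contDiffAt_const.add (contDiffAt_const.mul (Complex.reCLM.contDiff.contDiffAt.comp z hs))
  refine ⟨hs2.congr_of_eventuallyEq heq, fun a b => ?_⟩
  have h2 : ContDiffAt ℝ 2 h z := hs.of_le ENat.LEInfty.out
  have hc : ∀ c : ℝ, fderiv ℝ (fun y => c + 2 * (h y).re) = fderiv ℝ fun y => ((2 : ℝ) • Complex.reCLM) (h y) :=
    fun c => funext fun y => fderiv_const_add c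
  rw [heq.fderiv.fderiv_eq, hc, fderiv_fderiv_clm_comp _ h2, fderiv_fderiv_clm_comp _ h2,
    (fderiv_fderiv_holomorphic h2 _ hJ _ _).1, (fderiv_fderiv_holomorphic h2 _ hJ _ _).2]
  simp

theorem det_cofMatrix_comp {Φ : CForm (p + 1) (2 * p)} {A : CSpace (p + 1) →L[ℝ] CSpace (p + 1)}
    (hA : ∀ u, A (complexJ (p + 1) u) = complexJ (p + 1) (A u)) (hdet : (complexMatrix A).det ≠ 0) :
    (cofMatrix (Φ.compContinuousLinearMap A)).det.re =
      Complex.normSq (complexMatrix A).det ^ p * (cofMatrix Φ).det.re := by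
  have h := cofMatrix_comp Φ hA
  set a := complexMatrix A with ha
  set N := Complex.normSq a.det with hN
  have hN0 : 0 < N := Complex.normSq_pos.2 hdet
  have hNc : (N : ℂ) ≠ 0 := by exact_mod_cast hN0.ne'
  have h1 := congrArg Matrix.det h
  rw [Matrix.det_mul, Matrix.det_mul, Matrix.det_conjTranspose, Matrix.det_smul, Fintype.card_fin,
    mul_right_comm, Complex.star_def, Complex.mul_conj, ← hN, pow_succ, mul_comm (_ ^ p), mul_assoc] at h1
  have h2 := mul_left_cancel₀ hNc h1
  rw [h2, ← Complex.ofReal_pow, Complex.re_ofReal_mul]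

theorem logDet_comp (hp : p ≠ 0) {Φ : CForm (p + 1) (2 * p)} (hpos : 0 < (cofMatrix Φ).det.re)
    {A : CSpace (p + 1) →L[ℝ] CSpace (p + 1)}
    (hA : ∀ u, A (complexJ (p + 1) u) = complexJ (p + 1) (A u)) (hdet : (complexMatrix A).det ≠ 0) :
    logDet (Φ.compContinuousLinearMap A) = logDet Φ + Real.log (Complex.normSq (complexMatrix A).det) := by
  have hN0 : 0 < Complex.normSq (complexMatrix A).det := Complex.normSq_pos.2 hdet
  have : (p : ℝ) ≠ 0 := by exact_mod_cast hp
  rw [logDet, det_cofMatrix_comp hA hdet, Real.log_mul (by positivity) hpos.ne', Real.log_pow, logDet]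
  field_simp
  ring

theorem rootMatrix_comp (hp : p ≠ 0) {Φ : CForm (p + 1) (2 * p)} (hpos : 0 < (cofMatrix Φ).det.re)
    {A : CSpace (p + 1) →L[ℝ] CSpace (p + 1)}
    (hA : ∀ u, A (complexJ (p + 1) u) = complexJ (p + 1) (A u)) (hdet : (complexMatrix A).det ≠ 0) :
    rootMatrix (cofMatrix (Φ.compContinuousLinearMap A)) =
      (complexMatrix A).transpose * rootMatrix (cofMatrix Φ) * (complexMatrix A).map star := by
  rw [← hermMatrix_rootForm, rootForm_comp hp hpos hA hdet, rootForm, matrixBilin_comp _ hA,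
    hermMatrix_matrixBilin]

/-- The Chern scalar curvature is natural. -/
theorem rootScalar_pull (hp : p ≠ 0) {F : CSpace (p + 1) → CSpace (p + 1)} {z : CSpace (p + 1)} (hF : IsBiholo F z)
    {Φ : CSpace (p + 1) → CForm (p + 1) (2 * p)} (hΦ : ContDiffAt ℝ ∞ Φ (F z))
    (hpos : 0 < (cofMatrix (Φ (F z))).det.re) : rootScalar (pullForm F Φ) z = rootScalar Φ (F z) := by
  have hA := hF.commute.self_of_nhds
  have hdet : (complexMatrix (fderiv ℝ F z)).det ≠ 0 := hF.jacobian_ne_zero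
  have h1 : (fun y => logDet (pullForm F Φ y)) =ᶠ[𝓝 z]
      fun y => logDet (Φ (F y)) + Real.log (Complex.normSq (jacobian F y)) := by
    filter_upwards [hF.commute, hF.inj, hF.smooth.continuousAt.eventually (eventually_det_pos hΦ hpos)] with y h1 h2 h3
    exact logDet_comp hp h3 h1 (complexMatrix_det_ne_zero_of_injective h1 h2)
  obtain ⟨hj, hj2⟩ := hF.log_jacobian
  have hl : ContDiffAt ℝ ∞ (fun y => logDet (Φ y)) (F z) := (contDiffAt_logDet hpos).comp (F z) hΦ
  have hlF : ContDiffAt ℝ ∞ (fun y => logDet (Φ (F y))) z := hl.comp z hF.smooth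
  have h2 : fderiv ℝ (fun y => logDet (Φ (F y)) + Real.log (Complex.normSq (jacobian F y))) =ᶠ[𝓝 z]
      fun y => fderiv ℝ (fun y => logDet (Φ (F y))) y + fderiv ℝ (fun y => Real.log (Complex.normSq (jacobian F y))) y := by
    filter_upwards [contDiffAt_infty_eventually hlF 1, contDiffAt_infty_eventually hj 1] with y h1 h2
    exact fderiv_fun_add (h1.differentiableAt (by norm_num)) (h2.differentiableAt (by norm_num))
  have hlF1 : ContDiffAt ℝ ∞ (fderiv ℝ fun y => logDet (Φ (F y))) z := hlF.fderiv_right le_rfl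
  have hj1 : ContDiffAt ℝ ∞ (fderiv ℝ fun y => Real.log (Complex.normSq (jacobian F y))) z := hj.fderiv_right le_rfl
  rw [rootScalar, h1.fderiv.fderiv_eq, h2.fderiv_eq,
    fderiv_fun_add (hlF1.differentiableAt (by simp)) (hj1.differentiableAt (by simp)), map_add,
    chernTrace_eq_zero _ hj2, add_zero, rootScalar]
  -- the part of the second derivative that involves the second derivative of `F` does not contribute
  set ℓ : CSpace (p + 1) → ℝ := fun y => logDet (Φ y) with hℓ
  have hF2 := hF.two
  have h3 : fderiv ℝ (fderiv ℝ fun y => ℓ (F y)) z =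
      (fderiv ℝ (fderiv ℝ ℓ) (F z)).bilinearComp (fderiv ℝ F z) (fderiv ℝ F z) +
        ContinuousLinearMap.compL ℝ (CSpace (p + 1)) (CSpace (p + 1)) ℝ (fderiv ℝ ℓ (F z)) ∘L
          fderiv ℝ (fderiv ℝ F) z := by
    ext a b
    exact fderiv_fderiv_comp (hl.of_le ENat.LEInfty.out) hF2 a b
  have h4 : chernTrace (rootMatrix (cofMatrix (pullForm F Φ z))) (ContinuousLinearMap.compL ℝ (CSpace (p + 1)) (CSpace (p + 1)) ℝ (fderiv ℝ ℓ (F z)) ∘L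
          fderiv ℝ (fderiv ℝ F) z) = 0 := by
    refine chernTrace_eq_zero _ fun a b => ?_
    simp only [ContinuousLinearMap.comp_apply, ContinuousLinearMap.compL_apply]
    rw [(fderiv_fderiv_holomorphic hF2 _ hF.commute _ _).1, (fderiv_fderiv_holomorphic hF2 _ hF.commute _ _).2,
      complexJ_complexJ, map_neg]
  change -chernTrace _ (fderiv ℝ (fderiv ℝ fun y => ℓ (F y)) z) = _
  rw [h3, map_add, h4, add_zero, pullForm, rootMatrix_comp hp hpos hA hdet, chernTrace_comp hA hdet]

end Naturality

/-! ### The principal symbol and the remaining terms -/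

section Symbols

open Filter Topology

variable {n p m : ℕ}

/-- The `(2, 0)`-tensor attached to a functional on bilinear forms. -/
def contraOf (Λ : RealBilin n →L[ℝ] ℝ) : ContraTwo n :=
  ContinuousLinearMap.compL ℝ (Covec n) (RealBilin n) ℝ Λ ∘L
    ContinuousLinearMap.smulRightL ℝ (CSpace n) (Covec n)

theorem contraOf_apply (Λ : RealBilin n →L[ℝ] ℝ) (ξ η : Covec n) : contraOf Λ ξ η = Λ (ξ.smulRight η) := rfl

theorem sum_realCovec_smul_realVec (u : CSpace n) : ∑ a, realCovec a u • realVec a = u := by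
  conv_rhs => rw [← sum_smul_coordVec u]
  rw [Fintype.sum_sum_type, ← Finset.sum_add_distrib]
  refine Finset.sum_congr rfl fun r _ => ?_
  rw [complex_smul_eq]
  simp [realCovec, realVec]

theorem sum_contraOf (Λ : RealBilin n →L[ℝ] ℝ) (L : RealBilin n) :
    ∑ a, ∑ b, contraOf Λ (realCovec a) (realCovec b) * L (realVec a) (realVec b) = Λ L := by
  have h : L = ∑ a, ∑ b, L (realVec a) (realVec b) • (realCovec a).smulRight (realCovec b) := by
    refine ContinuousLinearMap.ext fun u => ContinuousLinearMap.ext fun w => ?_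
    conv_lhs => rw [← sum_realCovec_smul_realVec u, ← sum_realCovec_smul_realVec w]
    simp only [map_sum, map_smul, sum_apply, smul_apply, smul_eq_mul, ContinuousLinearMap.smulRight_apply,
      Finset.mul_sum]
    rw [Finset.sum_comm]
    refine Finset.sum_congr rfl fun a _ => Finset.sum_congr rfl fun b _ => ?_
    ring
  conv_rhs => rw [h]
  simp only [map_sum, map_smul, smul_eq_mul, contraOf_apply]
  refine Finset.sum_congr rfl fun a _ => Finset.sum_congr rfl fun b _ => mul_comm _ _

/-- The full contraction with two tensors that come from functionals on bilinear forms. -/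
theorem contract_contraOf (Λ Λ' : RealBilin n →L[ℝ] ℝ) (T : CovTensor n (2 * 2))
    (S : CSpace n →L[ℝ] CSpace n →L[ℝ] RealBilin n) (hS : ∀ a b c d, T ![a, b, c, d] = S a b c d) :
    contract ![contraOf Λ, contraOf Λ'] T =
      Λ (ContinuousLinearMap.compL ℝ (CSpace n) (RealBilin n) ℝ Λ' ∘L S) := by
-- index quadruples as pairs of pairs
  let e : ((Fin 2 × Fin 2 → Fin n ⊕ Fin n)) ≃ ((Fin n ⊕ Fin n) × (Fin n ⊕ Fin n)) × ((Fin n ⊕ Fin n) × (Fin n ⊕ Fin n)) :=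
    { toFun := fun P => ((P (0, 0), P (0, 1)), (P (1, 0), P (1, 1)))
      invFun := fun q i => ![![q.1.1, q.1.2], ![q.2.1, q.2.2]] i.1 i.2
      left_inv := fun P => by
        funext ⟨i, j⟩
        fin_cases i <;> fin_cases j <;> rfl
      right_inv := fun q => rfl }
  rw [contract, ← e.symm.sum_comp, Fintype.sum_prod_type, Fintype.sum_prod_type]
  rw [← sum_contraOf Λ]
  refine Finset.sum_congr rfl fun a _ => Finset.sum_congr rfl fun b _ => ?_
  have h1 : (ContinuousLinearMap.compL ℝ (CSpace n) (RealBilin n) ℝ Λ' ∘L S) (realVec a) (realVec b) =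
    Λ' (S (realVec a) (realVec b)) := rfl
  rw [h1, ← sum_contraOf Λ', Finset.mul_sum, Fintype.sum_prod_type]
  refine Finset.sum_congr rfl fun c _ => ?_
  rw [Finset.mul_sum]
  refine Finset.sum_congr rfl fun d _ => ?_
  rw [← hS, Fin.prod_univ_two, ← mul_assoc]
  have h2 : (fun s : Fin (2 * 2) => realVec (e.symm ((a, b), (c, d)) (finProdFinEquiv.symm s))) =
      ![realVec a, realVec b, realVec c, realVec d] := by
    funext s
    fin_cases s <;> rfl
  rw [h2]
  rfl

/-- The form `2 (levi t) ∧ ω^{n-2}`; this is `i∂∂̄(v ω^{n-2})` up to terms of lower order if `t` is the Hessian of `v`. -/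
def hessForm (G : RealBilin (m + 1 + 1)) : RealBilin (m + 1 + 1) →L[ℝ] CForm (m + 1 + 1) (2 * (m + 1)) :=
  (2 : ℝ) • wedgeTwoL (m + 1 + 1) (2 * m) (fundPow G m) ∘L levi ℝ

theorem hessForm_apply (G : RealBilin (m + 1 + 1)) (t : RealBilin (m + 1 + 1)) :
    hessForm G t = (2 : ℝ) • wedgeTwo (levi ℝ t) (fundPow G m) := rfl

theorem altTwo_levi_smul (G t : RealBilin (m + 1 + 1))
    (T : CSpace (m + 1 + 1) →L[ℝ] CSpace (m + 1 + 1) →L[ℝ] CForm (m + 1 + 1) (2 * m))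
    (hT : ∀ c d, T c d = t c d • fundPow G m) :
    altTwo (m + 1 + 1) (2 * m) (levi _ T) = hessForm G t := by
  rw [hessForm_apply, wedgeTwo_eq_altTwo, smul_smul]
  norm_num
  congr 1
  refine ContinuousLinearMap.ext fun u => ContinuousLinearMap.ext fun w => ?_
  rw [levi_apply, tensorForm_apply, levi_apply, hT, hT, ← sub_smul, smul_smul]
  rfl

theorem hessForm_smulRight (G : RealBilin (m + 1 + 1)) (ξ η : Covec (m + 1 + 1)) :
    hessForm G (ξ.smulRight η) = (1 / 2 : ℝ) • leviForm G ξ η := by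
  have h : levi ℝ (ξ.smulRight η : RealBilin (m + 1 + 1)) = (1 / 4 : ℝ) • leviBilin (m + 1 + 1) ξ η := by
    refine ContinuousLinearMap.ext fun u => ContinuousLinearMap.ext fun w => ?_
    rw [levi_apply, smul_apply, smul_apply, leviBilin_apply]
    simp
  rw [hessForm_apply, h, leviForm, ← wedgeTwoL_apply, map_smul, smul_smul, wedgeTwoL_apply]
  norm_num

theorem hessForm_comp {G : RealBilin (m + 1 + 1)} {A : CSpace (m + 1 + 1) →L[ℝ] CSpace (m + 1 + 1)}
    (hA : ∀ u, A (complexJ _ u) = complexJ _ (A u)) (t : RealBilin (m + 1 + 1)) :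
    hessForm (G.bilinearComp A A) (t.bilinearComp A A) = (hessForm G t).compContinuousLinearMap A := by
  have h : levi ℝ (t.bilinearComp A A) = (levi ℝ t).bilinearComp A A := by
    refine ContinuousLinearMap.ext fun u => ContinuousLinearMap.ext fun w => ?_
    rw [levi_apply, ContinuousLinearMap.bilinearComp_apply, ContinuousLinearMap.bilinearComp_apply, hA, hA]
    rfl
  rw [hessForm_apply, h, fundPow_comp _ hA, wedgeTwo_comp, hessForm_apply]
  rfl

/-- The derivative of `logDet` in the direction of `hessForm G t`. -/
def hessTrace (G : RealBilin (m + 1 + 1)) (Φ : CForm (m + 1 + 1) (2 * (m + 1))) : RealBilin (m + 1 + 1) →L[ℝ] ℝ :=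
  fderiv ℝ logDet Φ ∘L hessForm G

theorem hessTrace_apply (G : RealBilin (m + 1 + 1)) {Φ : CForm (m + 1 + 1) (2 * (m + 1))}
    (hpos : 0 < (cofMatrix Φ).det.re) (t : RealBilin (m + 1 + 1)) :
    hessTrace G Φ t = (1 / (m + 1 : ℕ) : ℝ) * ((cofMatrix Φ)⁻¹ * cofMatrix (hessForm G t)).trace.re :=
  fderiv_logDet hpos _

theorem trace_inv_mul_congr {a P P' Q Q' : Matrix (Fin n) (Fin n) ℂ} {N : ℂ} (hN : N ≠ 0) (hu : IsUnit a.det)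
    (hP : IsUnit P.det) (hP' : IsUnit P'.det) (h1 : a * P' * a.conjTranspose = N • P)
    (h2 : a * Q' * a.conjTranspose = N • Q) : (P'⁻¹ * Q').trace = (P⁻¹ * Q).trace := by
  have hu' : IsUnit a.conjTranspose.det := by
    rw [Matrix.det_conjTranspose]; exact hu.star
  have h3 : P⁻¹ * (a * P' * a.conjTranspose) * (a.conjTranspose⁻¹ * (P'⁻¹ * Q') * a.conjTranspose) =
      P⁻¹ * (N • Q) := by
    rw [← h2]
    calc _ = P⁻¹ * a * P' * (a.conjTranspose * a.conjTranspose⁻¹) * P'⁻¹ * Q' * a.conjTranspose := by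
          simp only [Matrix.mul_assoc]
      _ = P⁻¹ * a * (P' * P'⁻¹) * Q' * a.conjTranspose := by
          rw [Matrix.mul_nonsing_inv _ hu', Matrix.mul_one]
          simp only [Matrix.mul_assoc]
      _ = _ := by
          rw [Matrix.mul_nonsing_inv _ hP', Matrix.mul_one]
          simp only [Matrix.mul_assoc]
  rw [h1, Matrix.mul_smul, Matrix.nonsing_inv_mul _ hP, Matrix.smul_mul, Matrix.one_mul, Matrix.mul_smul] at h3
  have h4 := congrArg Matrix.trace h3
  rw [Matrix.trace_smul, Matrix.trace_smul, Matrix.trace_mul_comm, ← Matrix.mul_assoc,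
    Matrix.mul_nonsing_inv _ hu', Matrix.one_mul, smul_eq_mul, smul_eq_mul] at h4
  exact mul_left_cancel₀ hN h4

theorem hessTrace_comp {G : RealBilin (m + 1 + 1)} {Φ : CForm (m + 1 + 1) (2 * (m + 1))}
    (hpos : 0 < (cofMatrix Φ).det.re) {A : CSpace (m + 1 + 1) →L[ℝ] CSpace (m + 1 + 1)}
    (hA : ∀ u, A (complexJ _ u) = complexJ _ (A u)) (hdet : (complexMatrix A).det ≠ 0) (t : RealBilin (m + 1 + 1)) :
    hessTrace (G.bilinearComp A A) (Φ.compContinuousLinearMap A) (t.bilinearComp A A) = hessTrace G Φ t := by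
  have hN0 : 0 < Complex.normSq (complexMatrix A).det := Complex.normSq_pos.2 hdet
  have hpos' : 0 < (cofMatrix (Φ.compContinuousLinearMap A)).det.re := by
    rw [det_cofMatrix_comp hA hdet]; positivity
  rw [hessTrace_apply _ hpos', hessTrace_apply _ hpos, hessForm_comp hA]
  rw [trace_inv_mul_congr (by exact_mod_cast hN0.ne') hdet.isUnit (cofMatrix_det_ne_zero hpos).isUnit
    (cofMatrix_det_ne_zero hpos').isUnit (cofMatrix_comp Φ hA) (cofMatrix_comp (hessForm G t) hA)]

open scoped ComplexOrder in
theorem hessTrace_pos {G : RealBilin (m + 1 + 1)} (hs : ∀ u w, G u w = G w u)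
    (hJ : ∀ u w, G (complexJ _ u) (complexJ _ w) = G u w) (hp : ∀ u, u ≠ 0 → 0 < G u u)
    {Φ : CForm (m + 1 + 1) (2 * (m + 1))} (hΦ : (cofMatrix Φ).PosDef) {ξ : Covec (m + 1 + 1)} (hξ : ξ ≠ 0) :
    0 < hessTrace G Φ (ξ.smulRight ξ) := by
  have hpos : 0 < (cofMatrix Φ).det.re := (Complex.pos_iff.1 hΦ.det_pos).1
  have hG := cofMatrix_leviForm_posSemidef (hermMatrix_posDef hs hJ hp) hξ
  rw [matrixBilin_hermMatrix hJ] at hG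
  have h := trace_inv_mul_pos hΦ hG.1 hG.2
  rw [hessTrace_apply _ hpos, hessForm_smulRight, cofMatrix_smul, Matrix.mul_smul, Matrix.trace_smul, smul_eq_mul,
    Complex.re_ofReal_mul]
  positivity

theorem iteratedFDeriv_four {E V : Type*} [NormedAddCommGroup E] [NormedSpace ℝ E] [NormedAddCommGroup V]
    [NormedSpace ℝ V] (f : E → V) (z a b c d : E) :
    iteratedFDeriv ℝ 4 f z ![a, b, c, d] =
      fderiv ℝ (fderiv ℝ (fderiv ℝ (fderiv ℝ f))) z a b c d := by
  rw [iteratedFDeriv_succ_apply_right, iteratedFDeriv_succ_apply_right, iteratedFDeriv_succ_apply_right,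
    iteratedFDeriv_succ_apply_right]
  rfl

theorem fderiv_fderiv_add {E V : Type*} [NormedAddCommGroup E] [NormedSpace ℝ E] [NormedAddCommGroup V]
    [NormedSpace ℝ V] {f g : E → V} {z : E} (hf : ContDiffAt ℝ 2 f z) (hg : ContDiffAt ℝ 2 g z) :
    fderiv ℝ (fderiv ℝ fun y => f y + g y) z = fderiv ℝ (fderiv ℝ f) z + fderiv ℝ (fderiv ℝ g) z := by
  have h : fderiv ℝ (fun y => f y + g y) =ᶠ[𝓝 z] fun y => fderiv ℝ f y + fderiv ℝ g y := by
    filter_upwards [hf.eventually (by simp), hg.eventually (by simp)] with y h1 h2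
    exact fderiv_fun_add (h1.differentiableAt (by norm_num)) (h2.differentiableAt (by norm_num))
  rw [h.fderiv_eq]
  exact fderiv_fun_add ((hf.fderiv_right (m := 1) (by norm_num)).differentiableAt one_ne_zero)
    ((hg.fderiv_right (m := 1) (by norm_num)).differentiableAt one_ne_zero)

theorem iDelDelbar_add {k : ℕ} {α β : CSpace n → CForm n k} {z : CSpace n} (hα : ContDiffAt ℝ 2 α z)
    (hβ : ContDiffAt ℝ 2 β z) :
    iDelDelbar (fun y => α y + β y) z = iDelDelbar α z + iDelDelbar β z := by
  rw [iDelDelbar_eq (hα.add hβ), iDelDelbar_eq hα, iDelDelbar_eq hβ, fderiv_fderiv_add hα hβ, map_add, map_add]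

theorem eventually_iDelDelbar_eq {k : ℕ} {α : CSpace n → CForm n k} {z : CSpace n} (hα : ContDiffAt ℝ ∞ α z) :
    iDelDelbar α =ᶠ[𝓝 z] fun y => (altTwo n k ∘L levi _) (fderiv ℝ (fderiv ℝ α) y) := by
  filter_upwards [contDiffAt_infty_eventually hα 2] with y hy
  exact iDelDelbar_eq hy

theorem VanishesTo.iDelDelbar {k N : ℕ} {α : CSpace n → CForm n k} {z : CSpace n}
    (hα : VanishesTo (N + 2) α z) : VanishesTo N (iDelDelbar α) z :=
  (hα.fderiv.fderiv.clm_comp _).congr (eventually_iDelDelbar_eq hα.smooth)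

section

variable {G : CSpace (m + 1 + 1) → RealBilin (m + 1 + 1)} {u w : CSpace (m + 1 + 1) → ℝ}
  {z : CSpace (m + 1 + 1)}

theorem localPerturbed_add (hG : ContDiffAt ℝ ∞ G z) (hu : ContDiffAt ℝ ∞ u z) (hw : ContDiffAt ℝ ∞ w z) :
    localPerturbed G (fun y => u y + w y) =ᶠ[𝓝 z] fun y =>
      localPerturbed G u y + iDelDelbar (fun y => w y • fundPow (G y) m) y := by
  filter_upwards [contDiffAt_infty_eventually hG 2, contDiffAt_infty_eventually hu 2,
    contDiffAt_infty_eventually hw 2] with y h1 h2 h3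
  have h := iDelDelbar_add (contDiffAt_smul_fundPow h1 h2 m) (contDiffAt_smul_fundPow h1 h3 m)
  simp only [localPerturbed, add_smul]
  rw [h]
  exact (add_assoc _ _ _).symm

theorem VanishesTo.smul_fundPow {N : ℕ} (hG : ContDiffAt ℝ ∞ G z) (hw : VanishesTo N w z) (k : ℕ) :
    VanishesTo N (fun y => w y • fundPow (G y) k) z :=
  VanishesTo.bilin_left (ContinuousLinearMap.lsmul ℝ ℝ) hw (contDiffAt_fundPow hG k)

/-- The form `ω^{n-1} + i∂∂̄(u ω^{n-2})` depends only on the derivatives of `u` of order at most two. -/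
theorem localPerturbed_eq_of_vanishesTo (hG : ContDiffAt ℝ ∞ G z) (hu : ContDiffAt ℝ ∞ u z)
    (hw : VanishesTo 3 w z) : localPerturbed G (fun y => u y + w y) z = localPerturbed G u z := by
  have h1 := (localPerturbed_add hG hu hw.smooth).self_of_nhds
  have h2 := (VanishesTo.iDelDelbar (N := 1) (hw.smul_fundPow hG m)).eq_zero
  simp only [h2] at h1
  rw [h1]
  exact add_zero _

/-- The principal part of the second derivative of `i∂∂̄(w ω^{n-2})`. -/
theorem fderiv_fderiv_iDelDelbar_smul (hG : ContDiffAt ℝ ∞ G z) (hw : VanishesTo 4 w z)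
    (a b : CSpace (m + 1 + 1)) :
    fderiv ℝ (fderiv ℝ (iDelDelbar fun y => w y • fundPow (G y) m)) z a b =
      hessForm (G z) (fderiv ℝ (fderiv ℝ (fderiv ℝ (fderiv ℝ w))) z a b) := by
  set α : CSpace (m + 1 + 1) → CForm (m + 1 + 1) (2 * m) := fun y => w y • fundPow (G y) m with hα
  have hs : ContDiffAt ℝ ∞ α z := hw.smooth.smul (contDiffAt_fundPow hG m)
  have hs2 : ContDiffAt ℝ ∞ (fderiv ℝ (fderiv ℝ α)) z :=
    (hs.fderiv_right (m := ∞) le_rfl).fderiv_right le_rfl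
  rw [(eventually_iDelDelbar_eq hs).fderiv.fderiv_eq,
    fderiv_fderiv_clm_comp _ (hs2.of_le ENat.LEInfty.out), ContinuousLinearMap.comp_apply]
  refine altTwo_levi_smul _ _ _ fun c d => ?_
  rw [← iteratedFDeriv_four, ← iteratedFDeriv_four]
  exact hw.iteratedFDeriv_smul (contDiffAt_fundPow hG m) _

end

/-- The two factors of the principal symbol: the derivatives of `v` in the direction of the first factor come from
the trace with `ω_v` in the Chern scalar curvature, those in the direction of the second factor from the
derivative of `log det ω_v` in the direction of `i∂∂̄(v ω^{n-2})`. -/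
def symbols (G : RealBilin (m + 1 + 1)) (Φ : CForm (m + 1 + 1) (2 * (m + 1))) : Fin 2 → ContraTwo (m + 1 + 1) :=
  ![contraOf (chernTrace (rootMatrix (cofMatrix Φ))), contraOf (hessTrace G Φ)]

theorem contract_add {r : ℕ} (A : Fin r → ContraTwo n) (T T' : CovTensor n (r * 2)) :
    contract A (T + T') = contract A T + contract A T' := by
  simp only [contract, ← Finset.sum_add_distrib, ← mul_add]
  rfl

theorem exists_curry_four (T : CovTensor n (2 * 2)) :
    ∃ S : CSpace n →L[ℝ] CSpace n →L[ℝ] RealBilin n, ∀ a b c d, T ![a, b, c, d] = S a b c d := by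
  let c : (k : ℕ) → CovTensor n (k + 1) →L[ℝ] CSpace n →L[ℝ] CovTensor n k := fun k =>
    (continuousMultilinearCurryLeftEquiv ℝ (fun _ : Fin (k + 1) => CSpace n) ℝ).toContinuousLinearEquiv.toContinuousLinearMap
  let K0 : CovTensor n 0 →L[ℝ] ℝ :=
    (continuousMultilinearCurryFin0 ℝ (CSpace n) ℝ).toContinuousLinearEquiv.toContinuousLinearMap
  let K1 : CovTensor n 1 →L[ℝ] Covec n := ContinuousLinearMap.compL ℝ _ _ _ K0 ∘L c 0
  let K2 : CovTensor n 2 →L[ℝ] RealBilin n := ContinuousLinearMap.compL ℝ _ _ _ K1 ∘L c 1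
  let K3 : CovTensor n 3 →L[ℝ] CSpace n →L[ℝ] RealBilin n := ContinuousLinearMap.compL ℝ _ _ _ K2 ∘L c 2
  let K4 : CovTensor n 4 →L[ℝ] CSpace n →L[ℝ] CSpace n →L[ℝ] RealBilin n := ContinuousLinearMap.compL ℝ _ _ _ K3 ∘L c 3
  refine ⟨K4 T, fun a b c d => ?_⟩
  change _ = T (Fin.cons a (Fin.cons b (Fin.cons c (Fin.cons d 0))))
  congr 1
  funext i
  fin_cases i <;> rfl

/-- The contraction with the principal symbol is natural. -/
theorem contract_symbols_comp {G : RealBilin (m + 1 + 1)} {Φ : CForm (m + 1 + 1) (2 * (m + 1))}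
    (hpos : 0 < (cofMatrix Φ).det.re) {A : CSpace (m + 1 + 1) →L[ℝ] CSpace (m + 1 + 1)}
    (hA : ∀ u, A (complexJ _ u) = complexJ _ (A u)) (hdet : (complexMatrix A).det ≠ 0)
    (T : CovTensor (m + 1 + 1) (2 * 2)) :
    contract (symbols (G.bilinearComp A A) (Φ.compContinuousLinearMap A)) (T.compContinuousLinearMap fun _ => A) =
      contract (symbols G Φ) T := by
  obtain ⟨S, hS⟩ := exists_curry_four T
  obtain ⟨S', hS'⟩ := exists_curry_four (T.compContinuousLinearMap fun _ => A)
  have h : ∀ a b, S' a b = (S (A a) (A b)).bilinearComp A A := by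
    intro a b
    refine ContinuousLinearMap.ext fun c => ContinuousLinearMap.ext fun d => ?_
    rw [← hS', ContinuousLinearMap.bilinearComp_apply, ← hS]
    change T _ = T _
    congr 1
    funext i
    fin_cases i <;> rfl
  have key : ContinuousLinearMap.compL ℝ (CSpace (m + 1 + 1)) (RealBilin (m + 1 + 1)) ℝ
      (hessTrace (G.bilinearComp A A) (Φ.compContinuousLinearMap A)) ∘L S' =
      (ContinuousLinearMap.compL ℝ (CSpace (m + 1 + 1)) (RealBilin (m + 1 + 1)) ℝ (hessTrace G Φ) ∘L
        S).bilinearComp A A := by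
    refine ContinuousLinearMap.ext fun a => ContinuousLinearMap.ext fun b => ?_
    change hessTrace _ _ (S' a b) = hessTrace _ _ (S (A a) (A b))
    rw [h, hessTrace_comp hpos hA hdet]
  have hroot := rootMatrix_comp (Nat.succ_ne_zero m) hpos hA hdet
  rw [symbols, symbols, contract_contraOf _ _ _ S' hS', contract_contraOf _ _ _ S hS, key, hroot]
  exact chernTrace_comp hA hdet _ _

theorem symbols_comp {G : RealBilin (m + 1 + 1)} {Φ : CForm (m + 1 + 1) (2 * (m + 1))}
    (hpos : 0 < (cofMatrix Φ).det.re) {A : CSpace (m + 1 + 1) →L[ℝ] CSpace (m + 1 + 1)}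
    (hA : ∀ u, A (complexJ _ u) = complexJ _ (A u)) (hdet : (complexMatrix A).det ≠ 0) (k : Fin 2)
    (ξ η : Covec (m + 1 + 1)) :
    symbols (G.bilinearComp A A) (Φ.compContinuousLinearMap A) k (ξ ∘L A) (η ∘L A) = symbols G Φ k ξ η := by
  have h : (ξ ∘L A).smulRight (η ∘L A) = (ξ.smulRight η : RealBilin (m + 1 + 1)).bilinearComp A A := rfl
  fin_cases k
  · change contraOf _ _ _ = contraOf _ _ _
    rw [contraOf_apply, contraOf_apply, h, rootMatrix_comp (Nat.succ_ne_zero m) hpos hA hdet, chernTrace_comp hA hdet]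
  · change contraOf _ _ _ = contraOf _ _ _
    rw [contraOf_apply, contraOf_apply, h, hessTrace_comp hpos hA hdet]

/-- The sum of the Chern scalar curvature and the contraction of the symbols with the fourth covariant derivative;
this is the term of order at most three, see `lowerOrder_eq_of_vanishesTo`. -/
def lowerOrder (G : CSpace (m + 1 + 1) → RealBilin (m + 1 + 1)) (u : CSpace (m + 1 + 1) → ℝ)
    (z : CSpace (m + 1 + 1)) : ℝ :=
  rootScalar (localPerturbed G u) z + contract (symbols (G z) (localPerturbed G u z)) (iterCovDeriv G u (2 * 2) z)

section

variable {G : CSpace (m + 1 + 1) → RealBilin (m + 1 + 1)} {u w : CSpace (m + 1 + 1) → ℝ}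
  {z : CSpace (m + 1 + 1)}

theorem rootScalar_congr {p : ℕ} {Φ Ψ : CSpace (p + 1) → CForm (p + 1) (2 * p)} {z : CSpace (p + 1)}
    (h : Φ =ᶠ[𝓝 z] Ψ) : rootScalar Φ z = rootScalar Ψ z := by
  have h1 : (fun y => logDet (Φ y)) =ᶠ[𝓝 z] fun y => logDet (Ψ y) := h.mono fun y hy => by simp only [hy]
  rw [rootScalar, rootScalar, h.self_of_nhds, h1.fderiv.fderiv_eq]

/-- `lowerOrder` depends only on the derivatives of `u` of order at most three. -/
theorem lowerOrder_eq_of_vanishesTo (hG : IsHermitianAt G z) (hu : ContDiffAt ℝ ∞ u z)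
    (hw : VanishesTo 4 w z) (hpos : 0 < (cofMatrix (localPerturbed G u z)).det.re) :
    lowerOrder G (fun y => u y + w y) z = lowerOrder G u z := by
  have hΨ : VanishesTo 2 (iDelDelbar fun y => w y • fundPow (G y) m) z :=
    VanishesTo.iDelDelbar (hw.smul_fundPow hG.smooth m)
  rw [lowerOrder, lowerOrder, localPerturbed_eq_of_vanishesTo hG.smooth hu (hw.mono (by norm_num)),
    (iterCovDeriv_add hG hu hw.smooth _).self_of_nhds, contract_add,
    rootScalar_congr (localPerturbed_add hG.smooth hu hw.smooth),
    rootScalar_add (contDiffAt_localPerturbed hG.smooth hu) hΨ hpos]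
  have h4 : iterCovDeriv G w (2 * 2) z = iteratedFDeriv ℝ 4 w z := hw.iterCovDeriv_eq hG
-- the contraction with the symbols is the contribution of `w` to the curvature
  have h5 : contract (symbols (G z) (localPerturbed G u z)) (iterCovDeriv G w (2 * 2) z) =
      chernTrace (rootMatrix (cofMatrix (localPerturbed G u z)))
        (ContinuousLinearMap.compL ℝ (CSpace (m + 1 + 1)) (CForm (m + 1 + 1) (2 * (m + 1))) ℝ
          (fderiv ℝ logDet (localPerturbed G u z)) ∘L
          fderiv ℝ (fderiv ℝ (iDelDelbar fun y => w y • fundPow (G y) m)) z) := by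
    rw [h4, symbols, contract_contraOf _ _ _ _ (iteratedFDeriv_four w z)]
    congr 1
    refine ContinuousLinearMap.ext fun a => ContinuousLinearMap.ext fun b => ?_
    simp only [ContinuousLinearMap.comp_apply, ContinuousLinearMap.compL_apply,
      fderiv_fderiv_iDelDelbar_smul hG.smooth hw, hessTrace]
  rw [h5]
  ring

/-- Both summands of `lowerOrder` are natural. -/
theorem lowerOrder_pull {F : CSpace (m + 1 + 1) → CSpace (m + 1 + 1)} (hF : IsBiholo F z)
    (hG : IsHermitianAt G (F z)) (hu : ContDiffAt ℝ ∞ u (F z))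
    (hpos : 0 < (cofMatrix (localPerturbed G u (F z))).det.re) :
    lowerOrder (pullMetric F G) (fun y => u (F y)) z = lowerOrder G u (F z) := by
  have h1 : localPerturbed (pullMetric F G) (fun y => u (F y)) =ᶠ[𝓝 z] pullForm F (localPerturbed G u) := by
    have hc := hF.smooth.continuousAt
    filter_upwards [hc.eventually (contDiffAt_infty_eventually hG.smooth 2),
      hc.eventually (contDiffAt_infty_eventually hu 2), hF.eventually] with y h1 h2 h3
    exact localPerturbed_pull h3 h1 h2
  have hA := hF.commute.self_of_nhds
  have hdet : (complexMatrix (fderiv ℝ F z)).det ≠ 0 := hF.jacobian_ne_zero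
  have e1 : rootScalar (localPerturbed (pullMetric F G) fun y => u (F y)) z = rootScalar (localPerturbed G u) (F z) :=
    (rootScalar_congr h1).trans
      (rootScalar_pull (Nat.succ_ne_zero m) hF (contDiffAt_localPerturbed hG.smooth hu) hpos)
  have e2 : localPerturbed (pullMetric F G) (fun y => u (F y)) z =
      (localPerturbed G u (F z)).compContinuousLinearMap (fderiv ℝ F z) := h1.self_of_nhds
  have e3 : iterCovDeriv (pullMetric F G) (fun y => u (F y)) (2 * 2) z =
      (iterCovDeriv G u (2 * 2) (F z)).compContinuousLinearMap fun _ => fderiv ℝ F z :=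
    (iterCovDeriv_pull hF hG hu _).self_of_nhds
  have e4 : pullMetric F G z = (G (F z)).bilinearComp (fderiv ℝ F z) (fderiv ℝ F z) := rfl
  rw [lowerOrder, lowerOrder, e1, e2, e3, e4, contract_symbols_comp hpos hA hdet]

end

end Symbols

/-! ### Dependence on the jet -/

section JetSymbols

open Filter Topology

variable {n p m : ℕ} {X : Type*} [NormedAddCommGroup X] [NormedSpace ℝ X]

theorem contDiffAt_chernTrace {M : X → Matrix (Fin n) (Fin n) ℂ} {L : X → RealBilin n} {x : X}
    (hM : ∀ r s, ContDiffAt ℝ ∞ (fun y => M y r s) x) (hd : (M x).det ≠ 0) (hL : ContDiffAt ℝ ∞ L x) :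
    ContDiffAt ℝ ∞ (fun y => chernTrace (M y) (L y)) x := by
  have h1 : ∀ u w : CSpace n, ContDiffAt ℝ ∞ (fun y => L y u w) x := fun u w =>
    (hL.clm_apply contDiffAt_const).clm_apply contDiffAt_const
  have h2 : ∀ u w : CSpace n, ContDiffAt ℝ ∞ (fun y => sesq (L y) u w) x := fun u w =>
    (Complex.ofRealCLM.contDiff.contDiffAt.comp x ((h1 _ _).add (h1 _ _))).add
      (contDiffAt_const.mul (Complex.ofRealCLM.contDiff.contDiffAt.comp x ((h1 _ _).sub (h1 _ _))))
  have h3 : ContDiffAt ℝ ∞ (fun y => ∑ i, ∑ j, (M y)⁻¹ j i * sesq (L y) (coordVec j) (coordVec i)) x :=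
    ContDiffAt.sum fun i _ => ContDiffAt.sum fun j _ => (contDiffAt_matrix_inv hM hd j i).mul (h2 _ _)
  exact contDiffAt_const.mul (Complex.reCLM.contDiff.contDiffAt.comp x h3)

theorem rootMatrix_det_ne_zero (hp : p ≠ 0) {Φ : CForm (p + 1) (2 * p)} (hpos : 0 < (cofMatrix Φ).det.re) :
    (rootMatrix (cofMatrix Φ)).det ≠ 0 := fun h => by
  have := (log_det_rootMatrix hp (cofMatrix_isHermitian Φ) hpos).1
  rw [h] at this
  simp at this

theorem contDiffAt_hessTrace {G : X → RealBilin (m + 1 + 1)} {Φ : X → CForm (m + 1 + 1) (2 * (m + 1))} {x : X}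
    (hG : ContDiffAt ℝ ∞ G x) (hΦ : ContDiffAt ℝ ∞ Φ x) (hpos : 0 < (cofMatrix (Φ x)).det.re)
    (t : RealBilin (m + 1 + 1)) : ContDiffAt ℝ ∞ (fun y => hessTrace (G y) (Φ y) t) x := by
  have h1 : ContDiffAt ℝ ∞ (fun y => fderiv ℝ logDet (Φ y)) x :=
    ((contDiffAt_logDet hpos).fderiv_right (m := ∞) le_rfl).comp x hΦ
  have h2 : ContDiffAt ℝ ∞ (fun y => wedgeTwoL (m + 1 + 1) (2 * m) (fundPow (G y) m) (levi ℝ t)) x :=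
    ((wedgeTwoL (m + 1 + 1) (2 * m)).contDiff.contDiffAt.comp x (contDiffAt_fundPow hG m)).clm_apply contDiffAt_const
  exact h1.clm_apply (h2.const_smul (2 : ℝ))

theorem contDiffAt_symbols {G : X → RealBilin (m + 1 + 1)} {Φ : X → CForm (m + 1 + 1) (2 * (m + 1))} {x : X}
    (hG : ContDiffAt ℝ ∞ G x) (hΦ : ContDiffAt ℝ ∞ Φ x) (hpos : 0 < (cofMatrix (Φ x)).det.re) (k : Fin 2)
    (ξ η : Covec (m + 1 + 1)) : ContDiffAt ℝ ∞ (fun y => symbols (G y) (Φ y) k ξ η) x := by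
  fin_cases k
  · exact contDiffAt_chernTrace (contDiffAt_rootMatrix (contDiffAt_cofMatrix hΦ) hpos)
      (rootMatrix_det_ne_zero (Nat.succ_ne_zero m) hpos) contDiffAt_const
  · exact contDiffAt_hessTrace hG hΦ hpos _

open scoped ComplexOrder in
theorem symbols_pos {G : RealBilin (m + 1 + 1)} (hs : ∀ u w, G u w = G w u)
    (hJ : ∀ u w, G (complexJ _ u) (complexJ _ w) = G u w) (hp : ∀ u, u ≠ 0 → 0 < G u u)
    {Φ : CForm (m + 1 + 1) (2 * (m + 1))} (hΦ : (cofMatrix Φ).PosDef) (k : Fin 2) {ξ : Covec (m + 1 + 1)}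
    (hξ : ξ ≠ 0) : 0 < symbols G Φ k ξ ξ := by
  fin_cases k
  · exact chernTrace_pos (rootMatrix_posDef hΦ) hξ
  · exact hessTrace_pos hs hJ hp hΦ hξ

theorem contDiffAt_contract {r : ℕ} {A : X → Fin r → ContraTwo n} {T : X → CovTensor n (r * 2)} {x : X}
    (hA : ∀ k ξ η, ContDiffAt ℝ ∞ (fun y => A y k ξ η) x) (hT : ContDiffAt ℝ ∞ T x) :
    ContDiffAt ℝ ∞ (fun y => contract (A y) (T y)) x := by
  refine ContDiffAt.sum fun P _ => (contDiffAt_prod fun k _ => hA k _ _).mul ?_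
  exact (ContinuousMultilinearMap.apply ℝ (fun _ : Fin (r * 2) => CSpace n) ℝ _).contDiff.contDiffAt.comp x hT

theorem contDiffAt_rootScalar_param {Φ : X → CSpace (p + 1) → CForm (p + 1) (2 * p)} (hp : p ≠ 0)
    {q : X × CSpace (p + 1)} (hΦ : ContDiffAt ℝ ∞ (fun q : X × CSpace (p + 1) => Φ q.1 q.2) q)
    (hpos : 0 < (cofMatrix (Φ q.1 q.2)).det.re) :
    ContDiffAt ℝ ∞ (fun q : X × CSpace (p + 1) => rootScalar (Φ q.1) q.2) q := by
  have h1 : ContDiffAt ℝ ∞ (fun q : X × CSpace (p + 1) => logDet (Φ q.1 q.2)) q :=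
    ContDiffAt.comp (g := logDet) (f := fun q : X × CSpace (p + 1) => Φ q.1 q.2) q (contDiffAt_logDet hpos) hΦ
  have h2 := contDiffAt_fderiv_param (f := fun p y => logDet (Φ p y)) h1
  have h3 := contDiffAt_fderiv_param (f := fun p y => fderiv ℝ (fun y => logDet (Φ p y)) y) h2
  exact (contDiffAt_chernTrace (contDiffAt_rootMatrix (contDiffAt_cofMatrix hΦ) hpos)
      (rootMatrix_det_ne_zero hp hpos) h3).neg

theorem contDiffAt_lowerOrder_param {G : CSpace (m + 1 + 1) → RealBilin (m + 1 + 1)}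
    {u : X → CSpace (m + 1 + 1) → ℝ} {q : X × CSpace (m + 1 + 1)} (hG : IsHermitianAt G q.2)
    (hu : ContDiffAt ℝ ∞ (fun q : X × CSpace (m + 1 + 1) => u q.1 q.2) q)
    (hpos : 0 < (cofMatrix (localPerturbed G (u q.1) q.2)).det.re) :
    ContDiffAt ℝ ∞ (fun q : X × CSpace (m + 1 + 1) => lowerOrder G (u q.1) q.2) q := by
  have h1 := contDiffAt_localPerturbed_param hG.smooth hu
  have h2 : ContDiffAt ℝ ∞ (fun q : X × CSpace (m + 1 + 1) => G q.2) q := hG.smooth.comp q contDiffAt_snd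
  exact (contDiffAt_rootScalar_param (Φ := fun p => localPerturbed G (u p)) (Nat.succ_ne_zero m) h1 hpos).add
    (contDiffAt_contract (fun k ξ η => contDiffAt_symbols h2 h1 hpos k ξ η) (contDiffAt_iterCovDeriv_param hG hu _))

/-- The value of `ω^{n-1} + i∂∂̄(u ω^{n-2})` at `z` for functions `u` with the jet `ψ`; `jetPoly` provides such a
function for every `ψ`, also if the tensors of `ψ` are not symmetric. -/
def jetForm (G : CSpace (m + 1 + 1) → RealBilin (m + 1 + 1)) (z : CSpace (m + 1 + 1))
    (ψ : JetTuple (m + 1 + 1) (2 * 2)) : CForm (m + 1 + 1) (2 * (m + 1)) :=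
  localPerturbed G (jetPoly G z ψ 4) z

/-- The value of `lowerOrder` at `z` for functions with the jet `ψ`. -/
def jetLower (G : CSpace (m + 1 + 1) → RealBilin (m + 1 + 1)) (z : CSpace (m + 1 + 1))
    (ψ : JetTuple (m + 1 + 1) (2 * 2)) : ℝ :=
  lowerOrder G (jetPoly G z ψ 4) z

variable {G : CSpace (m + 1 + 1) → RealBilin (m + 1 + 1)} {u : CSpace (m + 1 + 1) → ℝ} {z : CSpace (m + 1 + 1)}
  {ψ : JetTuple (m + 1 + 1) (2 * 2)}

theorem localPerturbed_eq_jetForm (hG : IsHermitianAt G z) (hu : ContDiffAt ℝ ∞ u z)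
    (h : ∀ k < 3, ∀ a, iterCovDeriv G u k z (fun _ => a) = jetComp _ _ k ψ fun _ => a) :
    localPerturbed G u z = jetForm G z ψ := by
  have hp := contDiffAt_jetPoly (k := 4) hG ψ z
  have h1 : VanishesTo 3 (fun y => u y - jetPoly G z ψ 4 y) z :=
    vanishesTo_sub hG hu hp fun k hk a => by
      rw [h k hk, iterCovDeriv_jetPoly hG ψ (by omega)]
  have h2 := localPerturbed_eq_of_vanishesTo hG.smooth hp h1
  simp only [add_sub_cancel] at h2
  exact h2

theorem lowerOrder_eq_jetLower (hG : IsHermitianAt G z) (hu : ContDiffAt ℝ ∞ u z)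
    (h : ∀ k < 4, ∀ a, iterCovDeriv G u k z (fun _ => a) = jetComp _ _ k ψ fun _ => a)
    (hpos : 0 < (cofMatrix (jetForm G z ψ)).det.re) :
    lowerOrder G u z = jetLower G z ψ := by
  have hp := contDiffAt_jetPoly (k := 4) hG ψ z
  have h1 : VanishesTo 4 (fun y => u y - jetPoly G z ψ 4 y) z :=
    vanishesTo_sub hG hu hp fun k hk a => by
      rw [h k hk, iterCovDeriv_jetPoly hG ψ (by omega)]
  have h2 := lowerOrder_eq_of_vanishesTo hG hp h1 hpos
  simp only [add_sub_cancel] at h2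
  exact h2

theorem jetComp_pullback {N : ℕ} (A : CSpace n →L[ℝ] CSpace n) (ψ : JetTuple n N) (k : ℕ) :
    jetComp n N k (ψ.pullback A) = (jetComp n N k ψ).compContinuousLinearMap fun _ => A := by
  unfold jetComp
  split_ifs with h
  · rfl
  · ext v
    rfl

theorem iterCovDeriv_pull_jetPoly {F : CSpace (m + 1 + 1) → CSpace (m + 1 + 1)} (hF : IsBiholo F z)
    (hG : IsHermitianAt G (F z)) (k : ℕ) (hk : k < 4) (a : CSpace (m + 1 + 1)) :
    iterCovDeriv (pullMetric F G) (fun y => jetPoly G (F z) ψ 4 (F y)) k z (fun _ => a) =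
      jetComp _ _ k (ψ.pullback (fderiv ℝ F z)) fun _ => a := by
  rw [(iterCovDeriv_pull hF hG (contDiffAt_jetPoly hG ψ _) k).self_of_nhds, jetComp_pullback]
  exact iterCovDeriv_jetPoly hG ψ hk _

theorem jetForm_pull {F : CSpace (m + 1 + 1) → CSpace (m + 1 + 1)} (hF : IsBiholo F z)
    (hG : IsHermitianAt G (F z)) (ψ : JetTuple (m + 1 + 1) (2 * 2)) :
    jetForm (pullMetric F G) z (ψ.pullback (fderiv ℝ F z)) =
      (jetForm G (F z) ψ).compContinuousLinearMap (fderiv ℝ F z) := by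
  have hp := contDiffAt_jetPoly (k := 4) hG ψ (F z)
  exact (localPerturbed_eq_jetForm (hG.pull hF) (hp.comp z hF.smooth) fun k hk =>
    iterCovDeriv_pull_jetPoly hF hG k (hk.trans (by norm_num))).symm.trans
    (localPerturbed_pull hF.toIsHolo (hG.smooth.of_le ENat.LEInfty.out) (hp.of_le ENat.LEInfty.out))

theorem jetLower_pull {F : CSpace (m + 1 + 1) → CSpace (m + 1 + 1)} (hF : IsBiholo F z)
    (hG : IsHermitianAt G (F z)) (hpos : 0 < (cofMatrix (jetForm G (F z) ψ)).det.re) :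
    jetLower (pullMetric F G) z (ψ.pullback (fderiv ℝ F z)) = jetLower G (F z) ψ := by
  have hp := contDiffAt_jetPoly (k := 4) hG ψ (F z)
  have hdet : (complexMatrix (fderiv ℝ F z)).det ≠ 0 := hF.jacobian_ne_zero
  have hN0 : 0 < Complex.normSq (complexMatrix (fderiv ℝ F z)).det := Complex.normSq_pos.2 hdet
  refine (lowerOrder_eq_jetLower (hG.pull hF) (hp.comp z hF.smooth) (iterCovDeriv_pull_jetPoly hF hG) ?_).symm.trans
    (lowerOrder_pull hF hG hp hpos)
  rw [jetForm_pull hF hG, det_cofMatrix_comp hF.commute.self_of_nhds hdet]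
  positivity

/-- Restriction of a smooth function of `((y, w), y')` to `y' = y`. -/
theorem contDiffAt_diag {E W Y : Type*} [NormedAddCommGroup E] [NormedSpace ℝ E] [NormedAddCommGroup W]
    [NormedSpace ℝ W] [NormedAddCommGroup Y] [NormedSpace ℝ Y] {f : E × W → E → Y} {z : E} {w : W}
    (h : ContDiffAt ℝ ∞ (fun q : (E × W) × E => f q.1 q.2) ((z, w), z)) :
    ContDiffAt ℝ ∞ (fun q : E × W => f q q.1) (z, w) :=
  h.comp (z, w) (contDiffAt_id.prodMk contDiffAt_fst)

theorem contDiffAt_jetForm (hG : IsHermitianAt G z) :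
    ContDiffAt ℝ ∞ (fun q : CSpace (m + 1 + 1) × JetTuple (m + 1 + 1) (2 * 2) => jetForm G q.1 q.2) (z, ψ) :=
  contDiffAt_diag (f := fun p y => localPerturbed G (jetPoly G p.1 p.2 4) y)
    (contDiffAt_localPerturbed_param (u := fun p : CSpace (m + 1 + 1) × JetTuple (m + 1 + 1) (2 * 2) =>
      jetPoly G p.1 p.2 4) (q := ((z, ψ), z)) hG.smooth (contDiffAt_jetPoly_param hG ψ z))

theorem contDiffAt_jetLower (hG : IsHermitianAt G z) (hpos : 0 < (cofMatrix (jetForm G z ψ)).det.re) :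
    ContDiffAt ℝ ∞ (fun q : CSpace (m + 1 + 1) × JetTuple (m + 1 + 1) (2 * 2) => jetLower G q.1 q.2) (z, ψ) :=
  contDiffAt_diag (f := fun p y => lowerOrder G (jetPoly G p.1 p.2 4) y)
    (contDiffAt_lowerOrder_param (u := fun p : CSpace (m + 1 + 1) × JetTuple (m + 1 + 1) (2 * 2) =>
      jetPoly G p.1 p.2 4) (q := ((z, ψ), z)) hG (contDiffAt_jetPoly_param hG ψ z) hpos)

end JetSymbols

/-! ### Charts and coordinate expressions -/

section Charts

open Filter Topology

variable {n : ℕ} {M : Type*} [TopologicalSpace M] [ChartedSpace (CSpace n) M]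
  [IsManifold 𝓘(ℂ, CSpace n) ω M] {φ φ' : OpenPartialHomeomorph M (CSpace n)} {x : M} {z : CSpace n}

theorem mem_maximalAtlas_real (hφ : φ ∈ atlas (CSpace n) M) :
    φ ∈ IsManifold.maximalAtlas 𝓘(ℝ, CSpace n) ∞ M :=
  StructureGroupoid.subset_maximalAtlas _ hφ

theorem contMDiffAt_chart (hφ : φ ∈ atlas (CSpace n) M) (hx : x ∈ φ.source) :
    ContMDiffAt 𝓘(ℝ, CSpace n) 𝓘(ℝ, CSpace n) ∞ φ x :=
  (contMDiffOn_of_mem_maximalAtlas (mem_maximalAtlas_real hφ)).contMDiffAt (φ.open_source.mem_nhds hx)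

theorem contMDiffAt_chart_symm (hφ : φ ∈ atlas (CSpace n) M) (hz : z ∈ φ.target) :
    ContMDiffAt 𝓘(ℝ, CSpace n) 𝓘(ℝ, CSpace n) ∞ φ.symm z :=
  (contMDiffOn_symm_of_mem_maximalAtlas (mem_maximalAtlas_real hφ)).contMDiffAt (φ.open_target.mem_nhds hz)

theorem chartDeriv_comp_chartSymmDeriv (hφ : φ ∈ atlas (CSpace n) M) (hφ' : φ' ∈ atlas (CSpace n) M)
    (hz : z ∈ φ.target) (hz' : φ.symm z ∈ φ'.source) :
    chartDeriv φ' (φ.symm z) ∘L chartSymmDeriv φ z = fderiv ℝ (φ' ∘ φ.symm) z := by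
  rw [← mfderiv_eq_fderiv]
  exact (mfderiv_comp z ((contMDiffAt_chart hφ' hz').mdifferentiableAt (by simp))
    ((contMDiffAt_chart_symm hφ hz).mdifferentiableAt (by simp))).symm

theorem chartDeriv_comp_chartSymmDeriv_self (hφ : φ ∈ atlas (CSpace n) M) (hz : z ∈ φ.target) :
    chartDeriv φ (φ.symm z) ∘L chartSymmDeriv φ z = ContinuousLinearMap.id ℝ _ := by
  rw [chartDeriv_comp_chartSymmDeriv hφ hφ hz (φ.map_target hz)]
  have h : (φ ∘ φ.symm) =ᶠ[𝓝 z] id := φ.eventually_right_inverse hz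
  rw [h.fderiv_eq, fderiv_id]

theorem chartSymmDeriv_comp_chartDeriv_self (hφ : φ ∈ atlas (CSpace n) M) (hx : x ∈ φ.source) :
    chartSymmDeriv φ (φ x) ∘L chartDeriv φ x = ContinuousLinearMap.id ℝ _ := by
  have h : (φ.symm ∘ φ) =ᶠ[𝓝 x] id := φ.eventually_left_inverse hx
  have h2 := mfderiv_comp x ((contMDiffAt_chart_symm hφ (φ.map_source hx)).mdifferentiableAt (by simp))
    ((contMDiffAt_chart hφ hx).mdifferentiableAt (by simp))
  rw [h.mfderiv_eq, mfderiv_id] at h2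
  exact h2.symm

theorem chartDeriv_chartAt (x : M) :
    chartDeriv (chartAt (CSpace n) x) x = ContinuousLinearMap.id ℝ _ := by
  have h := mfderiv_extChartAt_self (I := 𝓘(ℝ, CSpace n)) (x := x)
  simp only [mfld_simps] at h
  exact h

theorem chartSymmDeriv_chartAt (x : M) :
    chartSymmDeriv (chartAt (CSpace n) x) (chartAt (CSpace n) x x) = ContinuousLinearMap.id ℝ _ := by
  have h := chartSymmDeriv_comp_chartDeriv_self (chart_mem_atlas (CSpace n) x) (mem_chart_source _ x)
  rwa [chartDeriv_chartAt, ContinuousLinearMap.comp_id] at h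

/-- Transition maps are biholomorphic. -/
theorem isBiholo_transition (hφ : φ ∈ atlas (CSpace n) M) (hφ' : φ' ∈ atlas (CSpace n) M)
    (hz : z ∈ φ.target) (hz' : φ.symm z ∈ φ'.source) : IsBiholo (φ' ∘ φ.symm) z := by
  have hU : ∀ᶠ y in 𝓝 z, y ∈ φ.target ∧ φ.symm y ∈ φ'.source :=
    (φ.open_target.eventually_mem hz).and
      ((φ.continuousAt_symm hz).eventually (φ'.open_source.eventually_mem hz'))
  have h1 : ContDiffOn ℂ ω (φ' ∘ φ.symm) (φ.symm.trans φ').source := by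
    have h := (contDiffGroupoid ω 𝓘(ℂ, CSpace n)).compatible hφ hφ'
    simpa [contDiffPregroupoid, mfld_simps] using (mem_groupoid_of_pregroupoid.1 h).1
  have h2 : ∀ᶠ y in 𝓝 z, ContDiffAt ℂ ω (φ' ∘ φ.symm) y := by
    filter_upwards [hU] with y hy
    exact h1.contDiffAt ((φ.symm.trans φ').open_source.mem_nhds (by simpa [mfld_simps] using hy))
  refine ⟨⟨h2.mono fun y hy => (hy.restrict_scalars ℝ).of_le le_top, h2.mono fun y hy u => ?_⟩,
    hU.mono fun y hy => ?_⟩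
  · rw [(hy.differentiableAt (by simp)).fderiv_restrictScalars ℝ]
    simp [complexJ_apply]
  · rw [← chartDeriv_comp_chartSymmDeriv hφ hφ' hy.1 hy.2]
    have e1 := chartDeriv_comp_chartSymmDeriv_self hφ hy.1
    have e2 := chartSymmDeriv_comp_chartDeriv_self hφ' hy.2
    have h1 : Function.LeftInverse (chartDeriv φ (φ.symm y)) (chartSymmDeriv φ y) := fun u =>
      congrArg (fun A : CSpace n →L[ℝ] CSpace n => A u) e1
    have h2 : Function.LeftInverse (chartSymmDeriv φ' (φ' (φ.symm y))) (chartDeriv φ' (φ.symm y)) := fun u =>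
      congrArg (fun A : CSpace n →L[ℝ] CSpace n => A u) e2
    exact h2.injective.comp h1.injective

theorem chartDeriv_eq_fderiv (hφ : φ ∈ atlas (CSpace n) M) (hx : x ∈ φ.source) :
    chartDeriv φ x = fderiv ℝ (φ ∘ (chartAt (CSpace n) x).symm) (chartAt (CSpace n) x x) := by
  have hz : chartAt (CSpace n) x x ∈ (chartAt (CSpace n) x).target := mem_chart_target _ x
  have hx0 : (chartAt (CSpace n) x).symm (chartAt (CSpace n) x x) = x :=
    (chartAt (CSpace n) x).left_inv (mem_chart_source _ x)
  rw [← chartDeriv_comp_chartSymmDeriv (chart_mem_atlas _ x) hφ hz (by rwa [hx0]), hx0,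
    chartSymmDeriv_chartAt, ContinuousLinearMap.comp_id]

/-- The coordinate expression, in the chart `φ`, of a field `s` of bilinear forms. -/
def bilinIn (s : M → RealBilin n) (φ : OpenPartialHomeomorph M (CSpace n)) (z : CSpace n) : RealBilin n :=
  (s (φ.symm z)).bilinearComp (chartSymmDeriv φ z) (chartSymmDeriv φ z)

theorem bilinIn_chartAt (s : M → RealBilin n) (x : M) :
    bilinIn s (chartAt (CSpace n) x) (chartAt (CSpace n) x x) = s x := by
  rw [bilinIn, chartSymmDeriv_chartAt, (chartAt (CSpace n) x).left_inv (mem_chart_source _ x)]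
  rfl

/-- Coordinate expressions are pulled back by transition maps. -/
theorem bilinIn_eq_pullMetric (s : M → RealBilin n) (hφ : φ ∈ atlas (CSpace n) M)
    (hφ' : φ' ∈ atlas (CSpace n) M) (hz : z ∈ φ.target) (hz' : φ.symm z ∈ φ'.source) :
    bilinIn s φ =ᶠ[𝓝 z] pullMetric (φ' ∘ φ.symm) (bilinIn s φ') := by
  filter_upwards [(φ.open_target.eventually_mem hz).and
      ((φ.continuousAt_symm hz).eventually (φ'.open_source.eventually_mem hz'))] with y hy
  have e1 : chartSymmDeriv φ' (φ' (φ.symm y)) ∘L fderiv ℝ (φ' ∘ φ.symm) y = chartSymmDeriv φ y := by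
    rw [← chartDeriv_comp_chartSymmDeriv hφ hφ' hy.1 hy.2, ← ContinuousLinearMap.comp_assoc,
      chartSymmDeriv_comp_chartDeriv_self hφ' hy.2, ContinuousLinearMap.id_comp]
  have e2 : ∀ u, chartSymmDeriv φ' (φ' (φ.symm y)) (fderiv ℝ (φ' ∘ φ.symm) y u) = chartSymmDeriv φ y u :=
    fun u => congrArg (fun A => A u) e1
  ext u w
  change s (φ.symm y) (chartSymmDeriv φ y u) (chartSymmDeriv φ y w) =
    s (φ'.symm (φ' (φ.symm y))) (chartSymmDeriv φ' (φ' (φ.symm y)) (fderiv ℝ (φ' ∘ φ.symm) y u))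
      (chartSymmDeriv φ' (φ' (φ.symm y)) (fderiv ℝ (φ' ∘ φ.symm) y w))
  rw [e2, e2, φ'.left_inv hy.2]

/-- A field of bilinear forms is a smooth section if and only if its coordinate expression in the
preferred charts is smooth at the centres of these charts. -/
theorem contMDiffAt_section_iff_bilinIn (s : M → RealBilin n) (x : M) :
    ContMDiffAt 𝓘(ℝ, CSpace n) (𝓘(ℝ, CSpace n).prod 𝓘(ℝ, RealBilin n)) ∞
      (fun y => Bundle.TotalSpace.mk' (RealBilin n)
        (E := fun y : M => TangentSpace 𝓘(ℝ, CSpace n) y →L[ℝ] TangentSpace 𝓘(ℝ, CSpace n) y →L[ℝ] ℝ) y (s y)) x ↔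
      ContDiffAt ℝ ∞ (bilinIn s (chartAt (CSpace n) x)) (chartAt (CSpace n) x x) := by
  set e := chartAt (CSpace n) x with he
  have h1 : ∀ᶠ y in 𝓝 x, ContinuousLinearMap.inCoordinates (CSpace n) (fun y : M => TangentSpace 𝓘(ℝ, CSpace n) y)
      (CSpace n →L[ℝ] ℝ) (fun y : M => TangentSpace 𝓘(ℝ, CSpace n) y →L[ℝ] ℝ) x y x y (s y) = bilinIn s e (e y) := by
    filter_upwards [e.open_source.eventually_mem (mem_chart_source _ x)] with y hy
    have hb : y ∈ (trivializationAt (CSpace n) (fun y : M => TangentSpace 𝓘(ℝ, CSpace n) y) x).baseSet := by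
      simpa [mfld_simps] using hy
    have h2 := TangentBundle.symmL_trivializationAt (I := 𝓘(ℝ, CSpace n)) (x₀ := x) (x := y) hy
    ext u w
    have h3 := inCoordinates_apply_eq₂ (F₁ := CSpace n) (F₂ := CSpace n) (F₃ := ℝ) (𝕜 := ℝ)
      (E₁ := fun y : M => TangentSpace 𝓘(ℝ, CSpace n) y) (E₂ := fun y : M => TangentSpace 𝓘(ℝ, CSpace n) y)
      (E₃ := fun _ : M => ℝ) (x₀ := x) (x := y) (ϕ := s y) (v := u) (w := w) hb hb (Set.mem_univ _)
    refine h3.trans ?_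
    have h4 : ∀ u : CSpace n, (trivializationAt (CSpace n) (fun y : M => TangentSpace 𝓘(ℝ, CSpace n) y) x).symm y u
        = chartSymmDeriv e (e y) u := fun u => by
      have := congrArg (fun A => A u) h2
      simp only [mfld_simps, mfderivWithin_univ] at this
      exact ((trivializationAt (CSpace n) (TangentSpace 𝓘(ℝ, CSpace n)) x).symmL_apply (R := ℝ) hb u).symm.trans this
    rw [h4, h4, bilinIn, e.left_inv hy]
    simp
    rfl
  refine (contMDiffAt_hom_bundle _).trans ((and_iff_right contMDiffAt_id).trans ?_)
  have hx : e.symm (e x) = x := e.left_inv (mem_chart_source _ x)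
  have hchart : e ∈ atlas (CSpace n) M := chart_mem_atlas _ x
  constructor
  · intro h
    have h2 : ContMDiffAt 𝓘(ℝ, CSpace n) 𝓘(ℝ, RealBilin n) ∞ (fun y => bilinIn s e (e y)) x :=
      ContMDiffAt.congr_of_eventuallyEq h (h1.mono fun y hy => hy.symm)
    rw [← contMDiffAt_iff_contDiffAt]
    have h3 : ContMDiffAt 𝓘(ℝ, CSpace n) 𝓘(ℝ, RealBilin n) ∞ (fun z => bilinIn s e (e (e.symm z))) (e x) :=
      ContMDiffAt.comp (g := fun y => bilinIn s e (e y)) (e x) (by rwa [hx])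
        (contMDiffAt_chart_symm hchart (mem_chart_target _ x))
    refine h3.congr_of_eventuallyEq ?_
    filter_upwards [e.open_target.eventually_mem (mem_chart_target _ x)] with y hy
    rw [e.right_inv hy]
  · intro h
    have h2 : ContMDiffAt 𝓘(ℝ, CSpace n) 𝓘(ℝ, RealBilin n) ∞ (fun y => bilinIn s e (e y)) x :=
      ContMDiffAt.comp (g := bilinIn s e) x (contMDiffAt_iff_contDiffAt.2 h) (contMDiffAt_chart hchart (mem_chart_source _ x))
    exact h2.congr_of_eventuallyEq h1

/-- The coordinate expression of a smooth field of bilinear forms is smooth in every chart. -/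
theorem contDiffAt_bilinIn {s : M → RealBilin n}
    (hs : ∀ x, ContDiffAt ℝ ∞ (bilinIn s (chartAt (CSpace n) x)) (chartAt (CSpace n) x x))
    (hφ : φ ∈ atlas (CSpace n) M) (hz : z ∈ φ.target) : ContDiffAt ℝ ∞ (bilinIn s φ) z := by
  have hc := mem_chart_source (CSpace n) (φ.symm z)
  exact (contDiffAt_pullMetric (isBiholo_transition hφ (chart_mem_atlas _ _) hz hc).smooth
    (hs (φ.symm z))).congr_of_eventuallyEq (bilinIn_eq_pullMetric s hφ (chart_mem_atlas _ _) hz hc)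

theorem chartDeriv_complexJ (hφ : φ ∈ atlas (CSpace n) M) (hx : x ∈ φ.source) (u : CSpace n) :
    chartDeriv φ x (complexJ n u) = complexJ n (chartDeriv φ x u) := by
  rw [chartDeriv_eq_fderiv hφ hx]
  refine (isBiholo_transition (chart_mem_atlas _ x) hφ (mem_chart_target _ x) ?_).commute.self_of_nhds u
  rwa [(chartAt (CSpace n) x).left_inv (mem_chart_source _ x)]

theorem chartDeriv_chartSymmDeriv_apply (hφ : φ ∈ atlas (CSpace n) M) (hz : z ∈ φ.target) (u : CSpace n) :
    chartDeriv φ (φ.symm z) (chartSymmDeriv φ z u) = u :=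
  congrArg (fun A : CSpace n →L[ℝ] CSpace n => A u) (chartDeriv_comp_chartSymmDeriv_self hφ hz)

theorem chartSymmDeriv_chartDeriv_apply (hφ : φ ∈ atlas (CSpace n) M) (hz : z ∈ φ.target) (u : CSpace n) :
    chartSymmDeriv φ z (chartDeriv φ (φ.symm z) u) = u := by
  have h := congrArg (fun A : CSpace n →L[ℝ] CSpace n => A u)
    (chartSymmDeriv_comp_chartDeriv_self hφ (φ.map_target hz))
  rw [φ.right_inv hz] at h
  exact h

theorem chartSymmDeriv_complexJ (hφ : φ ∈ atlas (CSpace n) M) (hz : z ∈ φ.target) (u : CSpace n) :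
    chartSymmDeriv φ z (complexJ n u) = complexJ n (chartSymmDeriv φ z u) := by
  have h := chartDeriv_complexJ hφ (φ.map_target hz) (chartSymmDeriv φ z u)
  rw [chartDeriv_chartSymmDeriv_apply hφ hz] at h
  rw [← h, chartSymmDeriv_chartDeriv_apply hφ hz]

theorem isHermitianAt_bilinIn {s : M → RealBilin n}
    (hs : ∀ x, ContDiffAt ℝ ∞ (bilinIn s (chartAt (CSpace n) x)) (chartAt (CSpace n) x x))
    (hsymm : ∀ x u w, s x u w = s x w u) (hpos : ∀ x u, u ≠ 0 → 0 < s x u u)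
    (hJ : ∀ x u w, s x (complexJ n u) (complexJ n w) = s x u w)
    (hφ : φ ∈ atlas (CSpace n) M) (hz : z ∈ φ.target) : IsHermitianAt (bilinIn s φ) z where
  smooth := contDiffAt_bilinIn hs hφ hz
  symm := Eventually.of_forall fun y u w => hsymm _ _ _
  pos := by
    filter_upwards [φ.open_target.eventually_mem hz] with y hy u hu
    refine hpos _ _ fun h => hu ?_
    exact (chartDeriv_chartSymmDeriv_apply hφ hy u).symm.trans
      ((congrArg (chartDeriv φ (φ.symm y)) h).trans (map_zero _))
  invariant := by
    filter_upwards [φ.open_target.eventually_mem hz] with y hy u w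
    change s _ (chartSymmDeriv φ y _) (chartSymmDeriv φ y _) = s _ (chartSymmDeriv φ y _) (chartSymmDeriv φ y _)
    rw [chartSymmDeriv_complexJ hφ hy, chartSymmDeriv_complexJ hφ hy, hJ]

theorem contDiffAt_metricAt (g : RMetric n M) (x : M) :
    ContDiffAt ℝ ∞ (bilinIn (metricAt g) (chartAt (CSpace n) x)) (chartAt (CSpace n) x x) :=
  (contMDiffAt_section_iff_bilinIn (metricAt g) x).1 (g.contMDiff x)

theorem isHermitianAt_metricIn (g : HermitianMetric n M) (hφ : φ ∈ atlas (CSpace n) M) (hz : z ∈ φ.target) :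
    IsHermitianAt (metricIn g.metric φ) z :=
  isHermitianAt_bilinIn (s := metricAt g.metric) (contDiffAt_metricAt g.metric) (fun x u w => g.metric.symm x u w)
    (fun x u hu => g.metric.pos x u hu) g.invariant hφ hz

end Charts

/-! ### The induced Hermitian metric -/

section Induced

open Filter Topology
open scoped ComplexOrder

/-- A continuous family of positive definite forms is uniformly positive definite on compact sets. -/
theorem exists_pos_forall_mul_norm_sq_le {X E : Type*} [TopologicalSpace X] [NormedAddCommGroup E]
    [NormedSpace ℝ E] [FiniteDimensional ℝ E] {B : X → E →L[ℝ] E →L[ℝ] ℝ} {K : Set X} (hK : IsCompact K)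
    (hB : ∀ u w, ContinuousOn (fun x => B x u w) K) (hpos : ∀ x ∈ K, ∀ u, u ≠ 0 → 0 < B x u u) :
    ∃ c : ℝ, 0 < c ∧ ∀ x ∈ K, ∀ u, c * ‖u‖ ^ 2 ≤ B x u u := by
  have := FiniteDimensional.proper ℝ E
  have hc : ContinuousOn (fun q : X × E => B q.1 q.2 q.2) (K ×ˢ Metric.sphere (0 : E) 1) := by
    have h1 : ContinuousOn B K :=
      continuousOn_clm_apply.2 fun u => continuousOn_clm_apply.2 fun w => hB u w
    have h2 : ContinuousOn (fun q : X × E => B q.1) (K ×ˢ Metric.sphere (0 : E) 1) :=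
      h1.comp continuousOn_fst fun q hq => hq.1
    exact (h2.clm_apply continuousOn_snd).clm_apply continuousOn_snd
  have hpos' : ∀ q ∈ K ×ˢ Metric.sphere (0 : E) 1, 0 < B q.1 q.2 q.2 := fun q hq =>
    hpos q.1 hq.1 q.2 (ne_zero_of_mem_unit_sphere ⟨q.2, hq.2⟩)
  obtain ⟨c, hc0, hcK⟩ : ∃ c : ℝ, 0 < c ∧ ∀ q ∈ K ×ˢ Metric.sphere (0 : E) 1, c ≤ B q.1 q.2 q.2 := by
    rcases (K ×ˢ Metric.sphere (0 : E) 1).eq_empty_or_nonempty with h | h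
    · exact ⟨1, one_pos, fun q hq => by simp [h] at hq⟩
    · obtain ⟨q, hq, hmin⟩ := (hK.prod (isCompact_sphere 0 1)).exists_isMinOn h hc
      exact ⟨_, hpos' q hq, fun q' hq' => hmin hq'⟩
  refine ⟨c, hc0, fun x hx u => ?_⟩
  rcases eq_or_ne u 0 with rfl | hu
  · simp
  have hn : ‖u‖ ≠ 0 := norm_ne_zero_iff.2 hu
  have h := hcK (x, ‖u‖⁻¹ • u) ⟨hx, by simp [norm_smul, hn]⟩
  simp only [map_smul, smul_apply, smul_eq_mul] at h
  calc c * ‖u‖ ^ 2 ≤ (‖u‖⁻¹ * (‖u‖⁻¹ * B x u u)) * ‖u‖ ^ 2 := by gcongr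
    _ = B x u u := by field_simp

theorem wirt_congr {n : ℕ} {f f' : CSpace n → ℂ} {z : CSpace n} (h : f =ᶠ[𝓝 z] f') (r : Fin n) :
    wirt r f z = wirt r f' z := by
  rw [wirt, wirt, h.fderiv_eq]

theorem wirtBar_congr {n : ℕ} {f f' : CSpace n → ℂ} {z : CSpace n} (h : f =ᶠ[𝓝 z] f') (r : Fin n) :
    wirtBar r f z = wirtBar r f' z := by
  rw [wirtBar, wirtBar, h.fderiv_eq]

theorem chernScalarLocal_congr {n : ℕ} {G G' : CSpace n → RealBilin n} {z : CSpace n} (h : G =ᶠ[𝓝 z] G') :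
    chernScalarLocal G z = chernScalarLocal G' z := by
  have h1 : ∀ i k l, chernGamma G i k l =ᶠ[𝓝 z] chernGamma G' i k l := fun i k l => by
    filter_upwards [h.eventuallyEq_nhds] with y hy
    rw [chernGamma, chernGamma, hy.self_of_nhds]
    refine Finset.sum_congr rfl fun q _ => ?_
    have h2 : (fun w => hermMatrix (G w) k q) =ᶠ[𝓝 y] fun w => hermMatrix (G' w) k q :=
      hy.mono fun w hw => congrArg (fun B => hermMatrix B k q) hw
    rw [wirt_congr h2]
  have h2 : ∀ i j k, chernCurv G i j k k z = chernCurv G' i j k k z := fun i j k => by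
    rw [chernCurv, chernCurv, wirtBar_congr (h1 i k k)]
  simp only [chernScalarLocal, h.self_of_nhds, h2]

variable {m : ℕ} {M : Type*} [TopologicalSpace M] [ChartedSpace (CSpace (m + 2)) M]
  [IsManifold 𝓘(ℂ, CSpace (m + 2)) ω M] {φ : OpenPartialHomeomorph M (CSpace (m + 2))}
  {g : HermitianMetric (m + 2) M} {v : M → ℝ} {x : M} {z : CSpace (m + 2)}

theorem perturbedForm_eq_localPerturbed (g : HermitianMetric (m + 2) M) (v : M → ℝ) (x : M) :
    perturbedForm g v x = localPerturbed (metricIn g.metric (chartAt (CSpace (m + 2)) x))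
      (v ∘ (chartAt (CSpace (m + 2)) x).symm) (chartAt (CSpace (m + 2)) x x) := by
  have h : metricIn g.metric (chartAt (CSpace (m + 2)) x) (chartAt (CSpace (m + 2)) x x) =
      metricAt g.metric x := bilinIn_chartAt (metricAt g.metric) x
  rw [localPerturbed, h]
  rfl

theorem contDiffAt_comp_chart_symm (hφ : φ ∈ atlas (CSpace (m + 2)) M) (hz : z ∈ φ.target)
    (hv : ContMDiffAt 𝓘(ℝ, CSpace (m + 2)) 𝓘(ℝ) ∞ v (φ.symm z)) : ContDiffAt ℝ ∞ (v ∘ φ.symm) z :=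
  contMDiffAt_iff_contDiffAt.1 (hv.comp z (contMDiffAt_chart_symm hφ hz))

/-- The coordinate expression of `ω^{n-1} + i∂∂̄(v ω^{n-2})` in an arbitrary chart. -/
theorem localPerturbed_metricIn (hφ : φ ∈ atlas (CSpace (m + 2)) M) (hz : z ∈ φ.target)
    (hv : ContMDiffAt 𝓘(ℝ, CSpace (m + 2)) 𝓘(ℝ) ∞ v (φ.symm z)) :
    localPerturbed (metricIn g.metric φ) (v ∘ φ.symm) z =
      (perturbedForm g v (φ.symm z)).compContinuousLinearMap (chartSymmDeriv φ z) := by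
  set p := φ.symm z with hp
  set e := chartAt (CSpace (m + 2)) p with he
  have hc : p ∈ e.source := mem_chart_source (CSpace (m + 2)) p
  have heA : e ∈ atlas (CSpace (m + 2)) M := chart_mem_atlas _ p
  have hF : IsBiholo (e ∘ φ.symm) z := isBiholo_transition hφ heA hz hc
  have h1 : metricIn g.metric φ =ᶠ[𝓝 z] pullMetric (e ∘ φ.symm) (metricIn g.metric e) :=
    bilinIn_eq_pullMetric (metricAt g.metric) hφ heA hz hc
  have h2 : v ∘ φ.symm =ᶠ[𝓝 z] fun y => (v ∘ e.symm) ((e ∘ φ.symm) y) := by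
    filter_upwards [(φ.continuousAt_symm hz).eventually (e.open_source.eventually_mem hc)] with y hy
    simp only [Function.comp_apply]
    rw [e.left_inv hy]
  have hG : ContDiffAt ℝ ∞ (metricIn g.metric e) ((e ∘ φ.symm) z) :=
    (isHermitianAt_metricIn g heA (e.map_source hc)).smooth
  have hu : ContDiffAt ℝ ∞ (v ∘ e.symm) ((e ∘ φ.symm) z) :=
    contDiffAt_comp_chart_symm heA (e.map_source hc) (by
      change ContMDiffAt _ _ _ v (e.symm (e p))
      rwa [e.left_inv hc])
  have h3 := localPerturbed_pull hF.toIsHolo (hG.of_le ENat.LEInfty.out) (hu.of_le ENat.LEInfty.out)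
  have h4 : fderiv ℝ (e ∘ φ.symm) z = chartSymmDeriv φ z := by
    have h5 : chartDeriv e (φ.symm z) = ContinuousLinearMap.id ℝ _ := chartDeriv_chartAt p
    rw [← chartDeriv_comp_chartSymmDeriv hφ heA hz hc, h5]
    rfl
  rw [localPerturbed_congr h1 h2, h3, h4, perturbedForm_eq_localPerturbed]
  rfl

theorem complexMatrix_chartSymmDeriv_det_ne_zero (hφ : φ ∈ atlas (CSpace (m + 2)) M) (hz : z ∈ φ.target) :
    (complexMatrix (chartSymmDeriv φ z)).det ≠ 0 :=
  complexMatrix_det_ne_zero_of_injective (chartSymmDeriv_complexJ hφ hz)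
    (Function.LeftInverse.injective (g := chartDeriv φ (φ.symm z)) (chartDeriv_chartSymmDeriv_apply hφ hz))

theorem IsPositiveForm.det_re_pos {p : ℕ} {Φ : CForm (p + 1) (2 * p)} (h : IsPositiveForm Φ) :
    0 < (cofMatrix Φ).det.re :=
  (Complex.pos_iff.1 (cofMatrix_posDef h).det_pos).1

/-- The coordinate expression of the metric `ω_v` in an arbitrary chart. -/
theorem bilinIn_rootForm (hv : v ∈ admissibleFunctions g) (hφ : φ ∈ atlas (CSpace (m + 2)) M) (hz : z ∈ φ.target) :
    bilinIn (fun x => rootForm (perturbedForm g v x)) φ z =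
      rootForm (localPerturbed (metricIn g.metric φ) (v ∘ φ.symm) z) := by
  rw [localPerturbed_metricIn hφ hz (hv.1 _)]
  exact (rootForm_comp (Nat.succ_ne_zero m) (hv.2 (φ.symm z)).det_re_pos (chartSymmDeriv_complexJ hφ hz)
    (complexMatrix_chartSymmDeriv_det_ne_zero hφ hz)).symm

theorem det_localPerturbed_pos (hv : v ∈ admissibleFunctions g) (x : M) :
    0 < (cofMatrix (localPerturbed (metricIn g.metric (chartAt (CSpace (m + 2)) x))
      (v ∘ (chartAt (CSpace (m + 2)) x).symm) (chartAt (CSpace (m + 2)) x x))).det.re := by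
  have h := (hv.2 x).det_re_pos
  rwa [perturbedForm_eq_localPerturbed] at h

theorem contDiffAt_chart_localPerturbed (hv : v ∈ admissibleFunctions g) (x : M) :
    ContDiffAt ℝ ∞ (localPerturbed (metricIn g.metric (chartAt (CSpace (m + 2)) x))
      (v ∘ (chartAt (CSpace (m + 2)) x).symm)) (chartAt (CSpace (m + 2)) x x) :=
  contDiffAt_localPerturbed
    (isHermitianAt_metricIn g (chart_mem_atlas _ x) (mem_chart_target _ x)).smooth
    (contDiffAt_comp_chart_symm (chart_mem_atlas _ x) (mem_chart_target _ x) (hv.1 _))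

theorem bilinIn_rootForm_eventually (hv : v ∈ admissibleFunctions g) (x : M) :
    bilinIn (fun x => rootForm (perturbedForm g v x)) (chartAt (CSpace (m + 2)) x)
      =ᶠ[𝓝 (chartAt (CSpace (m + 2)) x x)]
      fun y => rootForm (localPerturbed (metricIn g.metric (chartAt (CSpace (m + 2)) x))
        (v ∘ (chartAt (CSpace (m + 2)) x).symm) y) := by
  filter_upwards [(chartAt (CSpace (m + 2)) x).open_target.eventually_mem (mem_chart_target _ x)] with y hy
  exact bilinIn_rootForm hv (chart_mem_atlas _ x) hy

theorem contDiffAt_bilinIn_rootForm (hv : v ∈ admissibleFunctions g) (x : M) :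
    ContDiffAt ℝ ∞ (bilinIn (fun x => rootForm (perturbedForm g v x)) (chartAt (CSpace (m + 2)) x))
      (chartAt (CSpace (m + 2)) x x) :=
  ContDiffAt.congr_of_eventuallyEq (contDiffAt_rootForm (contDiffAt_chart_localPerturbed hv x)
    (det_localPerturbed_pos hv x)) (bilinIn_rootForm_eventually hv x)

theorem isVonNBounded_of_pos {n : ℕ} {G : RealBilin n} (hG : ∀ u, u ≠ 0 → 0 < G u u) :
    Bornology.IsVonNBounded ℝ {u : CSpace n | G u u < 1} := by
  obtain ⟨c, hc, h⟩ := exists_pos_forall_mul_norm_sq_le (X := Unit) (B := fun _ => G) isCompact_univ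
    (fun u w => continuousOn_const) fun _ _ => hG
  refine (NormedSpace.isVonNBounded_iff ℝ).2 ((Metric.isBounded_closedBall (x := 0) (r := 1 + c⁻¹)).subset ?_)
  intro u hu
  have h1 : c * ‖u‖ ^ 2 < 1 := (h () trivial u).trans_lt hu
  have h2 : ‖u‖ ^ 2 < c⁻¹ := by rwa [inv_eq_one_div, lt_div_iff₀' hc]
  simp only [Metric.mem_closedBall, dist_zero_right]
  nlinarith [sq_nonneg (‖u‖ - 1)]

/-- The Hermitian metric `ω_v`, obtained from `rootForm` at each point. -/
def rootMetric (g : HermitianMetric (m + 2) M) (v : M → ℝ) (hv : v ∈ admissibleFunctions g) :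
    HermitianMetric (m + 2) M where
  metric :=
    { inner := fun x => rootForm (perturbedForm g v x)
      symm := fun x => matrixBilin_symm (rootMatrix_posDef (cofMatrix_posDef (hv.2 x))).isHermitian
      pos := fun x _ hu => matrixBilin_pos (rootMatrix_posDef (cofMatrix_posDef (hv.2 x))) hu
      isVonNBounded := fun x => isVonNBounded_of_pos fun _ hu =>
        matrixBilin_pos (rootMatrix_posDef (cofMatrix_posDef (hv.2 x))) hu
      contMDiff := fun x => (contMDiffAt_section_iff_bilinIn _ x).2 (contDiffAt_bilinIn_rootForm hv x) }
  invariant := fun _ => matrixBilin_invariant _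

/-- The root exists because the form `ω^{n-1} + i∂∂̄(v ω^{n-2})` is real and invariant under the complex structure. -/
theorem isInducedMetric_rootMetric (hv : v ∈ admissibleFunctions g) : IsInducedMetric g v (rootMetric g v hv) := by
  intro x
  have hG := isHermitianAt_metricIn g (chart_mem_atlas _ x) (mem_chart_target _ x)
  have hu := contDiffAt_comp_chart_symm (chart_mem_atlas _ x) (mem_chart_target _ x) (hv.1 _)
  refine fundPow_rootForm (Nat.succ_ne_zero m) ?_ ?_ (cofMatrix_posDef (hv.2 x))
  · rw [perturbedForm_eq_localPerturbed]
    exact localPerturbed_im (hG.smooth.of_le ENat.LEInfty.out) (hu.of_le ENat.LEInfty.out)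
  · rw [perturbedForm_eq_localPerturbed]
    exact localPerturbed_compJ (hG.smooth.of_le ENat.LEInfty.out) (hu.of_le ENat.LEInfty.out) hG.invariant

theorem IsInducedMetric.metricAt_eq {h : HermitianMetric (m + 2) M} (hh : IsInducedMetric g v h) :
    metricAt h.metric = fun x => rootForm (perturbedForm g v x) := by
  funext x
  rw [← hh x]
  exact (rootForm_fundPow (Nat.succ_ne_zero m) (fun u w => h.metric.symm x u w) (h.invariant x)
    fun u hu => h.metric.pos x u hu).symm

/-- A Hermitian metric is determined by its inner products. -/
theorem hermitianMetric_ext {n : ℕ} {M : Type*} [TopologicalSpace M] [ChartedSpace (CSpace n) M]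
    [IsManifold 𝓘(ℂ, CSpace n) ω M] {h h' : HermitianMetric n M} (e : metricAt h.metric = metricAt h'.metric) :
    h = h' := by
  obtain ⟨⟨i, _, _, _, _⟩, _⟩ := h
  obtain ⟨⟨i', _, _, _, _⟩, _⟩ := h'
  obtain rfl : i = i' := e
  rfl

theorem existsUnique_isInducedMetric (hv : v ∈ admissibleFunctions g) :
    ∃! h : HermitianMetric (m + 2) M, IsInducedMetric g v h :=
  ⟨rootMetric g v hv, isInducedMetric_rootMetric hv, fun _ hh =>
    hermitianMetric_ext (hh.metricAt_eq.trans (isInducedMetric_rootMetric hv).metricAt_eq.symm)⟩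

/-- The Chern scalar curvature of `ω_v` is a scalar expression in the form `ω^{n-1} + i∂∂̄(v ω^{n-2})`. -/
theorem scalarOperator_eq_rootScalar (hv : v ∈ admissibleFunctions g) (x : M) :
    scalarOperator g v x = rootScalar (localPerturbed (metricIn g.metric (chartAt (CSpace (m + 2)) x))
      (v ∘ (chartAt (CSpace (m + 2)) x).symm)) (chartAt (CSpace (m + 2)) x x) := by
  have hex : ∃ h : HermitianMetric (m + 2) M, IsInducedMetric g v h := (existsUnique_isInducedMetric hv).exists
  have h1 : IsInducedMetric g v (inducedMetric g v) := by
    rw [inducedMetric, dif_pos hex]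
    exact hex.choose_spec
  have h2 : metricIn (inducedMetric g v).metric (chartAt (CSpace (m + 2)) x) =
      bilinIn (fun x => rootForm (perturbedForm g v x)) (chartAt (CSpace (m + 2)) x) := by
    rw [← h1.metricAt_eq]
    rfl
  rw [scalarOperator, chernScalar, h2, chernScalarLocal_congr (bilinIn_rootForm_eventually hv x)]
  exact chernScalarLocal_rootForm (Nat.succ_ne_zero m) (contDiffAt_chart_localPerturbed hv x)
    (det_localPerturbed_pos hv x)

end Induced

/-! ### The coefficients of the scalar curvature operator -/

section Coefficients

open Filter Topology
open scoped ComplexOrder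

section Congruence

variable {n N m : ℕ}

theorem jetPoly_congr {G G' : CSpace n → RealBilin n} {z : CSpace n} (h : G =ᶠ[𝓝 z] G') (ψ : JetTuple n N) (k : ℕ) :
    jetPoly G z ψ k = jetPoly G' z ψ k := by
  induction k with
  | zero => rfl
  | succ k ih =>
    funext y
    rw [jetPoly, jetPoly, ih, (iterCovDeriv_congr h EventuallyEq.rfl k).self_of_nhds]

variable {G G' : CSpace (m + 1 + 1) → RealBilin (m + 1 + 1)} {z : CSpace (m + 1 + 1)}

theorem localPerturbed_eventuallyEq (h : G =ᶠ[𝓝 z] G') (u : CSpace (m + 1 + 1) → ℝ) :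
    localPerturbed G u =ᶠ[𝓝 z] localPerturbed G' u :=
  h.eventuallyEq_nhds.mono fun _ hy => localPerturbed_congr hy EventuallyEq.rfl

theorem jetForm_congr (h : G =ᶠ[𝓝 z] G') (ψ : JetTuple (m + 1 + 1) (2 * 2)) : jetForm G z ψ = jetForm G' z ψ := by
  rw [jetForm, jetForm, jetPoly_congr h, localPerturbed_congr h EventuallyEq.rfl]

theorem lowerOrder_congr (h : G =ᶠ[𝓝 z] G') (u : CSpace (m + 1 + 1) → ℝ) : lowerOrder G u z = lowerOrder G' u z := by
  have h1 := localPerturbed_eventuallyEq h u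
  rw [lowerOrder, lowerOrder, rootScalar_congr h1, h1.self_of_nhds, h.self_of_nhds,
    (iterCovDeriv_congr h EventuallyEq.rfl _).self_of_nhds]

theorem jetLower_congr (h : G =ᶠ[𝓝 z] G') (ψ : JetTuple (m + 1 + 1) (2 * 2)) : jetLower G z ψ = jetLower G' z ψ := by
  rw [jetLower, jetLower, jetPoly_congr h, lowerOrder_congr h]

end Congruence

variable {m : ℕ} {M : Type*} [TopologicalSpace M] [ChartedSpace (CSpace (m + 2)) M]
  [IsManifold 𝓘(ℂ, CSpace (m + 2)) ω M] {φ : OpenPartialHomeomorph M (CSpace (m + 2))}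
  {g : HermitianMetric (m + 2) M} {v : M → ℝ} {x : M} {z : CSpace (m + 2)} {ψ : JetTuple (m + 2) (2 * 2)}

/-- The value at `x` of `ω^{n-1} + i∂∂̄(v ω^{n-2})` for functions with the jet `ψ` at `x`. -/
def formOfJet (g : HermitianMetric (m + 2) M) (x : M) (ψ : JetTuple (m + 2) (2 * 2)) :
    CForm (m + 2) (2 * (m + 1)) :=
  jetForm (metricIn g.metric (chartAt (CSpace (m + 2)) x)) (chartAt (CSpace (m + 2)) x x) ψ

/-- The tensors `E₁` and `E₂`. -/
def symbolAt (g : HermitianMetric (m + 2) M) (k : Fin 2) (x : M) (ψ : JetTuple (m + 2) (2 * 2)) : ContraTwo (m + 2) :=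
  symbols (metricAt g.metric x) (formOfJet g x ψ) k

/-- The function `b`. -/
def lowerAt (g : HermitianMetric (m + 2) M) (x : M) (ψ : JetTuple (m + 2) (2 * 2)) : ℝ :=
  jetLower (metricIn g.metric (chartAt (CSpace (m + 2)) x)) (chartAt (CSpace (m + 2)) x x) ψ

theorem jetComp_jetAt (g : HermitianMetric (m + 2) M) (v : M → ℝ) (x : M) {k : ℕ} (hk : k < 2 * 2) :
    jetComp (m + 2) (2 * 2) k (jetAt g.metric (2 * 2) v x) = covDerivAt g.metric v k x :=
  jetComp_apply (jetAt g.metric (2 * 2) v x) ⟨k, hk⟩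

theorem perturbedForm_eq_formOfJet (hv : ContMDiffAt 𝓘(ℝ, CSpace (m + 2)) 𝓘(ℝ) ∞ v x)
    (h : ∀ k < 3, ∀ a, covDerivAt g.metric v k x (fun _ => a) = jetComp _ _ k ψ fun _ => a) :
    perturbedForm g v x = formOfJet g x ψ := by
  rw [perturbedForm_eq_localPerturbed]
  refine localPerturbed_eq_jetForm (isHermitianAt_metricIn g (chart_mem_atlas _ x) (mem_chart_target _ x))
    (contDiffAt_comp_chart_symm (chart_mem_atlas _ x) (mem_chart_target _ x) ?_) h
  rwa [(chartAt (CSpace (m + 2)) x).left_inv (mem_chart_source _ x)]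

/-- Only the diagonal of `ψ 2` enters, and it is the diagonal of the Hessian of an admissible function. -/
theorem posDef_formOfJet (hψ : ψ ∈ admissibleJets g x) : (cofMatrix (formOfJet g x ψ)).PosDef := by
  obtain ⟨u, hu, hpos, h0, h1, h2⟩ := hψ
  rw [← perturbedForm_eq_formOfJet hu]
  · exact cofMatrix_posDef hpos
  · intro k hk a
    interval_cases k
    · have h5 : jetComp (m + 2) (2 * 2) 0 ψ = ψ 0 := jetComp_apply ψ 0
      rw [h5, h0]
    · have h5 : jetComp (m + 2) (2 * 2) 1 ψ = ψ 1 := jetComp_apply ψ 1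
      rw [h5, h1]
    · have h3 := h2 a a
      have h4 : (![a, a] : Fin 2 → CSpace (m + 2)) = fun _ => a := by
        funext i
        fin_cases i <;> rfl
      have h5 : jetComp (m + 2) (2 * 2) 2 ψ = ψ 2 := jetComp_apply ψ 2
      rw [h5, ← h4, h3]
      ring

theorem jetAt_mem_admissibleJets (hv : v ∈ admissibleFunctions g) (x : M) :
    jetAt g.metric (2 * 2) v x ∈ admissibleJets g x := by
  refine ⟨v, hv.1 x, hv.2 x, rfl, rfl, fun a b => ?_⟩
  have h := iterCovDeriv_two_symm (isHermitianAt_metricIn g (chart_mem_atlas _ x) (mem_chart_target _ x))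
    (contDiffAt_comp_chart_symm (chart_mem_atlas _ x) (mem_chart_target _ x) (hv.1 _)) a b
  change covDerivAt g.metric v 2 x ![a, b] =
    (1 / 2) * (covDerivAt g.metric v 2 x ![a, b] + covDerivAt g.metric v 2 x ![b, a])
  have h' : covDerivAt g.metric v 2 x ![a, b] = covDerivAt g.metric v 2 x ![b, a] := h
  rw [h']
  ring

/-- The curvature is `-E₁ E₂ ∇⁴v + b` by the definition of `lowerOrder`. -/
theorem scalarOperator_eq (hv : v ∈ admissibleFunctions g) (x : M) :
    scalarOperator g v x = (-1) ^ (2 - 1) *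
      contract (fun k => symbolAt g k x (jetAt g.metric (2 * 2) v x)) (covDerivAt g.metric v (2 * 2) x) +
        lowerAt g x (jetAt g.metric (2 * 2) v x) := by
  have hG := isHermitianAt_metricIn g (chart_mem_atlas _ x) (mem_chart_target _ x)
  have hu := contDiffAt_comp_chart_symm (chart_mem_atlas _ x) (mem_chart_target _ x) (hv.1 _)
  have hjet : ∀ k < 4, ∀ a, covDerivAt g.metric v k x (fun _ => a) =
      jetComp _ _ k (jetAt g.metric (2 * 2) v x) fun _ => a := fun k hk a => by rw [jetComp_jetAt g v x hk]
  have h1 : perturbedForm g v x = formOfJet g x (jetAt g.metric (2 * 2) v x) :=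
    perturbedForm_eq_formOfJet (hv.1 x) fun k hk => hjet k (hk.trans (by norm_num))
  have hpos : 0 < (cofMatrix (formOfJet g x (jetAt g.metric (2 * 2) v x))).det.re := by
    rw [← h1]
    exact (hv.2 x).det_re_pos
  have h2 := lowerOrder_eq_jetLower hG hu hjet hpos
  have h3 : metricIn g.metric (chartAt (CSpace (m + 2)) x) (chartAt (CSpace (m + 2)) x x) =
      metricAt g.metric x := bilinIn_chartAt (metricAt g.metric) x
  rw [lowerOrder, h3, ← perturbedForm_eq_localPerturbed, ← scalarOperator_eq_rootScalar hv, h1] at h2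
  have h4 : scalarOperator g v x + contract (fun k => symbolAt g k x (jetAt g.metric (2 * 2) v x))
      (covDerivAt g.metric v (2 * 2) x) = lowerAt g x (jetAt g.metric (2 * 2) v x) := h2
  rw [← h4]
  norm_num

/-- The form `formOfJet` and the function `lowerAt` in an arbitrary chart; the transition to the preferred chart at the
point is biholomorphic. -/
theorem formOfJet_pullback (hφ : φ ∈ atlas (CSpace (m + 2)) M) (hz : z ∈ φ.target) (ψ : JetTuple (m + 2) (2 * 2)) :
    formOfJet g (φ.symm z) (ψ.pullback (chartDeriv φ (φ.symm z))) =
        (jetForm (metricIn g.metric φ) z ψ).compContinuousLinearMap (chartDeriv φ (φ.symm z)) ∧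
      (0 < (cofMatrix (jetForm (metricIn g.metric φ) z ψ)).det.re →
        lowerAt g (φ.symm z) (ψ.pullback (chartDeriv φ (φ.symm z))) = jetLower (metricIn g.metric φ) z ψ) := by
  set p := φ.symm z with hp
  set e := chartAt (CSpace (m + 2)) p with he
  have heA : e ∈ atlas (CSpace (m + 2)) M := chart_mem_atlas _ p
  have hpe : p ∈ e.source := mem_chart_source _ p
  have hpφ : p ∈ φ.source := φ.map_target hz
  have hep : e.symm (e p) = p := e.left_inv hpe
  have hep' : e.symm (e p) ∈ φ.source := by rwa [hep]
  have hF : IsBiholo (φ ∘ e.symm) (e p) := isBiholo_transition heA hφ (e.map_source hpe) hep'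
  have hFz : (φ ∘ e.symm) (e p) = z := by
    rw [Function.comp_apply, hep, hp, φ.right_inv hz]
  have hG : IsHermitianAt (metricIn g.metric φ) ((φ ∘ e.symm) (e p)) := by
    rw [hFz]
    exact isHermitianAt_metricIn g hφ hz
  have hD : chartDeriv φ p = fderiv ℝ (φ ∘ e.symm) (e p) := chartDeriv_eq_fderiv hφ hpφ
  have h1 : metricIn g.metric e =ᶠ[𝓝 (e p)] pullMetric (φ ∘ e.symm) (metricIn g.metric φ) :=
    bilinIn_eq_pullMetric (metricAt g.metric) heA hφ (e.map_source hpe) hep'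
  have h2 := jetForm_pull hF hG ψ
  have h3 := jetLower_pull (ψ := ψ) hF hG
  rw [← jetForm_congr h1, ← hD, hFz] at h2
  rw [← jetLower_congr h1, ← hD, hFz] at h3
  exact ⟨h2, h3⟩

theorem complexMatrix_chartDeriv_det_ne_zero (hφ : φ ∈ atlas (CSpace (m + 2)) M) (hz : z ∈ φ.target) :
    (complexMatrix (chartDeriv φ (φ.symm z))).det ≠ 0 :=
  complexMatrix_det_ne_zero_of_injective (chartDeriv_complexJ hφ (φ.map_target hz))
    (Function.LeftInverse.injective (g := chartSymmDeriv φ z) (chartSymmDeriv_chartDeriv_apply hφ hz))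

theorem det_jetForm_pos (hφ : φ ∈ atlas (CSpace (m + 2)) M) {q : CSpace (m + 2) × JetTuple (m + 2) (2 * 2)}
    (hq : q ∈ jetRegion (admissibleJets g) φ) : 0 < (cofMatrix (jetForm (metricIn g.metric φ) q.1 q.2)).det.re := by
  have h1 := (Complex.pos_iff.1 (posDef_formOfJet hq.2).det_pos).1
  have hdet := complexMatrix_chartDeriv_det_ne_zero hφ hq.1
  rw [(formOfJet_pullback hφ hq.1 q.2).1,
    det_cofMatrix_comp (chartDeriv_complexJ hφ (φ.map_target hq.1)) hdet] at h1
  exact pos_of_mul_pos_right h1 (by have := Complex.normSq_pos.2 hdet; positivity)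

theorem metricIn_bilinearComp (hφ : φ ∈ atlas (CSpace (m + 2)) M) (hz : z ∈ φ.target) :
    (metricIn g.metric φ z).bilinearComp (chartDeriv φ (φ.symm z)) (chartDeriv φ (φ.symm z)) =
      metricAt g.metric (φ.symm z) := by
  ext u w
  change metricAt g.metric (φ.symm z) (chartSymmDeriv φ z (chartDeriv φ (φ.symm z) u))
    (chartSymmDeriv φ z (chartDeriv φ (φ.symm z) w)) = _
  rw [chartSymmDeriv_chartDeriv_apply hφ hz, chartSymmDeriv_chartDeriv_apply hφ hz]

/-- The coordinate expression of the tensors `E₁` and `E₂` in an arbitrary chart. -/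
theorem coordContra_symbolAt (hφ : φ ∈ atlas (CSpace (m + 2)) M) {q : CSpace (m + 2) × JetTuple (m + 2) (2 * 2)}
    (hq : q ∈ jetRegion (admissibleJets g) φ) (k : Fin 2) (ξ η : Covec (m + 2)) :
    coordContra (symbolAt g k) φ ξ η q =
      symbols (metricIn g.metric φ q.1) (jetForm (metricIn g.metric φ) q.1 q.2) k ξ η := by
  rw [coordContra, symbolAt, (formOfJet_pullback hφ hq.1 q.2).1, ← metricIn_bilinearComp hφ hq.1]
  exact symbols_comp (det_jetForm_pos hφ hq) (chartDeriv_complexJ hφ (φ.map_target hq.1))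
    (complexMatrix_chartDeriv_det_ne_zero hφ hq.1) k ξ η

theorem contDiffAt_symbols_jetForm (hφ : φ ∈ atlas (CSpace (m + 2)) M)
    {q : CSpace (m + 2) × JetTuple (m + 2) (2 * 2)} (hq : q ∈ jetRegion (admissibleJets g) φ) (k : Fin 2)
    (ξ η : Covec (m + 2)) : ContDiffAt ℝ ∞ (fun q : CSpace (m + 2) × JetTuple (m + 2) (2 * 2) =>
      symbols (metricIn g.metric φ q.1) (jetForm (metricIn g.metric φ) q.1 q.2) k ξ η) q := by
  have hG := isHermitianAt_metricIn g hφ hq.1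
  exact contDiffAt_symbols (ContDiffAt.comp (g := metricIn g.metric φ) q hG.smooth contDiffAt_fst)
    (contDiffAt_jetForm (ψ := q.2) hG) (det_jetForm_pos hφ hq) k ξ η

theorem contDiffOn_coordContra_symbolAt (hφ : φ ∈ atlas (CSpace (m + 2)) M) (k : Fin 2) (ξ η : Covec (m + 2)) :
    ContDiffOn ℝ ∞ (coordContra (symbolAt g k) φ ξ η) (jetRegion (admissibleJets g) φ) :=
  ContDiffOn.congr (fun _ hq => (contDiffAt_symbols_jetForm hφ hq k ξ η).contDiffWithinAt)
    fun _ hq => coordContra_symbolAt hφ hq k ξ η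

theorem contDiffOn_coordFun_lowerAt (hφ : φ ∈ atlas (CSpace (m + 2)) M) :
    ContDiffOn ℝ ∞ (coordFun (lowerAt g) φ) (jetRegion (admissibleJets g) φ) :=
  ContDiffOn.congr (fun q hq => (contDiffAt_jetLower (ψ := q.2) (isHermitianAt_metricIn g hφ hq.1)
    (det_jetForm_pos hφ hq)).contDiffWithinAt) fun q hq =>
      (formOfJet_pullback hφ hq.1 q.2).2 (det_jetForm_pos hφ hq)

theorem symbolAt_pos (hψ : ψ ∈ admissibleJets g x) (k : Fin 2) {ξ : Covec (m + 2)} (hξ : ξ ≠ 0) :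
    0 < symbolAt g k x ψ ξ ξ :=
  symbols_pos (fun u w => g.metric.symm x u w) (g.invariant x) (fun u hu => g.metric.pos x u hu)
    (posDef_formOfJet hψ) k hξ

/-- A lower bound for the metric in a chart gives an upper bound for the dual norm. -/
theorem covecNormSq_le (hφ : φ ∈ atlas (CSpace (m + 2)) M) (hz : z ∈ φ.target) {c : ℝ} (hc : 0 < c)
    (h : ∀ u, c * ‖u‖ ^ 2 ≤ metricIn g.metric φ z u u) (ξ : Covec (m + 2)) :
    c * covecNormSq g.metric (φ.symm z) (ξ ∘L chartDeriv φ (φ.symm z)) ≤ ‖ξ‖ ^ 2 := by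
  rw [← le_div_iff₀' hc]
  refine csSup_le ⟨0, 0, by simp, by simp⟩ ?_
  rintro _ ⟨u, hu, rfl⟩
  rw [← metricIn_bilinearComp hφ hz] at hu
  have h1 := (h (chartDeriv φ (φ.symm z) u)).trans hu
  rw [le_div_iff₀' hc]
  have h2 : (ξ (chartDeriv φ (φ.symm z) u)) ^ 2 ≤ ‖ξ‖ ^ 2 * ‖chartDeriv φ (φ.symm z) u‖ ^ 2 := by
    rw [← mul_pow, ← sq_abs, ← Real.norm_eq_abs]
    gcongr
    exact ξ.le_opNorm _
  calc c * (ξ (chartDeriv φ (φ.symm z) u)) ^ 2 ≤ c * (‖ξ‖ ^ 2 * ‖chartDeriv φ (φ.symm z) u‖ ^ 2) := by gcongr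
    _ = ‖ξ‖ ^ 2 * (c * ‖chartDeriv φ (φ.symm z) u‖ ^ 2) := by ring
    _ ≤ ‖ξ‖ ^ 2 * 1 := by gcongr
    _ = ‖ξ‖ ^ 2 := mul_one _

/-- The tensors `E₁` and `E₂` are uniformly positive definite on compact sets. -/
theorem exists_ellipticity_constant (hφ : φ ∈ atlas (CSpace (m + 2)) M)
    {K : Set (CSpace (m + 2) × JetTuple (m + 2) (2 * 2))} (hK : K ⊆ jetRegion (admissibleJets g) φ)
    (hcK : IsCompact K) : ∃ lam : ℝ, 0 < lam ∧ ∀ k, ∀ q ∈ K, ∀ ξ : Covec (m + 2),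
      lam * covecNormSq g.metric (φ.symm q.1) ξ ≤
        symbolAt g k (φ.symm q.1) (q.2.pullback (chartDeriv φ (φ.symm q.1))) ξ ξ := by
  obtain ⟨c, hc, hcG⟩ := exists_pos_forall_mul_norm_sq_le (B := fun q : CSpace (m + 2) × JetTuple (m + 2) (2 * 2) =>
      metricIn g.metric φ q.1) hcK (fun u w q hq => by
    have h1 : ContDiffAt ℝ ∞ (fun q : CSpace (m + 2) × JetTuple (m + 2) (2 * 2) => metricIn g.metric φ q.1) q :=
      ContDiffAt.comp (g := metricIn g.metric φ) q (isHermitianAt_metricIn g hφ (hK hq).1).smooth contDiffAt_fst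
    exact ((h1.clm_apply contDiffAt_const).clm_apply contDiffAt_const).continuousAt.continuousWithinAt)
    fun q hq => (isHermitianAt_metricIn g hφ (hK hq).1).pos.self_of_nhds
  have hS : ∀ k : Fin 2, ∃ d : ℝ, 0 < d ∧ ∀ q ∈ K, ∀ ξ, d * ‖ξ‖ ^ 2 ≤
      symbols (metricIn g.metric φ q.1) (jetForm (metricIn g.metric φ) q.1 q.2) k ξ ξ := fun k =>
    exists_pos_forall_mul_norm_sq_le (B := fun q : CSpace (m + 2) × JetTuple (m + 2) (2 * 2) =>
      symbols (metricIn g.metric φ q.1) (jetForm (metricIn g.metric φ) q.1 q.2) k) hcK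
      (fun ξ η q hq => (contDiffAt_symbols_jetForm hφ (hK hq) k ξ η).continuousAt.continuousWithinAt)
      fun q hq ξ hξ => by
        rw [← coordContra_symbolAt hφ (hK hq)]
        refine symbolAt_pos (hK hq).2 k fun h => hξ ?_
        ext u
        have h1 := congrArg (fun ζ : Covec (m + 2) => ζ (chartSymmDeriv φ q.1 u)) h
        exact (congrArg ξ (chartDeriv_chartSymmDeriv_apply hφ (hK hq).1 u)).symm.trans h1
  choose d hd hdS using hS
  refine ⟨c * min (d 0) (d 1), mul_pos hc (lt_min (hd 0) (hd 1)), fun k q hq ξ => ?_⟩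
  have hz := (hK hq).1
  have hdk : min (d 0) (d 1) ≤ d k := by
    fin_cases k
    · exact min_le_left _ _
    · exact min_le_right _ _
  -- every covector at the point is the pull-back of a covector in the chart
  obtain ⟨ζ, rfl⟩ : ∃ ζ : Covec (m + 2), ξ = ζ ∘L chartDeriv φ (φ.symm q.1) :=
    ⟨ξ ∘L chartSymmDeriv φ q.1, by
      ext u
      exact (congrArg ξ (chartSymmDeriv_chartDeriv_apply hφ hz u)).symm⟩
  calc c * min (d 0) (d 1) * covecNormSq g.metric (φ.symm q.1) (ζ ∘L chartDeriv φ (φ.symm q.1))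
      = min (d 0) (d 1) * (c * covecNormSq g.metric (φ.symm q.1) (ζ ∘L chartDeriv φ (φ.symm q.1))) := by ring
    _ ≤ min (d 0) (d 1) * ‖ζ‖ ^ 2 :=
      mul_le_mul_of_nonneg_left (covecNormSq_le hφ hz hc (hcG q hq) ζ) (lt_min (hd 0) (hd 1)).le
    _ ≤ d k * ‖ζ‖ ^ 2 := by gcongr
    _ ≤ _ := hdS k q hq ζ
    _ = _ := (coordContra_symbolAt hφ (hK hq) k ζ ζ).symm

end Coefficients

end

theorem mainTheorem4 {m : ℕ} {M : Type*} [TopologicalSpace M] [ChartedSpace (CSpace (m + 2)) M]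
    [IsManifold 𝓘(ℂ, CSpace (m + 2)) ω M] (g : HermitianMetric (m + 2) M) :
    (∀ v ∈ admissibleFunctions g, ∃! h : HermitianMetric (m + 2) M, IsInducedMetric g v h) ∧
    IsQuasilinearElliptic g.metric 2 (admissibleFunctions g) (admissibleJets g)
      (scalarOperator g) :=
  ⟨fun _ hv => existsUnique_isInducedMetric hv, fun _ hv x => jetAt_mem_admissibleJets hv x,
    symbolAt g, lowerAt g, fun _ hv x => scalarOperator_eq hv x,
    fun _ hφ => ⟨fun k ξ η => contDiffOn_coordContra_symbolAt hφ k ξ η, contDiffOn_coordFun_lowerAt hφ⟩,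
    fun _ hφ _ hK hcK => exists_ellipticity_constant hφ hK hcK⟩
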